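/- Let $(M,g)$ be an oriented Lorentzian $d$-manifold with Hodge operator $\ast$, normalised by $\alpha\wedge\ast\beta=\langle\alpha,\beta\rangle\,\mathrm{vol}_g$. Let $\mathfrak k$ be a Lie algebra of Killing vector fields of $(M,g)$, acting on differential forms by the Lie derivative, and let $\mathfrak g$ be an arbitrary real Lie algebra. For $\mathfrak g$-valued forms put $[\alpha\otimes x,\beta\otimes y]=(\alpha\wedge\beta)\otimes[x,y]$; the Lie derivative acts on the form factor only. Coefficients of formal power series in $\hbar$ are complexified. Let $\mathcal F\in(U\mathfrak k\otimes U\mathfrak k)[[\hbar]]$ be a Drinfel'd twist: $\mathcal F$ is invertible, $\mathcal F_{12}\,(\Delta\otimes\mathrm{id})\mathcal F=\mathcal F_{23}\,(\mathrm{id}\otimes\Delta)\mathcal F$, and $\mathcal F=1\otimes1+O(\hbar)$. Let $\mathcal R=\mathcal F_{21}\mathcal F^{-1}=\mathsf R^k\otimes\mathsf R_k$ (sum over $k$ understood), $v\otimes_\star w=\mathcal F^{-1}(v\otimes w)$ and $[v,w]^\star=[\,\cdot\,,\cdot\,](v\otimes_\star w)$. The Yang–Mills $L_\infty$-algebra has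 underlying graded space $\Omega^0(M,\mathfrak g)\oplus\Omega^1(M,\mathfrak g)\oplus\Omega^{d-1}(M,\mathfrak g)\oplus\Omega^d(M,\mathfrak g)$, and among its brackets those on gauge parameters $\lambda\in\Omega^0$ and gauge fields $A_i\in\Omega^1$ which enter below are $$\ell_1(\lambda)=d\lambda,\qquad \ell_1(A)=d\ast dA,\qquad \ell_2(\lambda,A)=-[\lambda,A],$$ $$\ell_2(A_1,A_2)=-d\ast[A_1,A_2]-[A_1,\ast dA_2]+(-1)^d[\ast dA_1,A_2],$$ $$\ell_3(A_1,A_2,A_3)=-[A_1,\ast[A_2,A_3]]-[A_2,\ast[A_1,A_3]]+(-1)^d[\ast[A_1,A_2],A_3].$$ The braided brackets are $\ell_1^\star=\ell_1$ and $\ell_n^\star(v_1,\dots,v_n)=\ell_n(v_1\otimes_\star\cdots\otimes_\star v_n)$. For $A\in\Omega^1(M,\mathfrak g)[[\hbar]]$ let $$\mathfrak F^\star_A=\ell_1^\star(A)-\tfrac12\,\ell_2^\star(A,A)-\tfrac16\,\ell_3^\star(A,A,A)$$ be the braided Maurer–Cartan element, $F^{\mathcal R}_A=dA+\tfrac12[A,A]^\star$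 the braided curvature, and $d^A_{\star L}\phi=d\phi+[A,\phi]^\star$, $d^A_{\star R}\phi=d\phi+[\mathsf R_kA,\mathsf R^k\phi]^\star$ the left and right braided covariant derivatives. For $\lambda\in\Omega^0(M,\mathfrak g)[[\hbar]]$, the braided gauge variation $\delta_\lambda$ is determined on expressions in $A$ by $\delta_\lambda A=\ell_1^\star(\lambda)+\ell_2^\star(\lambda,A)=d\lambda-[\lambda,A]^\star$, by the braided Leibniz rule $\delta_\lambda(v\otimes_\star w)=\delta_\lambda v\otimes_\star w+\mathsf R_kv\otimes_\star\delta_{\mathsf R^k\lambda}w$, and by commuting with the $\mathfrak k$-equivariant linear maps $d$, $\ast$, $[\,\cdot\,,\cdot\,]$ and with flips of the underlying classical tensor factors (so that $\delta_\lambda$ is applied to the braided flip $\mathsf R_kA\otimes_\star\mathsf R^kA$ by flipping $\delta_\lambda(A\otimes_\star A)$). Then: 1. (Braided Yang–Mills equations.) $$\mathfrak F^\star_A=\tfrac12\big(d^A_{\star L}\ast F^{\mathcal R}_A+d^A_{\star R}\ast F^{\mathcal R}_A\big)+Z_A,$$ $$Z_A=\tfrac16\big[\mathsf R_kA,\ast[\mathsf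 R^kA,A]^\star\big]^\star-\tfrac1{12}\big[A,\ast[A,A]^\star\big]^\star+\tfrac{(-1)^d}{12}\big[\ast[A,A]^\star,A\big]^\star .$$ 2. (Classical limit.) The $\hbar^0$-coefficient of $Z_A$ vanishes, and $Z_A=0$ whenever $\mathcal R=1\otimes1$. 3. (Braided covariance.) For every $\lambda\in\Omega^0(M,\mathfrak g)[[\hbar]]$, $$\delta_\lambda\mathfrak F^\star_A=-[\lambda,\mathfrak F^\star_A]^\star,\qquad \delta_\lambda Z_A=-[\lambda,Z_A]^\star .$$ -/

import Mathlib

open scoped Manifold ContDiff TensorProduct Topology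

noncomputable section

namespace BraidedYM

section Cartan

variable (C : Type*) [CommRing C] [Algebra ℝ C]

/-- Vector fields, as derivations of the algebra `C` of functions. -/
abbrev VField : Type _ := Derivation ℝ C C

/-- Differential `k`-forms, as alternating `C`-multilinear maps on vector fields. -/
abbrev DForm (k : ℕ) : Type _ := (VField C) [⋀^Fin k]→ₗ[C] C

variable {C}

theorem lie_smul_field (X Y : VField C) (f : C) : ⁅X, f • Y⁆ = f • ⁅X, Y⁆ + X f • Y := by
  ext a
  simp [Derivation.commutator_apply, mul_sub]

theorem smul_lie_field (X Y : VField C) (f : C) : ⁅f • X, Y⁆ = f • ⁅X, Y⁆ - Y f • X := by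
  ext a
  simp [Derivation.commutator_apply, mul_sub]
  ring

/-- The Lie derivative
`(L_X α) (V₁, …, V_k) = X (α (V₁, …, V_k)) - ∑ᵢ α (V₁, …, [X, Vᵢ], …, V_k)`. -/
def lieDeriv {k : ℕ} (X : VField C) (α : DForm C k) : DForm C k where
  toFun V := X (α V) - ∑ i, α (Function.update V i ⁅X, V i⁆)
  map_update_add' := by
    intro inst V j Y Z
    obtain rfl : inst = instDecidableEqFin k := Subsingleton.elim _ _
    have key : ∀ i, α (Function.update (Function.update V j (Y + Z)) i
          ⁅X, (Function.update V j (Y + Z)) i⁆)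
        = α (Function.update (Function.update V j Y) i ⁅X, (Function.update V j Y) i⁆)
        + α (Function.update (Function.update V j Z) i ⁅X, (Function.update V j Z) i⁆) := by
      intro i
      by_cases h : i = j
      · subst h; simp [lie_add]
      · simp only [Function.update_of_ne h, Function.update_comm (Ne.symm h)]
        exact α.map_update_add _ _ _ _
    simp only [key, Finset.sum_add_distrib, α.map_update_add, map_add]
    ring
  map_update_smul' := by
    intro inst V j f Y
    obtain rfl : inst = instDecidableEqFin k := Subsingleton.elim _ _
    have key : ∀ i, α (Function.update (Function.update V j (f • Y)) i
          ⁅X, (Function.update V j (f • Y)) i⁆)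
        = f * α (Function.update (Function.update V j Y) i ⁅X, (Function.update V j Y) i⁆)
          + if i = j then X f * α (Function.update V j Y) else 0 := by
      intro i
      by_cases h : i = j
      · subst h; simp [lie_smul_field, α.map_update_add, α.map_update_smul]
      · simp only [Function.update_of_ne h, Function.update_comm (Ne.symm h), h, if_false,
          add_zero]
        exact α.map_update_smul _ _ _ _
    simp only [key, Finset.sum_add_distrib, α.map_update_smul, smul_eq_mul, Derivation.leibniz,
      ← Finset.mul_sum, Finset.sum_ite_eq', Finset.mem_univ, if_true]
    ring
  map_eq_zero_of_eq' := by
    intro V i j hV hij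
    simp only [α.map_eq_zero_of_eq V hV hij, map_zero, zero_sub, neg_eq_zero]
    rw [Fintype.sum_eq_add i j hij]
    · have hsw : Function.update V j ⁅X, V j⁆
          = Function.update V i ⁅X, V i⁆ ∘ Equiv.swap i j := by
        funext l
        by_cases h1 : l = i
        · subst h1; simp [hij, hij.symm, hV]
        · by_cases h2 : l = j
          · subst h2; simp [hV]
          · simp [h1, h2, Equiv.swap_apply_of_ne_of_ne h1 h2]
      rw [hsw, α.map_swap _ hij, add_neg_cancel]
    · rintro l ⟨h1, h2⟩
      apply α.map_eq_zero_of_eq _ _ hij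
      simp [Function.update_of_ne h1.symm, Function.update_of_ne h2.symm, hV]

theorem lieDeriv_apply {k : ℕ} (X : VField C) (α : DForm C k) (V : Fin k → VField C) :
    lieDeriv X α V = X (α V) - ∑ i, α (Function.update V i ⁅X, V i⁆) := rfl

instance instLieRingModuleDForm (k : ℕ) : LieRingModule (VField C) (DForm C k) where
  bracket X α := lieDeriv X α
  add_lie X Y α := by
    ext V
    simp [lieDeriv_apply, add_lie, Finset.sum_add_distrib]
    ring
  lie_add X α β := by
    ext V
    simp [lieDeriv_apply, Finset.sum_add_distrib]
    ring
  leibniz_lie X Y α := by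
    ext V
    have key : ∀ X Y : VField C, lieDeriv X (lieDeriv Y α) V
        = X (Y (α V)) - ∑ i, X (α (Function.update V i ⁅Y, V i⁆))
          - ∑ i, Y (α (Function.update V i ⁅X, V i⁆))
          + ∑ i, α (Function.update V i ⁅Y, ⁅X, V i⁆⁆)
          + ∑ i, ∑ j, if i = j then 0 else
              α (Function.update (Function.update V i ⁅X, V i⁆) j ⁅Y, V j⁆) := by
      intro X Y
      have h : ∀ i, (lieDeriv Y α) (Function.update V i ⁅X, V i⁆)
          = Y (α (Function.update V i ⁅X, V i⁆)) - α (Function.update V i ⁅Y, ⁅X, V i⁆⁆)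
            - ∑ j, if i = j then 0 else
              α (Function.update (Function.update V i ⁅X, V i⁆) j ⁅Y, V j⁆) := by
        intro i
        rw [lieDeriv_apply, sub_sub]
        congr 1
        rw [← Finset.add_sum_erase _ _ (Finset.mem_univ i),
          ← Finset.add_sum_erase (a := i) (f := fun j => if i = j then 0 else _) _
            (Finset.mem_univ i)]
        simp only [Function.update_self, Function.update_idem, if_true, zero_add]
        congr 1
        refine Finset.sum_congr rfl fun j hj => ?_
        have hj' : j ≠ i := Finset.ne_of_mem_erase hj
        simp [hj', hj'.symm]
      rw [lieDeriv_apply, lieDeriv_apply]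
      simp only [h, map_sub, map_sum, Finset.sum_sub_distrib]
      ring
    have hsym : ∑ i, ∑ j, (if i = j then 0 else
          α (Function.update (Function.update V i ⁅X, V i⁆) j ⁅Y, V j⁆))
        = ∑ i, ∑ j, (if i = j then 0 else
          α (Function.update (Function.update V i ⁅Y, V i⁆) j ⁅X, V j⁆)) := by
      rw [Finset.sum_comm]
      refine Finset.sum_congr rfl fun i _ => Finset.sum_congr rfl fun j _ => ?_
      by_cases h : i = j
      · simp [h]
      · simp only [h, Ne.symm h, if_false, Function.update_comm (Ne.symm h)]
    change lieDeriv X (lieDeriv Y α) V = (lieDeriv ⁅X, Y⁆ α + lieDeriv Y (lieDeriv X α)) V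
    rw [AlternatingMap.add_apply, key X Y, key Y X, hsym, lieDeriv_apply]
    have hb : ∀ i, α (Function.update V i ⁅⁅X, Y⁆, V i⁆)
        = α (Function.update V i ⁅X, ⁅Y, V i⁆⁆) - α (Function.update V i ⁅Y, ⁅X, V i⁆⁆) := by
      intro i
      rw [lie_lie, α.map_update_sub]
    simp only [hb, Finset.sum_sub_distrib, Derivation.commutator_apply]
    ring

theorem lie_dform {k : ℕ} (X : VField C) (α : DForm C k) : ⁅X, α⁆ = lieDeriv X α := rfl

instance instLieModuleDForm (k : ℕ) : LieModule ℝ (VField C) (DForm C k) where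
  smul_lie t X α := by
    ext V
    simp only [lie_dform, lieDeriv_apply, AlternatingMap.smul_apply, Derivation.coe_smul,
      Pi.smul_apply, smul_sub, smul_lie, Finset.smul_sum]
    congr 1
    refine Finset.sum_congr rfl fun i _ => ?_
    rw [← algebraMap_smul C t, α.map_update_smul, algebraMap_smul]
  lie_smul t X α := by
    ext V
    simp [lie_dform, lieDeriv_apply, smul_sub, Finset.smul_sum]

/-- The Koszul formula
`∑ᵢ (-1)ⁱ Vᵢ (α (…, V̂ᵢ, …)) + ∑_{i < j} (-1)^{i + j} α ([Vᵢ, Vⱼ], …, V̂ᵢ, …, V̂ⱼ, …)`,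
with each bracket `[Vᵢ, Vⱼ]` counted twice with weight `1/2` and put into the slot of `Vⱼ`. -/
def extDAux {k : ℕ} (α : DForm C k) (V : Fin (k + 1) → VField C) : C :=
  ∑ i : Fin (k + 1), (-1 : ℤ) ^ (i : ℕ) •
    (V i (α (i.removeNth V)) -
      (1 / 2 : ℝ) • ∑ j, α (Function.update (i.removeNth V) j ⁅V i, i.removeNth V j⁆))

/-- The summand of `extDAux` that is attached to one vector field, as a real multilinear map. -/
def extDLin {k : ℕ} (α : DForm C k) : VField C →ₗ[ℝ] VField C [⋀^Fin k]→ₗ[ℝ] C where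
  toFun X :=
    { toFun := fun V => X (α V) - (1 / 2 : ℝ) • ∑ j, α (Function.update V j ⁅X, V j⁆)
      map_update_add' := by
        intro inst V j Y Z
        have h := (lieDeriv X α).map_update_add V j Y Z
        have h' := α.map_update_add V j Y Z
        rw [lieDeriv_apply, lieDeriv_apply, lieDeriv_apply, h', map_add] at h
        have h2 := congrArg (fun t => (1 / 2 : ℝ) • t) h
        simp only [smul_sub, smul_add] at h2
        rw [h', map_add]
        linear_combination h2
      map_update_smul' := by
        intro inst V j t Y
        have h := (lieDeriv X α).map_update_smul V j (algebraMap ℝ C t) Y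
        have h' := α.map_update_smul V j (algebraMap ℝ C t) Y
        simp only [algebraMap_smul] at h h'
        rw [lieDeriv_apply, lieDeriv_apply, h', X.map_smul] at h
        have h2 := congrArg (fun t => (1 / 2 : ℝ) • t) h
        simp only [smul_sub] at h2
        rw [h', X.map_smul, smul_sub]
        rw [smul_comm t (1 / 2 : ℝ)]
        linear_combination h2
      map_eq_zero_of_eq' := by
        intro V i j hV hij
        have h := (lieDeriv X α).map_eq_zero_of_eq V hV hij
        have h' := α.map_eq_zero_of_eq V hV hij
        rw [lieDeriv_apply, h', map_zero, zero_sub, neg_eq_zero] at h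
        simp only [h, h', map_zero, smul_zero, sub_zero] }
  map_add' X Y := by
    ext V
    simp [add_lie, Finset.sum_add_distrib, α.map_update_add]
    ring
  map_smul' t X := by
    ext V
    have : ∀ j, α (Function.update V j (t • ⁅X, V j⁆)) = t • α (Function.update V j ⁅X, V j⁆) := by
      intro j
      rw [← algebraMap_smul C t, α.map_update_smul, algebraMap_smul]
    simp [this, smul_sub, ← Finset.smul_sum, smul_comm t]

theorem extDLin_apply {k : ℕ} (α : DForm C k) (X : VField C) (V : Fin k → VField C) :
    extDLin α X V = X (α V) - (1 / 2 : ℝ) • ∑ j, α (Function.update V j ⁅X, V j⁆) := rfl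

theorem extDAux_eq {k : ℕ} (α : DForm C k) (V : Fin (k + 1) → VField C) :
    extDAux α V = AlternatingMap.alternatizeUncurryFin (extDLin α) V := by
  rw [AlternatingMap.alternatizeUncurryFin_apply]
  refine Finset.sum_congr rfl fun i _ => ?_
  rw [extDLin_apply]


theorem extDAux_update_smul {k : ℕ} (α : DForm C k) (V : Fin (k + 1) → VField C)
    (p : Fin (k + 1)) (f : C) (Y : VField C) :
    extDAux α (Function.update V p (f • Y)) = f * extDAux α (Function.update V p Y) := by
  have half : ∀ x : C, x - (1 / 2 : ℝ) • x = (1 / 2 : ℝ) • x := by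
    intro x
    rw [sub_eq_iff_eq_add, ← add_smul]
    norm_num
  have hp : p.removeNth (Function.update V p (f • Y)) = p.removeNth V ∧
      p.removeNth (Function.update V p Y) = p.removeNth V :=
    ⟨Fin.removeNth_update p _ V, Fin.removeNth_update p _ V⟩
  unfold extDAux
  rw [Fin.sum_univ_succAbove _ p, Fin.sum_univ_succAbove _ p, hp.1, hp.2, mul_add,
    Finset.mul_sum]
  simp only [Function.update_self]
  have h1 : (f • Y) (α (p.removeNth V))
      - (1 / 2 : ℝ) • ∑ q, α (Function.update (p.removeNth V) q ⁅f • Y, p.removeNth V q⁆)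
      = f * (Y (α (p.removeNth V))
        - (1 / 2 : ℝ) • ∑ q, α (Function.update (p.removeNth V) q ⁅Y, p.removeNth V q⁆))
        + (1 / 2 : ℝ) • ∑ q, p.removeNth V q f * α (Function.update (p.removeNth V) q Y) := by
    simp only [smul_lie_field, α.map_update_sub, α.map_update_smul, Finset.sum_sub_distrib,
      smul_eq_mul, ← Finset.mul_sum, smul_sub, mul_sub, Derivation.coe_smul, Pi.smul_apply,
      mul_smul_comm]
    ring
  have h2 : ∀ q : Fin k, (-1 : ℤ) ^ ((p.succAbove q : Fin (k + 1)) : ℕ) •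
      (Function.update V p (f • Y) (p.succAbove q)
          (α ((p.succAbove q).removeNth (Function.update V p (f • Y))))
        - (1 / 2 : ℝ) • ∑ j, α (Function.update
            ((p.succAbove q).removeNth (Function.update V p (f • Y))) j
            ⁅Function.update V p (f • Y) (p.succAbove q),
              (p.succAbove q).removeNth (Function.update V p (f • Y)) j⁆))
      = f * ((-1 : ℤ) ^ ((p.succAbove q : Fin (k + 1)) : ℕ) •
      (Function.update V p Y (p.succAbove q)
          (α ((p.succAbove q).removeNth (Function.update V p Y)))
        - (1 / 2 : ℝ) • ∑ j, α (Function.update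
            ((p.succAbove q).removeNth (Function.update V p Y)) j
            ⁅Function.update V p Y (p.succAbove q),
              (p.succAbove q).removeNth (Function.update V p Y) j⁆)))
        - (-1 : ℤ) ^ (p : ℕ) • (1 / 2 : ℝ) •
          (p.removeNth V q f * α (Function.update (p.removeNth V) q Y)) := by
    intro q
    have hne : p.succAbove q ≠ p := Fin.succAbove_ne p q
    obtain ⟨r, hr⟩ := Fin.exists_succAbove_eq hne.symm
    have hrem : ∀ Z : VField C, (p.succAbove q).removeNth (Function.update V p Z)
        = Function.update ((p.succAbove q).removeNth V) r Z := by
      intro Z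
      have := Fin.removeNth_update_succAbove (p.succAbove q) r Z V
      rw [hr] at this
      exact this
    simp only [hrem, Function.update_of_ne hne]
    set X := V (p.succAbove q) with hX
    set W := (p.succAbove q).removeNth V with hW
    have hl : X (α (Function.update W r (f • Y)))
        - (1 / 2 : ℝ) • ∑ j, α (Function.update (Function.update W r (f • Y)) j
            ⁅X, Function.update W r (f • Y) j⁆)
        = f * (X (α (Function.update W r Y))
        - (1 / 2 : ℝ) • ∑ j, α (Function.update (Function.update W r Y) j
            ⁅X, Function.update W r Y j⁆))
          + (1 / 2 : ℝ) • (X f * α (Function.update W r Y)) := by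
      have h := (lieDeriv X α).map_update_smul W r f Y
      rw [lieDeriv_apply, lieDeriv_apply, α.map_update_smul, smul_eq_mul, smul_eq_mul,
        X.leibniz] at h
      rw [α.map_update_smul, smul_eq_mul, X.leibniz]
      simp only [smul_eq_mul] at h ⊢
      have h3 : ∑ i, α (Function.update (Function.update W r (f • Y)) i
            ⁅X, Function.update W r (f • Y) i⁆)
          = f * ∑ j, α (Function.update (Function.update W r Y) j ⁅X, Function.update W r Y j⁆)
            + X f * α (Function.update W r Y) := by
        linear_combination -h
      rw [h3, smul_add, mul_sub, mul_smul_comm]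
      linear_combination half (X f * α (Function.update W r Y))
    have hs : (-1 : ℤ) ^ ((p.succAbove q : Fin (k + 1)) : ℕ) • α (Function.update W r Y)
        = - ((-1 : ℤ) ^ (p : ℕ) • α (Function.update (p.removeNth V) q Y)) := by
      have h := α.neg_one_pow_smul_map_removeNth_add_eq_zero_of_eq
        (v := Function.update (Function.update V p Y) (p.succAbove q) Y)
        (i := p.succAbove q) (j := p) (by simp [Function.update_of_ne hne.symm]) hne
      rw [Fin.removeNth_update, hrem, Function.update_comm hne.symm,
        Fin.removeNth_update, Fin.removeNth_update_succAbove] at h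
      exact eq_neg_of_add_eq_zero_left h
    rw [hl, smul_add, smul_comm _ (1 / 2 : ℝ), ← mul_smul_comm _ (X f), hs]
    simp only [mul_neg, smul_neg, mul_smul_comm, Fin.removeNth, hX, smul_comm _ (1 / 2 : ℝ)]
    ring
  rw [h1, Finset.sum_congr rfl fun q _ => h2 q, Finset.sum_sub_distrib, smul_add,
    Finset.smul_sum, ← Finset.smul_sum, ← Finset.smul_sum, mul_smul_comm]
  simp only [smul_comm _ (1 / 2 : ℝ), Finset.smul_sum]
  ring

/-- The exterior derivative of a `k`-form. -/
def extD {k : ℕ} (α : DForm C k) : DForm C (k + 1) where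
  toFun := extDAux α
  map_update_add' := by
    intro inst V j Y Z
    simp only [extDAux_eq]
    exact AlternatingMap.map_update_add _ V j Y Z
  map_update_smul' := by
    intro inst V j f Y
    obtain rfl : inst = instDecidableEqFin (k + 1) := Subsingleton.elim _ _
    exact extDAux_update_smul α V j f Y
  map_eq_zero_of_eq' := by
    intro V i j hV hij
    rw [extDAux_eq]
    exact AlternatingMap.map_eq_zero_of_eq _ V hV hij

end Cartan

section Wedge

variable (C : Type*) [CommRing C] [Algebra ℝ C]

/-- The degree `n` component of the wedge product of a `p`-form and a `q`-form
(zero unless `p + q = n`), with the shuffle normalisation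
`(α ∧ β) (X₁, …, X_{p+q}) = ∑ sign σ α (X_{σ 1}, …) β (X_{σ (p+1)}, …)`
over `(p, q)`-shuffles `σ`. -/
def wedge (p q n : ℕ) : DForm C p →ₗ[C] DForm C q →ₗ[C] DForm C n :=
  if h : p + q = n then
    (TensorProduct.mk C (DForm C p) (DForm C q)).compr₂
      ((AlternatingMap.domDomCongrₗ C (finSumFinEquiv.trans (finCongr h))).toLinearMap ∘ₗ
        (LinearMap.mul' C C).compAlternatingMapₗ C ∘ₗ AlternatingMap.domCoprod')
  else 0

variable {C}

theorem extD_apply {k : ℕ} (α : DForm C k) (V : Fin (k + 1) → VField C) :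
    extD α V = ∑ i : Fin (k + 1), (-1 : ℤ) ^ (i : ℕ) •
      (V i (α (i.removeNth V)) -
        (1 / 2 : ℝ) • ∑ j, α (Function.update (i.removeNth V) j ⁅V i, i.removeNth V j⁆)) := rfl

variable (C)

/-- The exterior derivative as a linear map with values in `n`-forms (zero unless `k + 1 = n`). -/
def extDLinear (k n : ℕ) : DForm C k →ₗ[ℝ] DForm C n :=
  if h : k + 1 = n then
    (AlternatingMap.domDomCongrₗ ℝ (finCongr h)).toLinearMap ∘ₗ
      { toFun := extD
        map_add' := fun α β => by
          ext V
          simp [extD_apply, Finset.sum_add_distrib, smul_add, add_sub_add_comm]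
        map_smul' := fun t α => by
          ext V
          simp [extD_apply, ← Finset.smul_sum, smul_comm _ t, ← smul_sub] }
  else 0

/-- The `m`-form `V₁♭ ∧ ⋯ ∧ V_m♭` for a bilinear form `g`, that is,
`(V₁♭ ∧ ⋯ ∧ V_m♭) (Z₁, …, Z_m) = det (g (V_a, Z_b))`. -/
def flatWedgeAux (g : VField C →ₗ[C] VField C →ₗ[C] C) {m : ℕ} (V : Fin m → VField C) :
    DForm C m :=
  Matrix.detRowAlternating.compLinearMap (LinearMap.pi fun a => g (V a))

theorem flatWedgeAux_apply (g : VField C →ₗ[C] VField C →ₗ[C] C) {m : ℕ}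
    (V Z : Fin m → VField C) :
    flatWedgeAux C g V Z = Matrix.det (Matrix.of fun b a => g (V a) (Z b)) := rfl

theorem flatWedgeAux_update (g : VField C →ₗ[C] VField C →ₗ[C] C) {m : ℕ}
    [DecidableEq (Fin m)] (V : Fin m → VField C) (i : Fin m) (X : VField C)
    (Z : Fin m → VField C) :
    flatWedgeAux C g (Function.update V i X) Z
      = Matrix.det (Matrix.updateCol (Matrix.of fun b a => g (V a) (Z b)) i
        (fun b => g X (Z b))) := by
  rw [flatWedgeAux_apply]
  congr 1
  ext b a
  by_cases h : a = i
  · subst h; simp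
  · simp [h]

/-- `V ↦ V₁♭ ∧ ⋯ ∧ V_m♭` as an alternating map. -/
def flatWedge (g : VField C →ₗ[C] VField C →ₗ[C] C) (m : ℕ) :
    VField C [⋀^Fin m]→ₗ[C] DForm C m where
  toFun V := flatWedgeAux C g V
  map_update_add' V i X Y := by
    ext Z
    rw [AlternatingMap.add_apply, flatWedgeAux_update, flatWedgeAux_update, flatWedgeAux_update,
      map_add, ← Matrix.det_updateCol_add]
    rfl
  map_update_smul' V i c X := by
    ext Z
    rw [AlternatingMap.smul_apply, flatWedgeAux_update, flatWedgeAux_update, map_smul,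
      smul_eq_mul, ← Matrix.det_updateCol_smul]
    rfl
  map_eq_zero_of_eq' V i j hV hij := by
    ext Z
    exact Matrix.det_zero_of_column_eq hij fun k => by simp [hV]

end Wedge

section Manifold

/-- Smooth real functions on a `d`-dimensional manifold. -/
abbrev Fn (d : ℕ) (M : Type*) [TopologicalSpace M] [ChartedSpace (EuclideanSpace ℝ (Fin d)) M] :
    Type _ :=
  C^∞⟮𝓘(ℝ, EuclideanSpace ℝ (Fin d)), M; ℝ⟯

variable (d : ℕ) (M : Type*) [TopologicalSpace M] [ChartedSpace (EuclideanSpace ℝ (Fin d)) M]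

variable {d M} in
theorem fn_sum_apply {ι : Type*} (s : Finset ι) (f : ι → Fn d M) (y : M) :
    (∑ i ∈ s, f i) y = ∑ i ∈ s, f i y :=
  map_sum (ContMDiffMap.evalRingHom (n := ∞) y : Fn d M →+* ℝ) f s

variable {d M} in
theorem fn_det_apply {ι : Type*} [Fintype ι] [DecidableEq ι] (A : Matrix ι ι (Fn d M)) (y : M) :
    A.det y = Matrix.det (Matrix.of fun i j => A i j y) :=
  RingHom.map_det (ContMDiffMap.evalRingHom (n := ∞) y : Fn d M →+* ℝ) A

/-- The Minkowski signs `(-1, 1, …, 1)`. -/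
def eta {d : ℕ} (i : Fin d) : ℝ := if i.val = 0 then -1 else 1

/-- A Lorentzian metric on `M` together with an orientation, given by the metric volume form. -/
structure OrientedLorentzian where
  g : VField (Fn d M) →ₗ[Fn d M] VField (Fn d M) →ₗ[Fn d M] Fn d M
  symm : ∀ X Y, g X Y = g Y X
  exists_frame : ∀ x : M, ∃ e : Fin d → VField (Fn d M), ∃ U ∈ 𝓝 x, ∀ y ∈ U,
    (∀ i j, g (e i) (e j) y = if i = j then eta i else 0) ∧
    ∀ (X : VField (Fn d M)) (f : Fn d M), X f y = ∑ i, eta i * g X (e i) y * e i f y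
  vol : DForm (Fn d M) d
  vol_mul_vol : ∀ X Y, vol X * vol Y = -Matrix.det (Matrix.of fun i j => g (X i) (Y j))

variable {d M}

namespace OrientedLorentzian

variable (S : OrientedLorentzian d M)

theorem form_eq_det [IsManifold 𝓘(ℝ, EuclideanSpace ℝ (Fin d)) ∞ M] [T2Space M]
    (α : DForm (Fn d M) d) (e : Fin d → VField (Fn d M)) (U : Set M) 
    (he : ∀ y ∈ U, ∀ (X : VField (Fn d M)) (f : Fn d M),
      X f y = ∑ i, eta i * S.g X (e i) y * e i f y)
    (y : M) (hy : U ∈ 𝓝 y) (X : Fin d → VField (Fn d M)) :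
    α X y = Matrix.det (Matrix.of fun j i => eta i • S.g (X j) (e i)) y * α e y := by
  obtain ⟨χ, -, hχ⟩ := (SmoothBumpFunction.nhds_basis_support
    (I := 𝓘(ℝ, EuclideanSpace ℝ (Fin d))) (c := y) hy).mem_iff.1 hy
  let f : Fn d M := ⟨χ, χ.contMDiff⟩
  have hf : f y = 1 := χ.eq_one
  have key : ∀ j, f • X j = f • ∑ i, (eta i • S.g (X j) (e i)) • e i := by
    intro j
    ext h z
    by_cases hz : z ∈ U
    · have hs : (∑ i, (eta i • S.g (X j) (e i)) • e i) h
          = ∑ i, (eta i • S.g (X j) (e i)) * e i h := by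
        rw [← Derivation.coeFnAddMonoidHom_apply]
        simp
      rw [Derivation.smul_apply, Derivation.smul_apply, hs, smul_eq_mul, smul_eq_mul]
      rw [ContMDiffMap.coe_mul, ContMDiffMap.coe_mul, Pi.mul_apply, Pi.mul_apply, he z hz (X j) h, fn_sum_apply]
      simp [mul_assoc]
    · have : f z = 0 := by
        by_contra h0
        exact hz (hχ h0)
      simp [this]
  let c : Matrix (Fin d) (Fin d) (Fn d M) := Matrix.of fun j i => eta i • S.g (X j) (e i)
  have h2 : α (fun j => ∑ i, c j i • e i) = c.det * α e := by
    let L : (Fin d → Fn d M) →ₗ[Fn d M] VField (Fn d M) :=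
      Fintype.linearCombination (Fn d M) e
    have h3 := (α.compLinearMap L).eq_smul_basis_det (Pi.basisFun (Fn d M) (Fin d))
    have h4 := congrArg (fun β => β c) h3
    simp only [Pi.basisFun_det, AlternatingMap.compLinearMap_apply, L,
      Fintype.linearCombination_apply, Pi.basisFun_apply, Pi.single_apply, ite_smul, one_smul,
      zero_smul, Finset.sum_ite_eq', Finset.mem_univ, if_true] at h4
    exact h4.trans (mul_comm _ _)
  have h1 : α (fun j => f • X j) = α (fun j => f • ∑ i, c j i • e i) :=
    congrArg α (funext key)
  rw [α.map_smul_univ, α.map_smul_univ, h2] at h1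
  have h5 := congrArg (fun k : Fn d M => k y) h1
  simpa [hf] using h5

variable [IsManifold 𝓘(ℝ, EuclideanSpace ℝ (Fin d)) ∞ M] [T2Space M]

/-- Every top degree form is a unique smooth multiple of the volume form. -/
theorem exists_topCoeff (α : DForm (Fn d M) d) :
    ∃! f : Fn d M, α = f • S.vol := by
  choose e U hU he using S.exists_frame
  have hvol : ∀ x, ∀ y ∈ U x, S.vol (e x) y * S.vol (e x) y = 1 := by
    intro x y hy
    have h := congrArg (fun k : Fn d M => k y) (S.vol_mul_vol (e x) (e x))
    simp only [ContMDiffMap.coe_mul, Pi.mul_apply, ContMDiffMap.coe_neg, Pi.neg_apply,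
      fn_det_apply] at h
    have hm : (Matrix.of fun i j => (Matrix.of fun i j => S.g (e x i) (e x j)) i j y)
        = Matrix.diagonal eta := by
      ext i j
      simpa [Matrix.diagonal_apply] using (he x y hy).1 i j
    rw [h, hm, Matrix.det_diagonal]
    rcases d with _ | d
    · exfalso
      simp only [hm, Matrix.det_diagonal, Finset.univ_eq_empty, Finset.prod_empty] at h
      nlinarith [mul_self_nonneg (S.vol (e x) y)]
    · rw [Fin.prod_univ_succ]
      simp [eta]
  have hmain : ∀ x y, U x ∈ 𝓝 y → ∀ X,
      α X y = α (e x) y * S.vol (e x) y * S.vol X y := by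
    intro x y hx X
    rw [S.form_eq_det α (e x) (U x) (fun z hz => (he x z hz).2) y hx X,
      S.form_eq_det S.vol (e x) (U x) (fun z hz => (he x z hz).2) y hx X]
    linear_combination (-(α (e x) y) * Matrix.det (Matrix.of fun j i =>
      eta i • S.g (X j) (e x i)) y) * hvol x y (mem_of_mem_nhds hx)
  have hloc : ∀ x y, U x ∈ 𝓝 y →
      α (e y) y * S.vol (e y) y = α (e x) y * S.vol (e x) y := by
    intro x y hx
    rw [hmain x y hx (e y), mul_assoc, hvol y y (mem_of_mem_nhds (hU y)), mul_one]
  have hsmooth : ContMDiff 𝓘(ℝ, EuclideanSpace ℝ (Fin d)) 𝓘(ℝ, ℝ) ∞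
      fun y => α (e y) y * S.vol (e y) y := by
    intro x
    have h : ContMDiffAt 𝓘(ℝ, EuclideanSpace ℝ (Fin d)) 𝓘(ℝ, ℝ) ∞
      (fun y => (α (e x) * S.vol (e x) : Fn d M) y) x := (α (e x) * S.vol (e x)).contMDiff x
    refine h.congr_of_eventuallyEq ?_
    filter_upwards [eventually_mem_nhds_iff.2 (hU x)] with y hy
    exact hloc x y hy
  refine ⟨⟨_, hsmooth⟩, ?_, ?_⟩
  · ext X y
    exact hmain y y (hU y) X
  · intro f hf
    ext y
    change f y = α (e y) y * S.vol (e y) y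
    have h : α (e y) y = f y * S.vol (e y) y := by rw [hf]; rfl
    rw [h, mul_assoc, hvol y y (mem_of_mem_nhds (hU y)), mul_one]

/-- The coefficient of a top degree form with respect to the volume form. -/
def topCoeff : DForm (Fn d M) d →ₗ[Fn d M] Fn d M where
  toFun α := (S.exists_topCoeff α).choose
  map_add' α β := by
    refine ((S.exists_topCoeff (α + β)).choose_spec.2 _ ?_).symm
    dsimp only
    rw [add_smul, ← (S.exists_topCoeff α).choose_spec.1, ← (S.exists_topCoeff β).choose_spec.1]
  map_smul' f α := by
    refine ((S.exists_topCoeff (f • α)).choose_spec.2 _ ?_).symm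
    dsimp only
    rw [RingHom.id_apply, smul_eq_mul, mul_smul, ← (S.exists_topCoeff α).choose_spec.1]

theorem topCoeff_smul_vol (α : DForm (Fn d M) d) : S.topCoeff α • S.vol = α :=
  (S.exists_topCoeff α).choose_spec.1.symm

/-- The Hodge operator on `k`-forms, with values in `m`-forms (zero unless `k + m = d`):
`(∗β) (V₁, …, V_m) vol = -β ∧ V₁♭ ∧ ⋯ ∧ V_m♭`, where the sign is that of the determinant of the
metric. Equivalently `α ∧ ∗β = ⟨α, β⟩ vol`. -/
def hodge (k m : ℕ) : DForm (Fn d M) k →ₗ[Fn d M] DForm (Fn d M) m where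
  toFun β := -(S.topCoeff ∘ₗ wedge (Fn d M) k m d β).compAlternatingMap
    (flatWedge (Fn d M) S.g m)
  map_add' α β := by
    ext V : 1
    simp only [AlternatingMap.neg_apply, AlternatingMap.add_apply,
      LinearMap.compAlternatingMap_apply, LinearMap.comp_apply, map_add, LinearMap.add_apply,
      neg_add]
  map_smul' f α := by
    ext V : 1
    simp only [AlternatingMap.neg_apply, AlternatingMap.smul_apply, RingHom.id_apply,
      LinearMap.compAlternatingMap_apply, LinearMap.comp_apply, map_smul, LinearMap.smul_apply,
      smul_neg]

/-- Infinitesimal isometries: vector fields `ξ` with `L_ξ g = 0`. -/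
def IsKilling (ξ : VField (Fn d M)) : Prop :=
  ∀ X Y, ξ (S.g X Y) = S.g ⁅ξ, X⁆ Y + S.g X ⁅ξ, Y⁆

end OrientedLorentzian
end Manifold

section Series

/-- Formal power series `∑ ħⁿ vₙ` with coefficients in `V`. -/
abbrev Ser (V : Type*) : Type _ := ℕ → V

variable {V W X Y : Type*} [AddCommGroup V] [Module ℂ V] [AddCommGroup W] [Module ℂ W]
  [AddCommGroup X] [Module ℂ X] [AddCommGroup Y] [Module ℂ Y]

/-- The `ħ`-linear extension of a linear map. -/
def serMap (f : V →ₗ[ℂ] W) : Ser V →ₗ[ℂ] Ser W := f.compLeft ℕ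

/-- The `ħ`-bilinear extension of a bilinear map. -/
def serMap₂ (b : V →ₗ[ℂ] W →ₗ[ℂ] X) (v : Ser V) (w : Ser W) : Ser X :=
  fun n => ∑ p ∈ Finset.HasAntidiagonal.antidiagonal n, b (v p.1) (w p.2)

/-- Evaluation of a formal series of linear maps, that is, of an `ħ`-linear map
`V[[ħ]] → W[[ħ]]`, on a formal series of vectors. -/
def serApply (f : Ser (V →ₗ[ℂ] W)) (v : Ser V) : Ser W := serMap₂ LinearMap.id f v

/-- Composition of formal series of linear maps. -/
def serComp (g : Ser (W →ₗ[ℂ] X)) (f : Ser (V →ₗ[ℂ] W)) : Ser (V →ₗ[ℂ] X) :=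
  serMap₂ (LinearMap.llcomp ℂ V W X) g f

/-- The tensor product of formal series, `v ⊗ w`, without any twist. -/
def serTensor (v : Ser V) (w : Ser W) : Ser (V ⊗[ℂ] W) := serMap₂ (TensorProduct.mk ℂ V W) v w

/-- `v' ↦ v' ⊗ w`. -/
def tensorRight (V : Type*) [AddCommGroup V] [Module ℂ V] (w : Ser W) :
    Ser (V →ₗ[ℂ] V ⊗[ℂ] W) :=
  serMap (TensorProduct.mk ℂ V W).flip w

/-- `w' ↦ v ⊗ w'`. -/
def tensorLeft (W : Type*) [AddCommGroup W] [Module ℂ W] (v : Ser V) :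
    Ser (W →ₗ[ℂ] V ⊗[ℂ] W) :=
  serMap (TensorProduct.mk ℂ V W) v

/-- `id ⊗ f`. -/
def idTensor (V : Type*) [AddCommGroup V] [Module ℂ V] (f : Ser (W →ₗ[ℂ] X)) :
    Ser (V ⊗[ℂ] W →ₗ[ℂ] V ⊗[ℂ] X) :=
  serMap (LinearMap.lTensorHom V) f

end Series

section Twist

attribute [local instance 100] LieRing.ofAssociativeRing

variable (L : Type*) [LieRing L] [LieAlgebra ℂ L]

/-- The universal enveloping algebra. -/
abbrev UEnv : Type _ := UniversalEnvelopingAlgebra ℂ L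

/-- The coproduct of the universal enveloping algebra, `Δ x = x ⊗ 1 + 1 ⊗ x` for `x ∈ L`. -/
def coproduct : UEnv L →ₐ[ℂ] UEnv L ⊗[ℂ] UEnv L :=
  UniversalEnvelopingAlgebra.lift ℂ
    { toFun := fun x => UniversalEnvelopingAlgebra.ι ℂ x ⊗ₜ 1 + 1 ⊗ₜ UniversalEnvelopingAlgebra.ι ℂ x
      map_add' := fun x y => by
        simp only [map_add, TensorProduct.add_tmul, TensorProduct.tmul_add]
        abel
      map_smul' := fun c x => by
        simp only [map_smul, TensorProduct.smul_tmul', TensorProduct.tmul_smul, smul_add,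
          RingHom.id_apply]
      map_lie' := fun {x y} => by
        simp only [LieHom.map_lie, LieRing.of_associative_ring_bracket, add_mul, mul_add,
          Algebra.TensorProduct.tmul_mul_tmul, one_mul, mul_one, TensorProduct.sub_tmul,
          TensorProduct.tmul_sub]
        abel }

/-- A Drinfel'd twist `F ∈ (U L ⊗ U L)[[ħ]]`: an invertible element with
`F₁₂ (Δ ⊗ id) F = F₂₃ (id ⊗ Δ) F` and `F = 1 ⊗ 1 + O(ħ)`. -/
structure DrinfeldTwist where
  F : (PowerSeries (UEnv L ⊗[ℂ] UEnv L))ˣ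
  cocycle :
    PowerSeries.map ((Algebra.TensorProduct.assoc ℂ ℂ ℂ (UEnv L) (UEnv L) (UEnv L)).toAlgHom.comp
        Algebra.TensorProduct.includeLeft).toRingHom F.val
      * PowerSeries.map ((Algebra.TensorProduct.assoc ℂ ℂ ℂ (UEnv L) (UEnv L) (UEnv L)).toAlgHom.comp
        (Algebra.TensorProduct.map (coproduct L) (AlgHom.id ℂ (UEnv L)))).toRingHom F.val
    = PowerSeries.map (Algebra.TensorProduct.includeRight :
        UEnv L ⊗[ℂ] UEnv L →ₐ[ℂ] UEnv L ⊗[ℂ] (UEnv L ⊗[ℂ] UEnv L)).toRingHom F.val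
      * PowerSeries.map (Algebra.TensorProduct.map (AlgHom.id ℂ (UEnv L)) (coproduct L)).toRingHom
        F.val
  normalized : PowerSeries.constantCoeff F.val = 1

variable {L}

/-- The flip of the two tensor factors. -/
def flipSer : PowerSeries (UEnv L ⊗[ℂ] UEnv L) →+* PowerSeries (UEnv L ⊗[ℂ] UEnv L) :=
  PowerSeries.map (Algebra.TensorProduct.comm ℂ (UEnv L) (UEnv L)).toAlgHom.toRingHom

namespace DrinfeldTwist

variable (T : DrinfeldTwist L)

/-- The `R`-matrix `R = F₂₁ F⁻¹ = R^k ⊗ R_k`. -/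
def rMatrix : PowerSeries (UEnv L ⊗[ℂ] UEnv L) := flipSer T.F.val * (T.F⁻¹).val

end DrinfeldTwist

variable (L) in
/-- The action of the universal enveloping algebra on a representation. -/
def uAct (V : Type*) [AddCommGroup V] [Module ℂ V] [LieRingModule L V] [LieModule ℂ L V] :
    UEnv L →ₐ[ℂ] Module.End ℂ V :=
  UniversalEnvelopingAlgebra.lift ℂ (LieModule.toEnd ℂ L V)

/-- The factorwise action of `(U L ⊗ U L)[[ħ]]` on `V ⊗ W`. -/
def serAct₂ (V W : Type*) [AddCommGroup V] [Module ℂ V] [LieRingModule L V] [LieModule ℂ L V]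
    [AddCommGroup W] [Module ℂ W] [LieRingModule L W] [LieModule ℂ L W]
    (P : PowerSeries (UEnv L ⊗[ℂ] UEnv L)) : Ser (V ⊗[ℂ] W →ₗ[ℂ] V ⊗[ℂ] W) :=
  fun n => ((Module.endTensorEndAlgHom (R := ℂ) (S := ℂ) (A := ℂ) (M := V) (N := W)).comp
    (Algebra.TensorProduct.map (uAct L V) (uAct L W))) (PowerSeries.coeff n P)

namespace DrinfeldTwist

variable (T : DrinfeldTwist L)
variable {V W X : Type*}
  [AddCommGroup V] [Module ℂ V] [LieRingModule L V] [LieModule ℂ L V]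
  [AddCommGroup W] [Module ℂ W] [LieRingModule L W] [LieModule ℂ L W]
  [AddCommGroup X] [Module ℂ X]

/-- The action of `F⁻¹` on `V ⊗ W`. -/
def invAct (V W : Type*) [AddCommGroup V] [Module ℂ V] [LieRingModule L V] [LieModule ℂ L V]
    [AddCommGroup W] [Module ℂ W] [LieRingModule L W] [LieModule ℂ L W] :
    Ser (V ⊗[ℂ] W →ₗ[ℂ] V ⊗[ℂ] W) :=
  serAct₂ V W (T.F⁻¹).val

/-- The operator `v ⊗ w ↦ R_k v ⊗ R^k w`. -/
def braidAct (V W : Type*) [AddCommGroup V] [Module ℂ V] [LieRingModule L V] [LieModule ℂ L V]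
    [AddCommGroup W] [Module ℂ W] [LieRingModule L W] [LieModule ℂ L W] :
    Ser (V ⊗[ℂ] W →ₗ[ℂ] V ⊗[ℂ] W) :=
  serAct₂ V W (flipSer T.rMatrix)

/-- The star tensor product `v ⊗⋆ w = F⁻¹ (v ⊗ w)`. -/
def starTensor (v : Ser V) (w : Ser W) : Ser (V ⊗[ℂ] W) :=
  serApply (T.invAct V W) (serTensor v w)

/-- `R_k v ⊗ R^k w`. -/
def braidTensor (v : Ser V) (w : Ser W) : Ser (V ⊗[ℂ] W) :=
  serApply (T.braidAct V W) (serTensor v w)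

/-- The twisted bilinear map `b⋆ = b ∘ F⁻¹`, as a map on `(V ⊗ W)[[ħ]]`. -/
def twisted (b : V ⊗[ℂ] W →ₗ[ℂ] X) : Ser (V ⊗[ℂ] W →ₗ[ℂ] X) :=
  serComp (Pi.single 0 b) (T.invAct V W)

/-- The twisted bilinear map `b⋆ (v, w) = b (F⁻¹ (v ⊗ w))`. -/
def star (b : V ⊗[ℂ] W →ₗ[ℂ] X) (v : Ser V) (w : Ser W) : Ser X :=
  serMap b (T.starTensor v w)

end DrinfeldTwist

/-- A `V[[ħ]]`-valued expression together with its variation: `val` is the expression and the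
`ħ`-linear map `var : λ ↦ δ_λ val` is its variation along gauge parameters `λ ∈ Λ[[ħ]]`. -/
@[ext]
structure Jet (Λ V : Type*) [AddCommGroup Λ] [Module ℂ Λ] [AddCommGroup V] [Module ℂ V] where
  val : Ser V
  var : Ser (Λ →ₗ[ℂ] V)

namespace Jet

variable {Λ V W : Type*} [AddCommGroup Λ] [Module ℂ Λ] [AddCommGroup V] [Module ℂ V]
  [AddCommGroup W] [Module ℂ W]

/-- The variation `δ_λ` in the direction of a gauge parameter. -/
def delta (v : Jet Λ V) (lam : Ser Λ) : Ser V := serApply v.var lam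

instance : Add (Jet Λ V) := ⟨fun v w => ⟨v.val + w.val, v.var + w.var⟩⟩

instance : SMul ℂ (Jet Λ V) := ⟨fun c v => ⟨c • v.val, c • v.var⟩⟩

/-- Variations commute with (untwisted, equivariant) linear maps. -/
def map (f : V →ₗ[ℂ] W) (v : Jet Λ V) : Jet Λ W :=
  ⟨serMap f v.val, serMap (LinearMap.llcomp ℂ Λ V W f) v.var⟩

/-- Variations act on star tensor products by the braided Leibniz rule
`δ_λ (v ⊗⋆ w) = δ_λ v ⊗⋆ w + R_k v ⊗⋆ δ_{R^k λ} w`. -/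
def starTensor [LieRingModule L Λ] [LieModule ℂ L Λ] [LieRingModule L V] [LieModule ℂ L V]
    [LieRingModule L W] [LieModule ℂ L W] (T : DrinfeldTwist L) (v : Jet Λ V) (w : Jet Λ W) :
    Jet Λ (V ⊗[ℂ] W) where
  val := T.starTensor v.val w.val
  var := serComp (T.invAct V W)
    (serComp (tensorRight V w.val) v.var
      + serComp (idTensor V w.var) (serComp (T.braidAct V Λ) (tensorLeft Λ v.val)))

end Jet

end Twist

section GForms

attribute [local instance 100] LieRing.ofAssociativeRing

variable (C : Type*) [CommRing C] [Algebra ℝ C] (𝔤 : Type*) [LieRing 𝔤] [LieAlgebra ℝ 𝔤]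

instance (k : ℕ) : IsScalarTower ℝ C (DForm C k) :=
  ⟨fun t f α => by ext V; simp⟩

/-- Real `𝔤`-valued `k`-forms. -/
def RForm (k : ℕ) : Type _ := DForm C k ⊗[ℝ] 𝔤

instance (k : ℕ) : AddCommGroup (RForm C 𝔤 k) := inferInstanceAs (AddCommGroup (DForm C k ⊗[ℝ] 𝔤))

instance (k : ℕ) : Module ℝ (RForm C 𝔤 k) := inferInstanceAs (Module ℝ (DForm C k ⊗[ℝ] 𝔤))

/-- The Lie derivative of `𝔤`-valued forms, `L_X (α ⊗ x) = L_X α ⊗ x`. -/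
def gLieDeriv (k : ℕ) (X : VField C) : RForm C 𝔤 k →ₗ[ℝ] RForm C 𝔤 k :=
  (LieModule.toEnd ℝ (VField C) (DForm C k) X).rTensor 𝔤

theorem gLieDeriv_leibniz (k : ℕ) (X Y : VField C) (a : RForm C 𝔤 k) :
    gLieDeriv C 𝔤 k X (gLieDeriv C 𝔤 k Y a)
      = gLieDeriv C 𝔤 k ⁅X, Y⁆ a + gLieDeriv C 𝔤 k Y (gLieDeriv C 𝔤 k X a) := by
  have key : gLieDeriv C 𝔤 k X ∘ₗ gLieDeriv C 𝔤 k Y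
      = gLieDeriv C 𝔤 k ⁅X, Y⁆ + gLieDeriv C 𝔤 k Y ∘ₗ gLieDeriv C 𝔤 k X := by
    refine TensorProduct.ext' fun α x => ?_
    change ⁅X, ⁅Y, α⁆⁆ ⊗ₜ[ℝ] x = ⁅⁅X, Y⁆, α⁆ ⊗ₜ[ℝ] x + ⁅Y, ⁅X, α⁆⁆ ⊗ₜ[ℝ] x
    rw [leibniz_lie, TensorProduct.add_tmul]
  exact LinearMap.congr_fun key a

instance (k : ℕ) : LieRingModule (VField C) (RForm C 𝔤 k) where
  bracket X a := gLieDeriv C 𝔤 k X a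
  add_lie X Y a := by
    change gLieDeriv C 𝔤 k (X + Y) a = gLieDeriv C 𝔤 k X a + gLieDeriv C 𝔤 k Y a
    unfold gLieDeriv
    rw [map_add, LinearMap.rTensor_add]
    rfl
  lie_add X := map_add (gLieDeriv C 𝔤 k X)
  leibniz_lie := gLieDeriv_leibniz C 𝔤 k

instance (k : ℕ) : LieModule ℝ (VField C) (RForm C 𝔤 k) where
  smul_lie t X a := by
    change gLieDeriv C 𝔤 k (t • X) a = t • gLieDeriv C 𝔤 k X a
    unfold gLieDeriv
    rw [map_smul, LinearMap.rTensor_smul]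
    rfl
  lie_smul t X := map_smul (gLieDeriv C 𝔤 k X) t

/-- Complex `𝔤`-valued `k`-forms, `Ω^k(M, 𝔤) ⊗ ℂ`. -/
abbrev GForm (k : ℕ) : Type _ := ℂ ⊗[ℝ] RForm C 𝔤 k

/-- The real bracket `[α ⊗ x, β ⊗ y] = (α ∧ β) ⊗ [x, y]` of `𝔤`-valued forms. -/
def rBracket (p q n : ℕ) : RForm C 𝔤 p →ₗ[ℝ] RForm C 𝔤 q →ₗ[ℝ] RForm C 𝔤 n :=
  TensorProduct.map₂ (LinearMap.restrictScalars₁₂ ℝ ℝ (wedge C p q n))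
    (LieModule.toEnd ℝ 𝔤 𝔤 : 𝔤 →ₗ[ℝ] Module.End ℝ 𝔤)

/-- The `ℂ`-bilinear bracket `[α ⊗ x, β ⊗ y] = (α ∧ β) ⊗ [x, y]` of `𝔤`-valued forms
(zero unless `p + q = n`). -/
def bracket (p q n : ℕ) : GForm C 𝔤 p ⊗[ℂ] GForm C 𝔤 q →ₗ[ℂ] GForm C 𝔤 n :=
  (TensorProduct.lift (rBracket C 𝔤 p q n)).baseChange ℂ ∘ₗ
    (TensorProduct.AlgebraTensorModule.distribBaseChange ℝ ℂ (RForm C 𝔤 p)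
      (RForm C 𝔤 q)).symm.toLinearMap

/-- The exterior derivative of `𝔤`-valued forms (zero unless `k + 1 = n`). -/
def gD (k n : ℕ) : GForm C 𝔤 k →ₗ[ℂ] GForm C 𝔤 n :=
  LinearMap.baseChange ℂ
    ((extDLinear C k n).rTensor 𝔤 : RForm C 𝔤 k →ₗ[ℝ] RForm C 𝔤 n)

end GForms

section YangMills

variable {d : ℕ} {M : Type*} [TopologicalSpace M] [ChartedSpace (EuclideanSpace ℝ (Fin d)) M]
  [IsManifold 𝓘(ℝ, EuclideanSpace ℝ (Fin d)) ∞ M] [T2Space M]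
  (S : OrientedLorentzian d M) (𝔤 : Type*) [LieRing 𝔤] [LieAlgebra ℝ 𝔤]

/-- The Hodge operator on `𝔤`-valued forms (zero unless `k + m = d`). -/
def gHodge (k m : ℕ) : GForm (Fn d M) 𝔤 k →ₗ[ℂ] GForm (Fn d M) 𝔤 m :=
  LinearMap.baseChange ℂ (((S.hodge k m).restrictScalars ℝ).rTensor 𝔤 :
    RForm (Fn d M) 𝔤 k →ₗ[ℝ] RForm (Fn d M) 𝔤 m)

variable (d M) in
/-- `𝔤`-valued forms on `M`. -/
abbrev Om (k : ℕ) : Type _ := GForm (Fn d M) 𝔤 k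

/-! The classical Yang-Mills brackets on gauge parameters `Ω⁰`, gauge fields `Ω¹`
and the space `Ω^{d-1}` of field equations. -/

variable (d M) in
/-- `ℓ₁(λ) = dλ`. -/
def ell1Gauge : Om d M 𝔤 0 →ₗ[ℂ] Om d M 𝔤 1 := gD (Fn d M) 𝔤 0 1

/-- `ℓ₁(A) = d ∗ dA`. -/
def ell1Field : Om d M 𝔤 1 →ₗ[ℂ] Om d M 𝔤 (d - 1) :=
  gD (Fn d M) 𝔤 (d - 2) (d - 1) ∘ₗ gHodge S 𝔤 2 (d - 2) ∘ₗ gD (Fn d M) 𝔤 1 2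

variable (d M) in
/-- `ℓ₂(λ, A) = -[λ, A]`. -/
def ell2Gauge : Om d M 𝔤 0 ⊗[ℂ] Om d M 𝔤 1 →ₗ[ℂ] Om d M 𝔤 1 := -bracket (Fn d M) 𝔤 0 1 1

/-- `ℓ₂(A₁, A₂) = -d ∗ [A₁, A₂] - [A₁, ∗ dA₂] + (-1)^d [∗ dA₁, A₂]`. -/
def ell2Field : Om d M 𝔤 1 ⊗[ℂ] Om d M 𝔤 1 →ₗ[ℂ] Om d M 𝔤 (d - 1) :=
  -(gD (Fn d M) 𝔤 (d - 2) (d - 1) ∘ₗ gHodge S 𝔤 2 (d - 2) ∘ₗ bracket (Fn d M) 𝔤 1 1 2)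
    - bracket (Fn d M) 𝔤 1 (d - 2) (d - 1) ∘ₗ (gHodge S 𝔤 2 (d - 2) ∘ₗ gD (Fn d M) 𝔤 1 2).lTensor (Om d M 𝔤 1)
    + (-1 : ℂ) ^ d • bracket (Fn d M) 𝔤 (d - 2) 1 (d - 1) ∘ₗ (gHodge S 𝔤 2 (d - 2) ∘ₗ gD (Fn d M) 𝔤 1 2).rTensor (Om d M 𝔤 1)

/-- `(A₁, A₂, A₃) ↦ [A₁, ∗ [A₂, A₃]]`. -/
def cubicL : (Om d M 𝔤 1 ⊗[ℂ] Om d M 𝔤 1) ⊗[ℂ] Om d M 𝔤 1 →ₗ[ℂ] Om d M 𝔤 (d - 1) :=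
  bracket (Fn d M) 𝔤 1 (d - 2) (d - 1) ∘ₗ (gHodge S 𝔤 2 (d - 2) ∘ₗ bracket (Fn d M) 𝔤 1 1 2).lTensor (Om d M 𝔤 1) ∘ₗ
    (TensorProduct.assoc ℂ (Om d M 𝔤 1) (Om d M 𝔤 1) (Om d M 𝔤 1)).toLinearMap

/-- `(A₁, A₂, A₃) ↦ [A₂, ∗ [A₁, A₃]]`. -/
def cubicM : (Om d M 𝔤 1 ⊗[ℂ] Om d M 𝔤 1) ⊗[ℂ] Om d M 𝔤 1 →ₗ[ℂ] Om d M 𝔤 (d - 1) :=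
  cubicL S 𝔤 ∘ₗ
    (TensorProduct.comm ℂ (Om d M 𝔤 1) (Om d M 𝔤 1)).toLinearMap.rTensor (Om d M 𝔤 1)

/-- `(A₁, A₂, A₃) ↦ [∗ [A₁, A₂], A₃]`. -/
def cubicR : (Om d M 𝔤 1 ⊗[ℂ] Om d M 𝔤 1) ⊗[ℂ] Om d M 𝔤 1 →ₗ[ℂ] Om d M 𝔤 (d - 1) :=
  bracket (Fn d M) 𝔤 (d - 2) 1 (d - 1) ∘ₗ (gHodge S 𝔤 2 (d - 2) ∘ₗ bracket (Fn d M) 𝔤 1 1 2).rTensor (Om d M 𝔤 1)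

/-- `ℓ₃(A₁, A₂, A₃) = -[A₁, ∗ [A₂, A₃]] - [A₂, ∗ [A₁, A₃]] + (-1)^d [∗ [A₁, A₂], A₃]`. -/
def ell3Field : (Om d M 𝔤 1 ⊗[ℂ] Om d M 𝔤 1) ⊗[ℂ] Om d M 𝔤 1 →ₗ[ℂ] Om d M 𝔤 (d - 1) :=
  -cubicL S 𝔤 - cubicM S 𝔤 + (-1 : ℂ) ^ d • cubicR S 𝔤

variable {𝔤} {𝔨 : LieSubalgebra ℝ (VField (Fn d M))} (T : DrinfeldTwist (ℂ ⊗[ℝ] 𝔨))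
  (A : Ser (Om d M 𝔤 1))

/-- The gauge field `A` with its braided gauge variation
`δ_λ A = ℓ₁(λ) + ℓ₂⋆(λ, A) = dλ - [λ, A]⋆`. -/
def fieldJet : Jet (Om d M 𝔤 0) (Om d M 𝔤 1) where
  val := A
  var := Pi.single 0 (ell1Gauge d M 𝔤)
    + serComp (T.twisted (ell2Gauge d M 𝔤)) (tensorRight (Om d M 𝔤 0) A)

/-- `A ⊗⋆ A` with its variation. -/
def fieldJet₂ : Jet (Om d M 𝔤 0) (Om d M 𝔤 1 ⊗[ℂ] Om d M 𝔤 1) :=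
  (fieldJet T A).starTensor T (fieldJet T A)

/-- `A ⊗⋆ A ⊗⋆ A` with its variation. -/
def fieldJet₃ : Jet (Om d M 𝔤 0) ((Om d M 𝔤 1 ⊗[ℂ] Om d M 𝔤 1) ⊗[ℂ] Om d M 𝔤 1) :=
  (fieldJet₂ T A).starTensor T (fieldJet T A)

/-- The braided Maurer-Cartan element
`ℓ₁⋆(A) - 1/2 ℓ₂⋆(A, A) - 1/6 ℓ₃⋆(A, A, A)`, where `ℓ_n⋆(v₁, …, v_n) = ℓ_n(v₁ ⊗⋆ ⋯ ⊗⋆ v_n)`,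
with its braided gauge variation. -/
def maurerCartan : Jet (Om d M 𝔤 0) (Om d M 𝔤 (d - 1)) :=
  (fieldJet T A).map (ell1Field S 𝔤)
    + (-(1 / 2) : ℂ) • (fieldJet₂ T A).map (ell2Field S 𝔤)
    + (-(1 / 6) : ℂ) • (fieldJet₃ T A).map (ell3Field S 𝔤)

/-- `[v, w]⋆`. -/
def brStar {p q : ℕ} (n : ℕ) (v : Ser (Om d M 𝔤 p)) (w : Ser (Om d M 𝔤 q)) : Ser (Om d M 𝔤 n) :=
  T.star (bracket (Fn d M) 𝔤 p q n) v w

/-- The braided curvature `F_A = dA + 1/2 [A, A]⋆`. -/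
def curvature : Ser (Om d M 𝔤 2) :=
  serMap (gD (Fn d M) 𝔤 1 2) A + (1 / 2 : ℂ) • brStar T 2 A A

/-- The left braided covariant derivative `dφ + [A, φ]⋆`. -/
def covDL {p : ℕ} (n : ℕ) (φ : Ser (Om d M 𝔤 p)) : Ser (Om d M 𝔤 n) :=
  serMap (gD (Fn d M) 𝔤 p n) φ + brStar T n A φ

/-- The right braided covariant derivative `dφ + [R_k A, R^k φ]⋆`. -/
def covDR {p : ℕ} (n : ℕ) (φ : Ser (Om d M 𝔤 p)) : Ser (Om d M 𝔤 n) :=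
  serMap (gD (Fn d M) 𝔤 p n) φ
    + serApply (T.twisted (bracket (Fn d M) 𝔤 1 p n)) (T.braidTensor A φ)

/-- `b ↦ ∗ [b, A]⋆` as a formal series of linear maps. -/
def starBrRight : Ser (Om d M 𝔤 1 →ₗ[ℂ] Om d M 𝔤 (d - 2)) :=
  serComp (T.twisted (gHodge S 𝔤 2 (d - 2) ∘ₗ bracket (Fn d M) 𝔤 1 1 2)) (tensorRight (Om d M 𝔤 1) A)

/-- `[R_k A, ∗ [R^k A, A]⋆]⋆`. -/
def cubicBraided : Ser (Om d M 𝔤 (d - 1)) :=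
  serApply (T.twisted (bracket (Fn d M) 𝔤 1 (d - 2) (d - 1)))
    (serApply (idTensor (Om d M 𝔤 1) (starBrRight S T A)) (T.braidTensor A A))

/-- The extra cubic terms
`Z_A = 1/6 [R_k A, ∗ [R^k A, A]⋆]⋆ - 1/12 [A, ∗ [A, A]⋆]⋆ + (-1)^d/12 [∗ [A, A]⋆, A]⋆`. -/
def extraTerms : Ser (Om d M 𝔤 (d - 1)) :=
  (1 / 6 : ℂ) • cubicBraided S T A
    - (1 / 12 : ℂ) • brStar T (d - 1) A (serMap (gHodge S 𝔤 2 (d - 2)) (brStar T 2 A A))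
    + ((-1) ^ d / 12 : ℂ) • brStar T (d - 1) (serMap (gHodge S 𝔤 2 (d - 2)) (brStar T 2 A A)) A

/-- The extra cubic terms with their braided gauge variation. -/
def extraTermsJet : Jet (Om d M 𝔤 0) (Om d M 𝔤 (d - 1)) :=
  (1 / 6 : ℂ) • (fieldJet₃ T A).map (cubicM S 𝔤)
    + (-(1 / 12) : ℂ) • (fieldJet₃ T A).map (cubicL S 𝔤)
    + ((-1) ^ d / 12 : ℂ) • (fieldJet₃ T A).map (cubicR S 𝔤)


end YangMills

end BraidedYM

end

/-! Every braided bracket is a classical 𝔨-equivariant multilinear map applied to a star tensor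
product. Once each expression is written as a linear map applied to λ ⊗⋆ A ⊗⋆ ⋯ ⊗⋆ A, with λ
leftmost, a braided identity follows from an identity between linear maps, and this is checked on
elementary tensors with independent entries.

Three facts bring expressions to that form. Equivariant maps pass through F⁻¹ (`serMap_starTensor`).
The cocycle condition makes ⊗⋆ associative (`starTensor_assoc`). Since F⁻¹R₂₁ = F₂₁⁻¹, the braided
flip R_k v ⊗⋆ R^k w is the plain flip of w ⊗⋆ v (`invAct_braidTensor`). Thus the second term of the
braided Leibniz rule is a permutation of a tensor that starts with λ (`delta_starTensor_field`).

The classical input is small and is collected in `GaugeSystem`: d² = 0 on functions, the Leibniz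
rule and the Jacobi identity with one entry of degree 0, symmetry of the bracket of 1-forms, and
linearity of ∗ over functions. Equivariance is Cartan calculus, together with invariance of ∗ under
Killing fields (`lieDeriv_hodge`).

Write L, M, N for [A₁,∗[A₂,A₃]], [A₂,∗[A₁,A₃]], [A₃,∗[A₁,A₂]]. The Maurer–Cartan element contains
(L+M+N)/6, the averaged covariant derivatives contain (L+N)/4, and the difference M/6 − L/12 − N/12
is Z. Its coefficients add up to zero, so Z vanishes wherever L, M, N agree. Putting dλ into the
three slots in turn produces each cubic expression with exactly these three coefficients, so the
inhomogeneous part of δ_λ Z cancels (`extra_comp_varThreeQuad`). -/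

noncomputable section

namespace BraidedYM

/-! ### Cartan calculus: wedge product, Lie derivative and exterior derivative. -/

section CartanCalculus

variable {C : Type*} [CommRing C] [Algebra ℝ C]

/-- Replacing shuffles by all permutations counts each shuffle p! q! times. The sum over a group can
be reindexed and treated term by term, and the factor is cancelled at the end because `C` is a real
algebra. -/
theorem factorial_smul_wedge_apply {p q n : ℕ} (h : p + q = n) (α : DForm C p) (β : DForm C q)
    (V : Fin n → VField C) :
    (p.factorial * q.factorial) • wedge C p q n α β V
      = ∑ σ : Equiv.Perm (Fin n), Equiv.Perm.sign σ •
          (α (fun i => V (σ (Fin.cast h (Fin.castAdd q i))))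
            * β (fun j => V (σ (Fin.cast h (Fin.natAdd p j))))) := by
  subst h
  have h1 := congrArg (fun γ => LinearMap.mul' C C (γ (V ∘ finSumFinEquiv)))
    (MultilinearMap.domCoprod_alternization_eq α β)
  simp only [Fintype.card_fin, AlternatingMap.smul_apply, map_nsmul] at h1
  have h2 : wedge C p q (p + q) α β V
      = LinearMap.mul' C C (α.domCoprod β (V ∘ finSumFinEquiv)) := by
    simp only [wedge, dif_pos]
    rfl
  rw [h2, ← h1, MultilinearMap.alternatization_apply, map_sum]
  refine Fintype.sum_equiv finSumFinEquiv.permCongr _ _ fun σ => ?_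
  rw [map_zsmul_unit, MultilinearMap.domDomCongr_apply, MultilinearMap.domCoprod_apply,
    LinearMap.mul'_apply, Equiv.Perm.sign_permCongr]
  simp [Equiv.permCongr_apply]

theorem wedge_eq_zero {p q n : ℕ} (h : p + q ≠ n) : wedge C p q n = 0 := dif_neg h

theorem smul_left_cancel_nat {N : ℕ} (hN : N ≠ 0) {a b : C} (h : N • a = N • b) : a = b := by
  have h' : (N : ℝ) • a = (N : ℝ) • b := by simpa [Nat.cast_smul_eq_nsmul] using h
  have hN' : (N : ℝ) ≠ 0 := Nat.cast_ne_zero.2 hN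
  simpa [smul_smul, hN'] using congrArg (fun t => (N : ℝ)⁻¹ • t) h'

/-- For a fixed permutation this is the product rule for X, because every slot that receives a
bracket belongs to exactly one of the two factors. -/
theorem lieDeriv_wedge {p q n : ℕ} (X : VField C) (α : DForm C p) (β : DForm C q) :
    lieDeriv X (wedge C p q n α β)
      = wedge C p q n (lieDeriv X α) β + wedge C p q n α (lieDeriv X β) := by
  by_cases h : p + q = n
  swap
  · ext V
    simp [wedge_eq_zero h, lieDeriv_apply]
  ext V
  refine smul_left_cancel_nat (mul_ne_zero p.factorial_ne_zero q.factorial_ne_zero) ?_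
  rw [lieDeriv_apply, AlternatingMap.add_apply, smul_sub, smul_add, ← map_nsmul,
    Finset.smul_sum]
  simp only [factorial_smul_wedge_apply h]
  rw [map_sum, Finset.sum_comm, ← Finset.sum_sub_distrib, ← Finset.sum_add_distrib]
  refine Finset.sum_congr rfl fun σ _ => ?_
  rw [map_zsmul_unit, ← Finset.smul_sum, ← smul_sub, ← smul_add]
  congr 1
  subst h
  -- Slots are renamed through σ, so that the bracket insertions split into those seen by α and
  -- those seen by β.
  rw [← Equiv.sum_comp (finSumFinEquiv.trans σ), Fintype.sum_sum_type]
  have e1 : ∀ (i : Fin p) (Y : VField C),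
      (fun x => Function.update V (σ (Fin.castAdd q i)) Y (σ (Fin.castAdd q x)))
        = Function.update (fun x => V (σ (Fin.castAdd q x))) i Y := by
    intro i Y
    ext1 x
    by_cases hx : x = i
    · subst hx; simp
    · simp [hx]
  have e2 : ∀ (i : Fin q) (Y : VField C),
      (fun x => Function.update V (σ (Fin.natAdd p i)) Y (σ (Fin.natAdd p x)))
        = Function.update (fun x => V (σ (Fin.natAdd p x))) i Y := by
    intro i Y
    ext1 x
    by_cases hx : x = i
    · subst hx; simp
    · simp [hx]
  have e3 : ∀ (i : Fin p) (x : Fin q) (Y : VField C),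
      Function.update V (σ (Fin.castAdd q i)) Y (σ (Fin.natAdd p x)) = V (σ (Fin.natAdd p x)) := by
    intro i x Y
    refine Function.update_of_ne (fun h => ?_) _ _
    have := congrArg Fin.val (σ.injective h)
    simp at this
    omega
  have e4 : ∀ (i : Fin q) (x : Fin p) (Y : VField C),
      Function.update V (σ (Fin.natAdd p i)) Y (σ (Fin.castAdd q x)) = V (σ (Fin.castAdd q x)) := by
    intro i x Y
    refine Function.update_of_ne (fun h => ?_) _ _
    have := congrArg Fin.val (σ.injective h)
    simp at this
    omega
  simp only [Equiv.trans_apply, finSumFinEquiv_apply_left, finSumFinEquiv_apply_right,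
    Fin.cast_eq_self, e1, e2, e3, e4, lieDeriv_apply, X.leibniz, smul_eq_mul, ← Finset.sum_mul,
    ← Finset.mul_sum]
  ring

theorem sum_perm_apply_zero {R : Type*} [CommRing R] {k : ℕ} (g : Fin (k + 1) → R) :
    ∑ σ : Equiv.Perm (Fin (k + 1)), g (σ 0) = k.factorial • ∑ i, g i := by
  rw [← Equiv.sum_comp Equiv.Perm.decomposeFin.symm, Fintype.sum_prod_type, Finset.smul_sum]
  refine Finset.sum_congr rfl fun i _ => ?_
  simp [Fintype.card_perm]

/-- As β is alternating, the summand of a permutation depends only on the image of 0. Each image is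
shared by k! permutations, which matches the normalising factor. -/
theorem wedge_one_apply {k n : ℕ} (h : k + 1 = n) (α : DForm C 1) (β : DForm C k)
    (V : Fin n → VField C) :
    wedge C 1 k n α β V = ∑ i : Fin (k + 1), (-1 : ℤ) ^ (i : ℕ) •
      (α (fun _ => V (Fin.cast h i)) * β (fun j => V (Fin.cast h (i.succAbove j)))) := by
  subst h
  refine smul_left_cancel_nat (mul_ne_zero (Nat.factorial_ne_zero 1) k.factorial_ne_zero) ?_
  rw [factorial_smul_wedge_apply (add_comm 1 k), Nat.factorial_one, one_mul,
    ← sum_perm_apply_zero]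
  refine Finset.sum_congr rfl fun σ _ => ?_
  -- The cycle moves σ 0 to 0 and keeps the order of the other points. Composed with σ it fixes 0,
  -- hence comes from a permutation e of the remaining k points.
  obtain ⟨e, he⟩ : ∃ e, (σ 0).cycleRange * σ = Equiv.Perm.decomposeFin.symm (0, e) := by
    refine ⟨(Equiv.Perm.decomposeFin ((σ 0).cycleRange * σ)).2, ?_⟩
    rw [Equiv.eq_symm_apply]
    refine Prod.ext ?_ rfl
    have h0 := Equiv.Perm.decomposeFin_symm_apply_zero
      (Equiv.Perm.decomposeFin ((σ 0).cycleRange * σ)).1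
      (Equiv.Perm.decomposeFin ((σ 0).cycleRange * σ)).2
    rw [Prod.mk.eta, Equiv.symm_apply_apply] at h0
    rw [← h0]
    simp
  have hs : Equiv.Perm.sign σ = (-1) ^ ((σ 0 : Fin (k + 1)) : ℕ) * Equiv.Perm.sign e := by
    have h1 := congrArg Equiv.Perm.sign he
    rw [Equiv.Perm.sign_mul, Fin.sign_cycleRange, Equiv.Perm.decomposeFin.symm_sign, if_pos rfl,
      one_mul] at h1
    rw [← h1, ← mul_assoc, ← mul_pow]
    simp
  have hσ : ∀ j : Fin k, σ j.succ = (σ 0).succAbove (e j) := by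
    intro j
    have h1 := congrArg (fun τ => (σ 0).cycleRange.symm (τ j.succ)) he
    simp only [Equiv.Perm.mul_apply, Equiv.symm_apply_apply,
      Equiv.Perm.decomposeFin_symm_apply_succ, Equiv.swap_self, Equiv.refl_apply] at h1
    rw [h1, Fin.cycleRange_symm_succ]
  have hα : (fun i : Fin 1 => V (σ (Fin.cast (add_comm 1 k) (Fin.castAdd k i))))
      = fun _ => V (σ 0) := by
    ext1 i
    rw [Subsingleton.elim i 0]
    rfl
  have hβ : (fun j : Fin k => V (σ (Fin.cast (add_comm 1 k) (Fin.natAdd 1 j))))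
      = (fun j => V ((σ 0).succAbove j)) ∘ e := by
    ext1 j
    rw [Function.comp_apply, ← hσ j]
    congr 2
    ext
    simp
  rw [hα, hβ, β.map_perm, hs, mul_smul_comm, mul_smul, smul_smul, mul_smul]
  rcases Int.units_eq_one_or (Equiv.Perm.sign e) with h | h <;>
    simp [h, Units.smul_def]

/-- Rotating the k + 1 positions by one step exchanges the two blocks of arguments, and this
rotation has sign (-1)^k. -/
theorem wedge_one_comm {k n : ℕ} (α : DForm C 1) (β : DForm C k) :
    wedge C k 1 n β α = (-1 : ℤ) ^ k • wedge C 1 k n α β := by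
  by_cases h : k + 1 = n
  swap
  · rw [wedge_eq_zero h, wedge_eq_zero (by rwa [add_comm])]
    simp
  subst h
  ext V
  rw [AlternatingMap.smul_apply]
  refine smul_left_cancel_nat (mul_ne_zero k.factorial_ne_zero (Nat.factorial_ne_zero 1)) ?_
  rw [factorial_smul_wedge_apply rfl, smul_comm, mul_comm k.factorial,
    factorial_smul_wedge_apply (add_comm 1 k), Finset.smul_sum,
    ← Equiv.sum_comp (Equiv.mulRight (finRotate (k + 1)))]
  refine Finset.sum_congr rfl fun σ _ => ?_
  have e1 : ∀ i : Fin k, (σ * finRotate (k + 1)) (Fin.cast rfl (Fin.castAdd 1 i))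
      = σ (Fin.cast (add_comm 1 k) (Fin.natAdd 1 i)) := by
    intro i
    rw [Equiv.Perm.mul_apply]
    congr 1
    ext
    have : finRotate (k + 1) (Fin.castSucc i) = Fin.succ i := by
      rw [finRotate_apply, Fin.coeSucc_eq_succ]
    change ((finRotate (k + 1) (Fin.castSucc i) : Fin (k + 1)) : ℕ) = _
    rw [this]
    simp
  have e2 : ∀ i : Fin 1, (σ * finRotate (k + 1)) (Fin.cast rfl (Fin.natAdd k i))
      = σ (Fin.cast (add_comm 1 k) (Fin.castAdd k i)) := by
    intro i
    rw [Subsingleton.elim i 0, Equiv.Perm.mul_apply]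
    congr 1
    exact finRotate_last
  simp only [Equiv.coe_mulRight, e1, e2, Equiv.Perm.sign_mul, sign_finRotate, Nat.add_sub_cancel]
  rw [mul_comm (α _), mul_comm (Equiv.Perm.sign σ), mul_smul]
  simp [Units.smul_def]

theorem wedge_zero_apply {k n : ℕ} (h : k = n) (α : DForm C 0) (β : DForm C k)
    (V : Fin n → VField C) :
    wedge C 0 k n α β V = α Fin.elim0 * β (fun j => V (Fin.cast h j)) := by
  subst h
  refine smul_left_cancel_nat (mul_ne_zero (Nat.factorial_ne_zero 0) k.factorial_ne_zero) ?_
  rw [factorial_smul_wedge_apply (zero_add k)]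
  have e : ∀ σ : Equiv.Perm (Fin k),
      (fun j => V (σ (Fin.cast (zero_add k) (Fin.natAdd 0 j)))) = (fun j => V (Fin.cast rfl j)) ∘ σ := by
    intro σ
    ext1 j
    simp
  have e' : ∀ σ : Equiv.Perm (Fin k),
      (fun j : Fin 0 => V (σ (Fin.cast (zero_add k) (Fin.castAdd k j)))) = Fin.elim0 :=
    fun σ => Subsingleton.elim _ _
  simp only [e, e', AlternatingMap.map_perm]
  simp only [mul_smul_comm, smul_smul, Int.units_mul_self, one_smul, Finset.sum_const,
    Finset.card_univ, Fintype.card_perm, Fintype.card_fin, Nat.factorial_zero, one_mul]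

theorem wedge_zero {k : ℕ} (α : DForm C 0) (β : DForm C k) :
    wedge C 0 k k α β = α Fin.elim0 • β := by
  ext V
  rw [wedge_zero_apply rfl]
  rfl

theorem extDLinear_eq_zero {k n : ℕ} (h : k + 1 ≠ n) : extDLinear C k n = 0 := dif_neg h

theorem extDLinear_apply {k : ℕ} (α : DForm C k) : extDLinear C k (k + 1) α = extD α := by
  simp only [extDLinear, dif_pos]
  rfl

/-- With brackets weighted by 1/2, a Koszul summand is the mean of a directional derivative and a
Lie derivative. Both satisfy the commutator law in Y, which is what makes the next lemma a formal
consequence. -/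
theorem extDLin_eq {k : ℕ} (α : DForm C k) (Y : VField C) (V : Fin k → VField C) :
    extDLin α Y V = (1 / 2 : ℝ) • (Y (α V) + lieDeriv Y α V) := by
  rw [extDLin_apply, lieDeriv_apply, ← add_sub_assoc, smul_sub, ← two_smul ℝ, smul_smul]
  norm_num

theorem extDLin_lieDeriv {k : ℕ} (X Y : VField C) (α : DForm C k) (V : Fin k → VField C) :
    extDLin (lieDeriv X α) Y V
      = X (extDLin α Y V) - extDLin α ⁅X, Y⁆ V
        - ∑ i, extDLin α Y (Function.update V i ⁅X, V i⁆) := by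
  have h := congrArg (fun γ : DForm C k => γ V) (leibniz_lie X Y α)
  simp only [lie_dform, AlternatingMap.add_apply] at h
  rw [lieDeriv_apply X (lieDeriv Y α)] at h
  simp only [extDLin_eq, lieDeriv_apply X α, ← Finset.smul_sum, Finset.sum_add_distrib, map_sub,
    map_sum, map_add, Derivation.map_smul, ← smul_sub, Derivation.commutator_apply]
  congr 1
  linear_combination -h

/-- The exterior derivative alternates `extDLin`, which is natural under X in all its arguments by
`extDLin_lieDeriv`; the identity therefore holds summand by summand. -/
theorem lieDeriv_extD {k : ℕ} (X : VField C) (α : DForm C k) :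
    lieDeriv X (extD α) = extD (lieDeriv X α) := by
  ext V
  have hD : ∀ (β : DForm C k) (W : Fin (k + 1) → VField C), extD β W
      = ∑ i : Fin (k + 1), (-1 : ℤ) ^ (i : ℕ) • extDLin β (W i) (i.removeNth W) := by
    intro β W
    exact (extDAux_eq β W).trans (AlternatingMap.alternatizeUncurryFin_apply _ _)
  rw [lieDeriv_apply]
  simp only [hD, extDLin_lieDeriv]
  rw [map_sum, Finset.sum_comm, ← Finset.sum_sub_distrib]
  refine Finset.sum_congr rfl fun i _ => ?_
  rw [map_zsmul, ← Finset.smul_sum, ← smul_sub]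
  congr 1
  -- A bracket in slot i hits the distinguished vector field; a bracket in any other slot hits an
  -- argument of α.
  rw [Fin.sum_univ_succAbove _ i, Function.update_self, Fin.removeNth_update, ← sub_sub]
  congr 1
  refine Finset.sum_congr rfl fun q _ => ?_
  rw [Fin.removeNth_update_succAbove, Function.update_of_ne (Fin.succAbove_ne i q).symm]
  rfl

theorem lieDeriv_extDLinear {k n : ℕ} (X : VField C) (α : DForm C k) :
    lieDeriv X (extDLinear C k n α) = extDLinear C k n (lieDeriv X α) := by
  by_cases h : k + 1 = n
  · subst h
    rw [extDLinear_apply, extDLinear_apply, lieDeriv_extD]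
  · ext V
    simp [extDLinear_eq_zero h, lieDeriv_apply]

theorem extD_zero_apply (α : DForm C 0) (V : Fin 1 → VField C) :
    extD α V = V 0 (α Fin.elim0) := by
  rw [extD_apply]
  have : (0 : Fin 1).removeNth V = Fin.elim0 := Subsingleton.elim _ _
  simp [this]

/-- The commutator V₀V₁f − V₁V₀f cancels against [V₀,V₁]f, which is assembled from two halves.
Degree 0 is enough: d² = 0 is only needed on gauge parameters. -/
theorem extD_extD_zero (α : DForm C 0) : extD (extD α) = 0 := by
  ext V
  rw [extD_apply]
  have h0 : ∀ i : Fin 2, i.removeNth V 0 = V (i.succAbove 0) := fun _ => rfl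
  have hs : (Fin.succAbove (0 : Fin 2) 0 = 1) ∧ (Fin.succAbove (1 : Fin 2) 0 = 0) := by decide
  have hb : (1 / 2 : ℝ) • (V 0 (V 1 (α Fin.elim0)) - V 1 (V 0 (α Fin.elim0)))
      + (1 / 2 : ℝ) • (V 0 (V 1 (α Fin.elim0)) - V 1 (V 0 (α Fin.elim0)))
      = V 0 (V 1 (α Fin.elim0)) - V 1 (V 0 (α Fin.elim0)) := by
    rw [← add_smul]
    norm_num
  have hu : ∀ i : Fin 2, ∑ j, extD α (Function.update (i.removeNth V) j ⁅V i, i.removeNth V j⁆)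
      = ⁅V i, V (i.succAbove 0)⁆ (α Fin.elim0) := fun i => (Fin.sum_univ_one _).trans (by
    rw [extD_zero_apply, Function.update_self, h0])
  refine (Fin.sum_univ_two _).trans ?_
  rw [hu, hu, hs.1, hs.2]
  simp only [extD_zero_apply, h0, hs.1, hs.2, Derivation.commutator_apply,
    Fin.val_zero, Fin.val_one, pow_zero, pow_one, one_smul, neg_smul,
    AlternatingMap.zero_apply]
  rw [← neg_sub (V 0 (V 1 (α Fin.elim0))), smul_neg]
  linear_combination -hb

/-- The function is differentiated only in the terms Vᵢ(β(…)); the bracket terms are linear over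
`C`. The extra terms form the expansion of df ∧ β along its first factor. -/
theorem extD_smul {k : ℕ} (α : DForm C 0) (β : DForm C k) :
    extD (α Fin.elim0 • β) = wedge C 1 k (k + 1) (extD α) β + α Fin.elim0 • extD β := by
  ext V
  rw [AlternatingMap.add_apply, wedge_one_apply rfl, AlternatingMap.smul_apply, extD_apply,
    extD_apply, Finset.smul_sum, ← Finset.sum_add_distrib]
  refine Finset.sum_congr rfl fun i _ => ?_
  rw [smul_comm _ ((-1 : ℤ) ^ (i : ℕ)), ← smul_add]
  congr 1
  simp only [extD_zero_apply, AlternatingMap.smul_apply, smul_eq_mul, Derivation.leibniz,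
    ← Finset.mul_sum, mul_sub, mul_smul_comm]
  have hi : (fun j => V (i.succAbove j)) = i.removeNth V := rfl
  simp only [Fin.cast_eq_self, hi]
  ring

theorem extDLinear_wedge_zero {k n : ℕ} (α : DForm C 0) (β : DForm C k) :
    extDLinear C k n (wedge C 0 k k α β)
      = wedge C 1 k n (extDLinear C 0 1 α) β + wedge C 0 n n α (extDLinear C k n β) := by
  by_cases h : k + 1 = n
  · subst h
    rw [wedge_zero, wedge_zero, extDLinear_apply, extDLinear_apply, extDLinear_apply, extD_smul]
  · simp [extDLinear_eq_zero h, wedge_eq_zero (p := 1) (q := k) (by rwa [add_comm])]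

end CartanCalculus
-- Invariance of the Hodge operator under Killing fields.
section Hodge

/-- Cramer's rule turns both sides into the trace of adj(A) B. This converts derivatives taken
column by column into derivatives taken row by row. -/
theorem sum_det_updateCol {R n : Type*} [CommRing R] [Fintype n] [DecidableEq n]
    (A B : Matrix n n R) :
    ∑ j, (A.updateCol j fun i => B i j).det = ∑ i, (A.updateRow i (B i)).det := by
  have h1 : ∀ j, (A.updateCol j fun i => B i j).det = ∑ i, A.adjugate j i * B i j := by
    intro j
    rw [← Matrix.cramer_apply, Matrix.cramer_eq_adjugate_mulVec]
    rfl
  have h2 : ∀ i, (A.updateRow i (B i)).det = ∑ j, A.adjugate j i * B i j := by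
    intro i
    rw [← Matrix.cramer_transpose_apply, Matrix.cramer_eq_adjugate_mulVec,
      ← Matrix.adjugate_transpose]
    rfl
  simp only [h1, h2]
  exact Finset.sum_comm

theorem derivation_prod {C ι : Type*} [CommRing C] [Algebra ℝ C] [DecidableEq ι] (X : VField C)
    (s : Finset ι) (f : ι → C) :
    X (∏ i ∈ s, f i) = ∑ j ∈ s, X (f j) * ∏ i ∈ s.erase j, f i := by
  induction s using Finset.induction_on with
  | empty => simp
  | insert a s ha ih =>
    rw [Finset.prod_insert ha, X.leibniz, Finset.sum_insert ha, Finset.erase_insert ha, ih,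
      smul_eq_mul, smul_eq_mul, Finset.mul_sum, add_comm, mul_comm (X (f a))]
    rw [mul_comm]
    congr 1
    refine Finset.sum_congr rfl fun j hj => ?_
    have hja : a ≠ j := fun h => ha (h ▸ hj)
    rw [Finset.erase_insert_of_ne hja, Finset.prod_insert (by simp [ha])]
    ring

theorem derivation_det {C n : Type*} [CommRing C] [Algebra ℝ C] [Fintype n] [DecidableEq n]
    (X : VField C) (A : Matrix n n C) :
    X A.det = ∑ j, (A.updateCol j fun i => X (A i j)).det := by
  simp only [Matrix.det_apply, map_sum]
  rw [Finset.sum_comm]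
  refine Finset.sum_congr rfl fun σ _ => ?_
  rw [map_zsmul_unit, ← Finset.smul_sum, derivation_prod]
  congr 1
  refine Finset.sum_congr rfl fun j _ => ?_
  rw [← Finset.mul_prod_erase _ _ (Finset.mem_univ j), Matrix.updateCol_self]
  congr 1
  refine Finset.prod_congr rfl fun i hi => ?_
  rw [Matrix.updateCol_ne (Finset.ne_of_mem_erase hi)]

theorem dform_sum_apply {C ι : Type*} [CommRing C] [Algebra ℝ C] {k : ℕ} (s : Finset ι)
    (f : ι → DForm C k) (Z : Fin k → VField C) : (∑ i ∈ s, f i) Z = ∑ i ∈ s, f i Z :=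
  map_sum (⟨⟨fun γ => γ Z, rfl⟩, fun _ _ => rfl⟩ : DForm C k →+ C) f s

variable {d : ℕ} {M : Type*} [TopologicalSpace M] [ChartedSpace (EuclideanSpace ℝ (Fin d)) M]

namespace OrientedLorentzian

variable (S : OrientedLorentzian d M)

/-- The Killing equation splits the derivative of each Gram entry g(V_a, Z_b) into a part with [ξ,
V_a] and a part with [ξ, Z_b]. The first is a column replacement; the second is regrouped into row
replacements and cancels the correction terms of the Lie derivative. -/
theorem lieDeriv_flatWedge {S : OrientedLorentzian d M} {ξ : VField (Fn d M)}
    (hξ : S.IsKilling ξ) {m : ℕ} (V : Fin m → VField (Fn d M)) :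
    lieDeriv ξ (flatWedge (Fn d M) S.g m V)
      = ∑ i, flatWedge (Fn d M) S.g m (Function.update V i ⁅ξ, V i⁆) := by
  ext1 Z
  rw [lieDeriv_apply, sub_eq_iff_eq_add]
  change ξ (Matrix.det (Matrix.of fun b a => S.g (V a) (Z b)))
    = (∑ i, flatWedge (Fn d M) S.g m (Function.update V i ⁅ξ, V i⁆)) Z + _
  have e1 : ∀ i, flatWedge (Fn d M) S.g m (Function.update V i ⁅ξ, V i⁆) Z
      = (Matrix.updateCol (Matrix.of fun b a => S.g (V a) (Z b)) i
          fun b => S.g ⁅ξ, V i⁆ (Z b)).det :=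
    fun i => flatWedgeAux_update _ _ _ _ _ _
  have e2 : ∀ i, flatWedge (Fn d M) S.g m V (Function.update Z i ⁅ξ, Z i⁆)
      = (Matrix.updateRow (Matrix.of fun b a => S.g (V a) (Z b)) i
          ((Matrix.of fun b a => S.g (V a) ⁅ξ, Z b⁆) i)).det := by
    intro i
    change Matrix.det (Matrix.of fun b a => S.g (V a) (Function.update Z i ⁅ξ, Z i⁆ b)) = _
    congr 1
    ext1 b a
    by_cases h : b = i
    · subst h; simp
    · simp [h]
  have e3 : ∀ (s : Finset (Fin m)) (f : Fin m → DForm (Fn d M) m),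
      (∑ i ∈ s, f i) Z = ∑ i ∈ s, f i Z :=
    fun s f => dform_sum_apply s f Z
  rw [e3]
  simp only [e1, e2]
  rw [← sum_det_updateCol, derivation_det, ← Finset.sum_add_distrib]
  refine Finset.sum_congr rfl fun j _ => ?_
  rw [← Matrix.det_updateCol_add]
  congr 2
  ext1 b
  exact hξ _ _

variable [IsManifold 𝓘(ℝ, EuclideanSpace ℝ (Fin d)) ∞ M] [T2Space M]

theorem topCoeff_smul_vol_eq (f : Fn d M) : S.topCoeff (f • S.vol) = f :=
  ((S.exists_topCoeff (f • S.vol)).choose_spec.2 f rfl).symm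

/-- The product vol ⊗ vol is minus the Gram determinant, hence invariant. If L_ξ vol = f vol, this
gives 2 f vol(X)² = 0 at every point, and therefore f vol(X) = 0 in ℝ. -/
theorem lieDeriv_vol {S : OrientedLorentzian d M} {ξ : VField (Fn d M)} (hξ : S.IsKilling ξ) :
    lieDeriv ξ S.vol = 0 := by
  have hv : ∀ X Z, S.vol X * S.vol Z = -flatWedge (Fn d M) S.g d X Z := by
    intro X Z
    rw [S.vol_mul_vol, ← Matrix.det_transpose]
    rfl
  have h1 : ∀ X Z, lieDeriv ξ S.vol X * S.vol Z + S.vol X * lieDeriv ξ S.vol Z = 0 := by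
    intro X Z
    have h2 := congrArg (fun γ : DForm (Fn d M) d => γ Z) (lieDeriv_flatWedge hξ X)
    have e3 : ∀ (s : Finset (Fin d)) (f : Fin d → DForm (Fn d M) d),
        (∑ i ∈ s, f i) Z = ∑ i ∈ s, f i Z :=
    fun s f => dform_sum_apply s f Z
    have h3 := congrArg ξ (hv X Z)
    simp only [e3, lieDeriv_apply] at h2
    rw [map_neg, ξ.leibniz, smul_eq_mul, smul_eq_mul] at h3
    simp only [← neg_eq_iff_eq_neg] at hv
    simp only [← hv, Finset.sum_neg_distrib, ← Finset.mul_sum, ← Finset.sum_mul, map_neg] at h2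
    simp only [← hv, map_neg, neg_neg] at h3
    rw [lieDeriv_apply, lieDeriv_apply]
    linear_combination h3 - h2
  ext X y
  have hy : ∀ f g : Fn d M, (f * g) y = f y * g y := fun _ _ => rfl
  obtain ⟨f, hf, -⟩ := S.exists_topCoeff (lieDeriv ξ S.vol)
  have h2 := congrArg (fun k : Fn d M => k y) (h1 X X)
  rw [hf] at h2 ⊢
  have h3 : (f y * S.vol X y) * S.vol X y + S.vol X y * (f y * S.vol X y) = 0 := h2
  change f y * S.vol X y = 0
  have h4 : (f y * S.vol X y) * (f y * S.vol X y) = 0 := by linear_combination (f y / 2) * h3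
  exact mul_self_eq_zero.1 h4

theorem topCoeff_lieDeriv {S : OrientedLorentzian d M} {ξ : VField (Fn d M)}
    (hξ : S.IsKilling ξ) (α : DForm (Fn d M) d) :
    S.topCoeff (lieDeriv ξ α) = ξ (S.topCoeff α) := by
  have h : lieDeriv ξ α = ξ (S.topCoeff α) • S.vol := by
    ext1 X
    have h1 := congrArg (fun γ : DForm (Fn d M) d => γ X) (lieDeriv_vol hξ)
    conv_lhs => rw [← S.topCoeff_smul_vol α]
    simp only [lieDeriv_apply, AlternatingMap.smul_apply, ξ.leibniz, smul_eq_mul,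
      ← Finset.mul_sum, AlternatingMap.zero_apply] at h1 ⊢
    linear_combination S.topCoeff α * h1
  rw [h, S.topCoeff_smul_vol_eq]

theorem hodge_apply {k m : ℕ} (β : DForm (Fn d M) k) (V : Fin m → VField (Fn d M)) :
    S.hodge k m β V
      = -S.topCoeff (wedge (Fn d M) k m d β (flatWedge (Fn d M) S.g m V)) := rfl

/-- The Hodge operator is assembled from the wedge product, the forms V₁♭ ∧ ⋯ ∧ V_m♭ and the
coefficient with respect to vol, all of which are natural under a Killing field. -/
theorem lieDeriv_hodge {S : OrientedLorentzian d M} {ξ : VField (Fn d M)}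
    (hξ : S.IsKilling ξ) {k m : ℕ} (β : DForm (Fn d M) k) :
    lieDeriv ξ (S.hodge k m β) = S.hodge k m (lieDeriv ξ β) := by
  ext1 V
  simp only [lieDeriv_apply, hodge_apply, map_neg, Finset.sum_neg_distrib]
  rw [← topCoeff_lieDeriv hξ, lieDeriv_wedge, lieDeriv_flatWedge hξ, map_add, map_sum, map_sum]
  ring

theorem hodge_eq_zero {k m : ℕ} (h : k + m ≠ d) : S.hodge k m = 0 := by
  ext1 β
  ext1 V
  rw [hodge_apply, wedge_eq_zero h]
  simp

theorem hodge_wedge_zero {k m : ℕ} (α : DForm (Fn d M) 0) (β : DForm (Fn d M) k) :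
    S.hodge k m (wedge (Fn d M) 0 k k α β) = wedge (Fn d M) 0 m m α (S.hodge k m β) := by
  rw [wedge_zero, wedge_zero, map_smul]

end OrientedLorentzian

end Hodge
-- Formal power series with coefficients in vector spaces and in linear maps.
section SeriesCalculus

variable {V W X Y Z V' W' X' : Type*}
  [AddCommGroup V] [Module ℂ V] [AddCommGroup W] [Module ℂ W] [AddCommGroup X] [Module ℂ X]
  [AddCommGroup Y] [Module ℂ Y] [AddCommGroup Z] [Module ℂ Z]
  [AddCommGroup V'] [Module ℂ V'] [AddCommGroup W'] [Module ℂ W'] [AddCommGroup X'] [Module ℂ X']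

theorem serMap_apply (f : V →ₗ[ℂ] W) (v : Ser V) (n : ℕ) : serMap f v n = f (v n) := rfl

theorem serMap₂_apply (b : V →ₗ[ℂ] W →ₗ[ℂ] X) (v : Ser V) (w : Ser W) (n : ℕ) :
    serMap₂ b v w n = ∑ p ∈ Finset.HasAntidiagonal.antidiagonal n, b (v p.1) (w p.2) := rfl

/-- Associativity of the Cauchy product for an arbitrary associativity law of bilinear maps.
Composition against evaluation, the associator and `idTensor` are all instances. -/
theorem serMap₂_assoc {b : V →ₗ[ℂ] W →ₗ[ℂ] X} {c : X →ₗ[ℂ] Y →ₗ[ℂ] Z}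
    {b' : W →ₗ[ℂ] Y →ₗ[ℂ] X'} {c' : V →ₗ[ℂ] X' →ₗ[ℂ] Z}
    (h : ∀ v w y, c (b v w) y = c' v (b' w y)) (v : Ser V) (w : Ser W) (y : Ser Y) :
    serMap₂ c (serMap₂ b v w) y = serMap₂ c' v (serMap₂ b' w y) := by
  funext n
  simp only [serMap₂_apply, map_sum, LinearMap.sum_apply, h]
  rw [Finset.sum_sigma', Finset.sum_sigma']
  -- Both double sums run over triples of exponents with sum n, grouped as (i + j) + k and as i + (j
  -- + k).
  refine Finset.sum_nbij' (fun x => ⟨(x.2.1, x.2.2 + x.1.2), (x.2.2, x.1.2)⟩)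
    (fun x => ⟨(x.1.1 + x.2.1, x.2.2), (x.1.1, x.2.1)⟩) ?_ ?_ ?_ ?_ ?_
  all_goals
    simp only [Finset.mem_sigma, Finset.HasAntidiagonal.mem_antidiagonal, Sigma.forall,
      Prod.forall, and_imp]
  · intro a b c d h1 h2
    exact ⟨by omega, trivial⟩
  · intro a b c d h1 h2
    exact ⟨by omega, trivial⟩
  · rintro a b c d h1 rfl
    rfl
  · rintro a b c d h1 rfl
    rfl
  · intros
    trivial

theorem serMap_serMap₂ (f : X →ₗ[ℂ] Y) (b : V →ₗ[ℂ] W →ₗ[ℂ] X) (v : Ser V) (w : Ser W) :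
    serMap f (serMap₂ b v w) = serMap₂ (b.compr₂ f) v w := by
  funext n
  simp [serMap_apply, serMap₂_apply]

theorem serMap₂_serMap (b : V' →ₗ[ℂ] W' →ₗ[ℂ] X) (f : V →ₗ[ℂ] V') (g : W →ₗ[ℂ] W') (v : Ser V)
    (w : Ser W) : serMap₂ b (serMap f v) (serMap g w) = serMap₂ (b.compl₁₂ f g) v w := rfl

theorem serMap₂_single (b : V →ₗ[ℂ] W →ₗ[ℂ] X) (v : V) (w : Ser W) :
    serMap₂ b (Pi.single 0 v) w = serMap (b v) w := by
  funext n
  rw [serMap₂_apply, serMap_apply, Finset.sum_eq_single_of_mem (0, n) (by simp)]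
  · simp
  · rintro ⟨i, j⟩ hij hne
    have hi : i ≠ 0 := by
      rintro rfl
      refine hne ?_
      simpa using hij
    simp [Pi.single_eq_of_ne hi]

theorem serMap₂_flip (b : V →ₗ[ℂ] W →ₗ[ℂ] X) (v : Ser V) (w : Ser W) :
    serMap₂ b v w = serMap₂ b.flip w v := by
  funext n
  rw [serMap₂_apply, serMap₂_apply, ← Finset.Nat.sum_antidiagonal_swap]
  rfl

theorem serMap₂_add_left (b : V →ₗ[ℂ] W →ₗ[ℂ] X) (v v' : Ser V) (w : Ser W) :
    serMap₂ b (v + v') w = serMap₂ b v w + serMap₂ b v' w := by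
  funext n
  simp [serMap₂_apply, Finset.sum_add_distrib]

theorem serMap₂_add_right (b : V →ₗ[ℂ] W →ₗ[ℂ] X) (v : Ser V) (w w' : Ser W) :
    serMap₂ b v (w + w') = serMap₂ b v w + serMap₂ b v w' := by
  funext n
  simp [serMap₂_apply, Finset.sum_add_distrib]

theorem serMap₂_smul_left (b : V →ₗ[ℂ] W →ₗ[ℂ] X) (c : ℂ) (v : Ser V) (w : Ser W) :
    serMap₂ b (c • v) w = c • serMap₂ b v w := by
  funext n
  simp [serMap₂_apply, Finset.smul_sum]

theorem serMap₂_smul_right (b : V →ₗ[ℂ] W →ₗ[ℂ] X) (c : ℂ) (v : Ser V) (w : Ser W) :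
    serMap₂ b v (c • w) = c • serMap₂ b v w := by
  funext n
  simp [serMap₂_apply, Finset.smul_sum]

theorem serMap_serMap (f : V →ₗ[ℂ] W) (g : W →ₗ[ℂ] X) (v : Ser V) :
    serMap g (serMap f v) = serMap (g ∘ₗ f) v := rfl

theorem serApply_single (f : V →ₗ[ℂ] W) (v : Ser V) : serApply (Pi.single 0 f) v = serMap f v :=
  serMap₂_single _ _ _

theorem serApply_serComp (g : Ser (W →ₗ[ℂ] X)) (f : Ser (V →ₗ[ℂ] W)) (v : Ser V) :
    serApply (serComp g f) v = serApply g (serApply f v) :=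
  serMap₂_assoc (fun _ _ _ => rfl) g f v

theorem serApply_llcomp (f : W →ₗ[ℂ] X) (g : Ser (V →ₗ[ℂ] W)) (v : Ser V) :
    serApply (serMap (LinearMap.llcomp ℂ V W X f) g) v = serMap f (serApply g v) := by
  rw [serApply, serApply, serMap_serMap₂]
  rfl

theorem serApply_tensorRight (v : Ser V) (w : Ser W) :
    serApply (tensorRight V w) v = serTensor v w := by
  rw [serTensor, serMap₂_flip]
  rfl

theorem serApply_tensorLeft (v : Ser V) (w : Ser W) :
    serApply (tensorLeft W v) w = serTensor v w := rfl

theorem serApply_idTensor (f : Ser (W →ₗ[ℂ] X)) (v : Ser V) (w : Ser W) :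
    serApply (idTensor V f) (serTensor v w) = serTensor v (serApply f w) := by
  have h1 : serApply (idTensor V f) (serTensor v w)
      = serMap₂ ((LinearMap.lTensorHom V).flip.flip) f (serMap₂ (TensorProduct.mk ℂ V W) v w) := rfl
  have h2 : serTensor v (serApply f w)
      = serMap₂ (TensorProduct.mk ℂ V X) v (serMap₂ LinearMap.id.flip w f) := by
    rw [serTensor, serApply, serMap₂_flip LinearMap.id]
  rw [h1, serMap₂_flip, h2]
  exact serMap₂_assoc (fun v w f => rfl) v w f

theorem idTensor_serComp (g : Ser (W →ₗ[ℂ] X)) (f : Ser (Y →ₗ[ℂ] W)) :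
    idTensor V (serComp g f) = serComp (idTensor V g) (idTensor V f) := by
  rw [idTensor, idTensor, idTensor, serComp, serComp, serMap_serMap₂, serMap₂_serMap]
  congr 1
  ext1 g
  ext1 f
  exact LinearMap.lTensor_comp V g f

theorem idTensor_single (f : W →ₗ[ℂ] X) :
    idTensor V (Pi.single 0 f) = Pi.single 0 (f.lTensor V) := by
  funext n
  rcases eq_or_ne n 0 with rfl | h
  · simp [idTensor, serMap_apply]
  · simp [idTensor, serMap_apply, h]

theorem idTensor_add (f g : Ser (W →ₗ[ℂ] X)) :
    idTensor V (f + g) = idTensor V f + idTensor V g := map_add _ _ _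

theorem serApply_add_left (f g : Ser (V →ₗ[ℂ] W)) (v : Ser V) :
    serApply (f + g) v = serApply f v + serApply g v := serMap₂_add_left _ _ _ _

theorem serApply_add_right (f : Ser (V →ₗ[ℂ] W)) (v w : Ser V) :
    serApply f (v + w) = serApply f v + serApply f w := serMap₂_add_right _ _ _ _

theorem serApply_smul_left (c : ℂ) (f : Ser (V →ₗ[ℂ] W)) (v : Ser V) :
    serApply (c • f) v = c • serApply f v := serMap₂_smul_left _ _ _ _

theorem serApply_smul_right (c : ℂ) (f : Ser (V →ₗ[ℂ] W)) (v : Ser V) :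
    serApply f (c • v) = c • serApply f v := serMap₂_smul_right _ _ _ _

theorem serMap_serTensor (f : V →ₗ[ℂ] V') (g : W →ₗ[ℂ] W') (v : Ser V) (w : Ser W) :
    serMap (TensorProduct.map f g) (serTensor v w) = serTensor (serMap f v) (serMap g w) := by
  rw [serTensor, serTensor, serMap_serMap₂, serMap₂_serMap]
  rfl

theorem serMap_comm_serTensor (v : Ser V) (w : Ser W) :
    serMap (TensorProduct.comm ℂ V W).toLinearMap (serTensor v w) = serTensor w v := by
  rw [serTensor, serTensor, serMap_serMap₂, serMap₂_flip]
  rfl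

theorem serMap_assoc_serTensor (v : Ser V) (w : Ser W) (x : Ser X) :
    serMap (TensorProduct.assoc ℂ V W X).toLinearMap (serTensor (serTensor v w) x)
      = serTensor v (serTensor w x) := by
  rw [serTensor, serMap_serMap₂]
  exact serMap₂_assoc (fun _ _ _ => rfl) v w x

/-- The formal series of operators through which a power series acts on a representation. -/
def opSer {R : Type*} [Ring R] [Algebra ℂ R] (ρ : R →ₐ[ℂ] Module.End ℂ V) (P : PowerSeries R) :
    Ser (V →ₗ[ℂ] V) :=
  fun n => ρ (PowerSeries.coeff n P)

section OpSer

variable {R R' : Type*} [Ring R] [Algebra ℂ R] [Ring R'] [Algebra ℂ R']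

theorem opSer_mul (ρ : R →ₐ[ℂ] Module.End ℂ V) (P Q : PowerSeries R) (v : Ser V) :
    serApply (opSer ρ (P * Q)) v = serApply (opSer ρ P) (serApply (opSer ρ Q) v) := by
  rw [← serApply_serComp]
  congr 1
  funext n
  simp only [opSer, PowerSeries.coeff_mul, map_sum, map_mul]
  rfl

theorem opSer_one (ρ : R →ₐ[ℂ] Module.End ℂ V) (v : Ser V) :
    serApply (opSer ρ 1) v = v := by
  have h : opSer ρ 1 = Pi.single 0 (LinearMap.id : V →ₗ[ℂ] V) := by
    funext n
    rcases eq_or_ne n 0 with rfl | h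
    · simp [opSer]
      rfl
    · simp [opSer, PowerSeries.coeff_one, h]
  rw [h, serApply_single]
  rfl

theorem opSer_map (ρ : R →ₐ[ℂ] Module.End ℂ V) (f : R' →ₐ[ℂ] R) (P : PowerSeries R') :
    opSer ρ (PowerSeries.map f.toRingHom P) = opSer (ρ.comp f) P := rfl

theorem serMap_opSer {ρ : R →ₐ[ℂ] Module.End ℂ V} {ρ' : R →ₐ[ℂ] Module.End ℂ W}
    {f : V →ₗ[ℂ] W} (h : ∀ r, f ∘ₗ ρ r = ρ' r ∘ₗ f) (P : PowerSeries R) (v : Ser V) :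
    serMap f (serApply (opSer ρ P) v) = serApply (opSer ρ' P) (serMap f v) := by
  rw [serApply, serApply, serMap_serMap₂]
  funext n
  simp only [serMap₂_apply]
  exact Finset.sum_congr rfl fun p _ => LinearMap.congr_fun (h _) _

end OpSer

end SeriesCalculus

/-! ### Drinfel'd twists: naturality, braided flip and associativity of ⊗⋆. -/

section TwistCalculus

attribute [local instance 100] LieRing.ofAssociativeRing

variable {L : Type*} [LieRing L] [LieAlgebra ℂ L]

/-- The elements satisfying p form a subalgebra containing the image of L. By the universal property
the identity factors through it, so it is everything. -/
theorem uenv_induction {p : UEnv L → Prop} (h0 : ∀ c, p (algebraMap ℂ (UEnv L) c))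
    (hι : ∀ x, p (UniversalEnvelopingAlgebra.ι ℂ x)) (hadd : ∀ a b, p a → p b → p (a + b))
    (hmul : ∀ a b, p a → p b → p (a * b)) (u : UEnv L) : p u := by
  let s : Subalgebra ℂ (UEnv L) :=
    { carrier := {u | p u}
      mul_mem' := fun ha hb => hmul _ _ ha hb
      add_mem' := fun ha hb => hadd _ _ ha hb
      algebraMap_mem' := h0 }
  let f : L →ₗ⁅ℂ⁆ s :=
    { toFun := fun x => ⟨UniversalEnvelopingAlgebra.ι ℂ x, hι x⟩
      map_add' := fun x y => Subtype.ext (map_add _ _ _)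
      map_smul' := fun c x => Subtype.ext (map_smul _ _ _)
      map_lie' := fun {x y} => Subtype.ext (LieHom.map_lie _ _ _) }
  have h : s.val.comp (UniversalEnvelopingAlgebra.lift ℂ f) = AlgHom.id ℂ (UEnv L) := by
    apply UniversalEnvelopingAlgebra.hom_ext
    ext x
    simp [f]
  rw [← AlgHom.id_apply (R := ℂ) u, ← h]
  exact (UniversalEnvelopingAlgebra.lift ℂ f u).2

section EquivariantBasic

variable {L V W X : Type*} [LieRing L]
  [AddCommGroup V] [Module ℂ V] [LieRingModule L V]
  [AddCommGroup W] [Module ℂ W] [LieRingModule L W]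
  [AddCommGroup X] [Module ℂ X] [LieRingModule L X]

variable (L) in
/-- Linear maps which commute with the action of the Lie algebra `L`. -/
def Equivariant (f : V →ₗ[ℂ] W) : Prop := ∀ (x : L) (v : V), f ⁅x, v⁆ = ⁅x, f v⁆

namespace Equivariant

theorem comp {g : W →ₗ[ℂ] X} {f : V →ₗ[ℂ] W} (hg : Equivariant L g) (hf : Equivariant L f) :
    Equivariant L (g ∘ₗ f) := fun x v => by
  rw [LinearMap.comp_apply, hf, hg, LinearMap.comp_apply]

theorem add {f g : V →ₗ[ℂ] W} (hf : Equivariant L f) (hg : Equivariant L g) :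
    Equivariant L (f + g) := fun x v => by
  rw [LinearMap.add_apply, hf, hg, LinearMap.add_apply, lie_add]

theorem neg {f : V →ₗ[ℂ] W} (hf : Equivariant L f) : Equivariant L (-f) := fun x v => by
  rw [LinearMap.neg_apply, hf, LinearMap.neg_apply, lie_neg]

theorem sub {f g : V →ₗ[ℂ] W} (hf : Equivariant L f) (hg : Equivariant L g) :
    Equivariant L (f - g) := fun x v => by
  rw [LinearMap.sub_apply, hf, hg, LinearMap.sub_apply, lie_sub]

theorem id : Equivariant L (LinearMap.id : V →ₗ[ℂ] V) := fun _ _ => rfl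

theorem smul [LieAlgebra ℂ L] [LieModule ℂ L W] {f : V →ₗ[ℂ] W} (c : ℂ) (hf : Equivariant L f) :
    Equivariant L (c • f) := fun x v => by
  rw [LinearMap.smul_apply, hf, LinearMap.smul_apply, lie_smul]

end Equivariant

end EquivariantBasic

variable {V W X V' W' X' : Type*}
  [AddCommGroup V] [Module ℂ V] [LieRingModule L V] [LieModule ℂ L V]
  [AddCommGroup W] [Module ℂ W] [LieRingModule L W] [LieModule ℂ L W]
  [AddCommGroup X] [Module ℂ X] [LieRingModule L X] [LieModule ℂ L X]
  [AddCommGroup V'] [Module ℂ V'] [LieRingModule L V'] [LieModule ℂ L V']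
  [AddCommGroup W'] [Module ℂ W'] [LieRingModule L W'] [LieModule ℂ L W']
  [AddCommGroup X'] [Module ℂ X'] [LieRingModule L X'] [LieModule ℂ L X']

namespace Equivariant

theorem tensorMap {f : V →ₗ[ℂ] V'} {g : W →ₗ[ℂ] W'} (hf : Equivariant L f)
    (hg : Equivariant L g) : Equivariant L (TensorProduct.map f g) := fun x t => by
  induction t using TensorProduct.induction_on with
  | zero => simp
  | tmul v w => simp [hf x v, hg x w]
  | add a b ha hb => simp only [lie_add, map_add, ha, hb]

theorem rTensor {f : V →ₗ[ℂ] V'} (hf : Equivariant L f) : Equivariant L (f.rTensor W) :=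
  hf.tensorMap id

theorem lTensor {f : V →ₗ[ℂ] V'} (hf : Equivariant L f) : Equivariant L (f.lTensor W) :=
  id.tensorMap hf

theorem tensorComm : Equivariant L (TensorProduct.comm ℂ V W).toLinearMap := fun x t => by
  induction t using TensorProduct.induction_on with
  | zero => simp
  | tmul v w => simp [add_comm]
  | add a b ha hb => simp only [lie_add, map_add, ha, hb]

theorem tensorAssoc : Equivariant L (TensorProduct.assoc ℂ V W X).toLinearMap := fun x t => by
  have h : (TensorProduct.assoc ℂ V W X).toLinearMap ∘ₗ LieModule.toEnd ℂ L _ x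
      = LieModule.toEnd ℂ L _ x ∘ₗ (TensorProduct.assoc ℂ V W X).toLinearMap := by
    refine TensorProduct.ext_threefold fun v w y => ?_
    simp [TensorProduct.add_tmul, TensorProduct.tmul_add, add_assoc]
  exact LinearMap.congr_fun h t

theorem uAct_comm {f : V →ₗ[ℂ] W} (hf : Equivariant L f) (u : UEnv L) :
    f ∘ₗ uAct L V u = uAct L W u ∘ₗ f := by
  induction u using uenv_induction with
  | h0 c =>
    ext v
    simp
  | hι x =>
    ext v
    simp [uAct, hf x v]
  | hadd a b ha hb => rw [map_add, map_add, LinearMap.comp_add, LinearMap.add_comp, ha, hb]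
  | hmul a b ha hb =>
    rw [map_mul, map_mul, Module.End.mul_eq_comp, Module.End.mul_eq_comp, ← LinearMap.comp_assoc,
      ha, LinearMap.comp_assoc, hb, LinearMap.comp_assoc]

end Equivariant

/-- The factorwise action of a tensor product of algebras on a tensor product of modules. -/
def tensorRep {R R' V W : Type*} [Ring R] [Algebra ℂ R] [Ring R'] [Algebra ℂ R']
    [AddCommGroup V] [Module ℂ V] [AddCommGroup W] [Module ℂ W]
    (ρ : R →ₐ[ℂ] Module.End ℂ V) (ρ' : R' →ₐ[ℂ] Module.End ℂ W) :
    R ⊗[ℂ] R' →ₐ[ℂ] Module.End ℂ (V ⊗[ℂ] W) :=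
  (Module.endTensorEndAlgHom (R := ℂ) (S := ℂ) (A := ℂ) (M := V) (N := W)).comp
    (Algebra.TensorProduct.map ρ ρ')

theorem tensorRep_tmul {R R' V W : Type*} [Ring R] [Algebra ℂ R] [Ring R'] [Algebra ℂ R']
    [AddCommGroup V] [Module ℂ V] [AddCommGroup W] [Module ℂ W]
    (ρ : R →ₐ[ℂ] Module.End ℂ V) (ρ' : R' →ₐ[ℂ] Module.End ℂ W) (r : R) (r' : R') :
    tensorRep ρ ρ' (r ⊗ₜ r') = TensorProduct.map (ρ r) (ρ' r') := rfl

/-- Both algebra maps agree on L, where the coproduct encodes the Leibniz action on a tensor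
product. This interprets the factors Δ ⊗ id and id ⊗ Δ of the cocycle condition. -/
theorem tensorRep_coproduct :
    (tensorRep (uAct L V) (uAct L W)).comp (coproduct L) = uAct L (V ⊗[ℂ] W) := by
  apply UniversalEnvelopingAlgebra.hom_ext
  ext x : 1
  refine TensorProduct.ext' fun v w => ?_
  simp [coproduct, uAct, tensorRep_tmul]

theorem serAct₂_eq (P : PowerSeries (UEnv L ⊗[ℂ] UEnv L)) :
    serAct₂ V W P = opSer (tensorRep (uAct L V) (uAct L W)) P := rfl

namespace DrinfeldTwist

variable (T : DrinfeldTwist L)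

/-- The coefficients of F⁻¹ act through enveloping algebra elements on each factor separately, and
equivariant maps commute with these. -/
theorem serMap_invAct {f : V →ₗ[ℂ] V'} {g : W →ₗ[ℂ] W'} (hf : Equivariant L f)
    (hg : Equivariant L g) (t : Ser (V ⊗[ℂ] W)) :
    serMap (TensorProduct.map f g) (serApply (T.invAct V W) t)
      = serApply (T.invAct V' W') (serMap (TensorProduct.map f g) t) := by
  refine serMap_opSer (fun r => ?_) _ _
  induction r using TensorProduct.induction_on with
  | zero => simp
  | tmul a b =>
    change TensorProduct.map f g ∘ₗ TensorProduct.map (uAct L V a) (uAct L W b)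
      = TensorProduct.map (uAct L V' a) (uAct L W' b) ∘ₗ TensorProduct.map f g
    rw [← TensorProduct.map_comp, ← TensorProduct.map_comp, hf.uAct_comm, hg.uAct_comm]
  | add a b ha hb => rw [map_add, map_add, LinearMap.comp_add, LinearMap.add_comp, ha, hb]

theorem serMap_starTensor {f : V →ₗ[ℂ] V'} {g : W →ₗ[ℂ] W'} (hf : Equivariant L f)
    (hg : Equivariant L g) (v : Ser V) (w : Ser W) :
    serMap (TensorProduct.map f g) (T.starTensor v w)
      = T.starTensor (serMap f v) (serMap g w) := by
  rw [starTensor, starTensor, T.serMap_invAct hf hg, serMap_serTensor]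

theorem serMap_rTensor_starTensor {f : V →ₗ[ℂ] V'} (hf : Equivariant L f) (v : Ser V)
    (w : Ser W) : serMap (f.rTensor W) (T.starTensor v w) = T.starTensor (serMap f v) w :=
  T.serMap_starTensor hf .id v w

theorem serMap_lTensor_starTensor {g : W →ₗ[ℂ] W'} (hg : Equivariant L g) (v : Ser V)
    (w : Ser W) : serMap (g.lTensor V) (T.starTensor v w) = T.starTensor v (serMap g w) :=
  T.serMap_starTensor .id hg v w

theorem starTensor_add_left (v v' : Ser V) (w : Ser W) :
    T.starTensor (v + v') w = T.starTensor v w + T.starTensor v' w := by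
  simp only [starTensor, serTensor, serMap₂_add_left, serApply_add_right]

theorem starTensor_add_right (v : Ser V) (w w' : Ser W) :
    T.starTensor v (w + w') = T.starTensor v w + T.starTensor v w' := by
  simp only [starTensor, serTensor, serMap₂_add_right, serApply_add_right]

theorem starTensor_smul_left (c : ℂ) (v : Ser V) (w : Ser W) :
    T.starTensor (c • v) w = c • T.starTensor v w := by
  simp only [starTensor, serTensor, serMap₂_smul_left, serApply_smul_right]

theorem starTensor_smul_right (c : ℂ) (v : Ser V) (w : Ser W) :
    T.starTensor v (c • w) = c • T.starTensor v w := by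
  simp only [starTensor, serTensor, serMap₂_smul_right, serApply_smul_right]

theorem invAct_braidAct (t : Ser (V ⊗[ℂ] W)) :
    serApply (T.invAct W V) (serApply (T.braidAct W V)
        (serMap (TensorProduct.comm ℂ V W).toLinearMap t))
      = serMap (TensorProduct.comm ℂ V W).toLinearMap (serApply (T.invAct V W) t) := by
  have hflip : ∀ P : PowerSeries (UEnv L ⊗[ℂ] UEnv L), flipSer (flipSer P) = P := by
    intro P
    ext n
    change TensorProduct.comm ℂ _ _ (TensorProduct.comm ℂ _ _ _) = _
    exact (TensorProduct.comm ℂ (UEnv L) (UEnv L)).symm_apply_apply _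
  -- Here R₂₁ = F F₂₁⁻¹, so F⁻¹R₂₁ = F₂₁⁻¹, which is F⁻¹ conjugated by the flip.
  rw [invAct, braidAct, serAct₂_eq, serAct₂_eq, ← opSer_mul, rMatrix, map_mul, hflip, ← mul_assoc,
    Units.inv_mul, one_mul]
  refine Eq.symm ((serMap_opSer (ρ' := (tensorRep (uAct L W) (uAct L V)).comp
    (Algebra.TensorProduct.comm ℂ (UEnv L) (UEnv L)).toAlgHom) (fun r => ?_) _ _))
  induction r using TensorProduct.induction_on with
  | zero => simp
  | tmul a b => exact TensorProduct.ext' fun v w => rfl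
  | add a b ha hb => rw [map_add, map_add, LinearMap.comp_add, LinearMap.add_comp, ha, hb]

/-- Braiding followed by the twist is an untwisted flip of a star product. Through this identity
every occurrence of the R-matrix is eliminated. -/
theorem invAct_braidTensor (v : Ser V) (w : Ser W) :
    serApply (T.invAct V W) (T.braidTensor v w)
      = serMap (TensorProduct.comm ℂ W V).toLinearMap (T.starTensor w v) := by
  rw [starTensor, ← invAct_braidAct, serMap_comm_serTensor]
  rfl

/-- Star products use F⁻¹, so the cocycle condition is needed with inverses, in reversed order. It
is obtained by inverting an equation in a group of units. -/
theorem inv_cocycle :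
    PowerSeries.map ((Algebra.TensorProduct.assoc ℂ ℂ ℂ (UEnv L) (UEnv L) (UEnv L)).toAlgHom.comp
        (Algebra.TensorProduct.map (coproduct L) (AlgHom.id ℂ (UEnv L)))).toRingHom (T.F⁻¹).val
      * PowerSeries.map ((Algebra.TensorProduct.assoc ℂ ℂ ℂ (UEnv L) (UEnv L) (UEnv L)).toAlgHom.comp
        Algebra.TensorProduct.includeLeft).toRingHom (T.F⁻¹).val
    = PowerSeries.map (Algebra.TensorProduct.map (AlgHom.id ℂ (UEnv L)) (coproduct L)).toRingHom
        (T.F⁻¹).val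
      * PowerSeries.map (Algebra.TensorProduct.includeRight :
        UEnv L ⊗[ℂ] UEnv L →ₐ[ℂ] UEnv L ⊗[ℂ] (UEnv L ⊗[ℂ] UEnv L)).toRingHom (T.F⁻¹).val := by
  have h : ∀ {R : Type _} [Ring R] (φ ψ χ κ : UEnv L ⊗[ℂ] UEnv L →+* R),
      PowerSeries.map φ T.F.val * PowerSeries.map ψ T.F.val
        = PowerSeries.map χ T.F.val * PowerSeries.map κ T.F.val →
      PowerSeries.map ψ (T.F⁻¹).val * PowerSeries.map φ (T.F⁻¹).val
        = PowerSeries.map κ (T.F⁻¹).val * PowerSeries.map χ (T.F⁻¹).val := by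
    intro R _ φ ψ χ κ hc
    have hu : Units.map (PowerSeries.map φ : _ →* PowerSeries R) T.F
          * Units.map (PowerSeries.map ψ : _ →* PowerSeries R) T.F
        = Units.map (PowerSeries.map χ : _ →* PowerSeries R) T.F
          * Units.map (PowerSeries.map κ : _ →* PowerSeries R) T.F := Units.ext hc
    have hi := congrArg Inv.inv hu
    rw [mul_inv_rev, mul_inv_rev] at hi
    exact congrArg Units.val hi
  exact h _ _ _ _ T.cocycle

/-- The inverse cocycle condition, read in the representation V ⊗ W ⊗ X. The first two factors enter
as an arbitrary series t, since the lemma is also applied to a braided tensor R_k v ⊗ R^k λ. -/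
theorem invAct_assoc (t : Ser (V ⊗[ℂ] W)) (x : Ser X) :
    serApply (T.invAct V (W ⊗[ℂ] X)) (serApply (idTensor V (T.invAct W X))
        (serMap (TensorProduct.assoc ℂ V W X).toLinearMap (serTensor t x)))
      = serMap (TensorProduct.assoc ℂ V W X).toLinearMap
          (T.starTensor (serApply (T.invAct V W) t) x) := by
  let ρ := tensorRep (uAct L V) (tensorRep (uAct L W) (uAct L X))
  let α := Algebra.TensorProduct.assoc ℂ ℂ ℂ (UEnv L) (UEnv L) (UEnv L)
  have h1 : T.invAct V (W ⊗[ℂ] X) = opSer ρ (PowerSeries.map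
      (Algebra.TensorProduct.map (AlgHom.id ℂ (UEnv L)) (coproduct L)).toRingHom (T.F⁻¹).val) := by
    rw [opSer_map, invAct, serAct₂_eq]
    congr 1
    rw [← tensorRep_coproduct]
    exact Algebra.TensorProduct.ext' fun a b => rfl
  have h2 : idTensor V (T.invAct W X) = opSer ρ (PowerSeries.map
      (Algebra.TensorProduct.includeRight : UEnv L ⊗[ℂ] UEnv L →ₐ[ℂ]
        UEnv L ⊗[ℂ] (UEnv L ⊗[ℂ] UEnv L)).toRingHom (T.F⁻¹).val) := by
    rw [opSer_map]
    funext n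
    change (tensorRep (uAct L W) (uAct L X) _).lTensor V = tensorRep _ _ (1 ⊗ₜ _)
    rw [tensorRep_tmul, map_one]
    rfl
  let ρ' := tensorRep (tensorRep (uAct L V) (uAct L W)) (uAct L X)
  -- The associator of modules intertwines the two bracketings of the action, along the associator
  -- of algebras.
  have hα : ∀ r, (TensorProduct.assoc ℂ V W X).toLinearMap ∘ₗ ρ' r
      = ρ (α r) ∘ₗ (TensorProduct.assoc ℂ V W X).toLinearMap := by
    intro r
    induction r using TensorProduct.induction_on with
    | zero => simp
    | add a b ha hb => rw [map_add, map_add, map_add, LinearMap.comp_add, LinearMap.add_comp, ha, hb]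
    | tmul a b =>
      induction a using TensorProduct.induction_on with
      | zero => simp
      | add a b ha hb =>
        rw [TensorProduct.add_tmul, map_add, map_add, map_add, LinearMap.comp_add,
          LinearMap.add_comp, ha, hb]
      | tmul a a' => exact TensorProduct.ext_threefold fun v w x => rfl
  have h3 : T.invAct (V ⊗[ℂ] W) X = opSer ρ' (PowerSeries.map (Algebra.TensorProduct.map
      (coproduct L) (AlgHom.id ℂ (UEnv L))).toRingHom (T.F⁻¹).val) := by
    rw [opSer_map, invAct, serAct₂_eq]
    congr 1
    rw [← tensorRep_coproduct]
    exact Algebra.TensorProduct.ext' fun a b => rfl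
  have h4 : serTensor (serApply (T.invAct V W) t) x
      = serApply (opSer ρ' (PowerSeries.map (Algebra.TensorProduct.includeLeft :
        UEnv L ⊗[ℂ] UEnv L →ₐ[ℂ] (UEnv L ⊗[ℂ] UEnv L) ⊗[ℂ] UEnv L).toRingHom (T.F⁻¹).val))
          (serTensor t x) := by
    have h5 : opSer ρ' (PowerSeries.map (Algebra.TensorProduct.includeLeft :
        UEnv L ⊗[ℂ] UEnv L →ₐ[ℂ] (UEnv L ⊗[ℂ] UEnv L) ⊗[ℂ] UEnv L).toRingHom (T.F⁻¹).val)
        = serMap (LinearMap.rTensorHom X) (T.invAct V W) := by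
      rw [opSer_map]
      funext n
      change tensorRep _ _ (_ ⊗ₜ 1) = (tensorRep (uAct L V) (uAct L W) _).rTensor X
      rw [tensorRep_tmul, map_one]
      rfl
    rw [h5]
    exact serMap₂_assoc (b := LinearMap.id) (c := TensorProduct.mk ℂ (V ⊗[ℂ] W) X)
      (b' := TensorProduct.mk ℂ (V ⊗[ℂ] W) X) (c' := LinearMap.rTensorHom X) (fun f t x => rfl)
      (T.invAct V W) t x
  have h6 : ∀ (P : PowerSeries ((UEnv L ⊗[ℂ] UEnv L) ⊗[ℂ] UEnv L)) (s : Ser ((V ⊗[ℂ] W) ⊗[ℂ] X)),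
      serMap (TensorProduct.assoc ℂ V W X).toLinearMap (serApply (opSer ρ' P) s)
        = serApply (opSer ρ (PowerSeries.map α.toAlgHom.toRingHom P))
          (serMap (TensorProduct.assoc ℂ V W X).toLinearMap s) := by
    intro P s
    rw [opSer_map]
    exact serMap_opSer (ρ' := ρ.comp α.toAlgHom) hα P s
  rw [starTensor, h3, h4, h6, h6, h1, h2, ← opSer_mul, ← opSer_mul, ← inv_cocycle]
  rfl

theorem starTensor_assoc (v : Ser V) (w : Ser W) (x : Ser X) :
    serMap (TensorProduct.assoc ℂ V W X).toLinearMap (T.starTensor (T.starTensor v w) x)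
      = T.starTensor v (T.starTensor w x) := by
  have h := T.invAct_assoc (serTensor v w) x
  rw [serMap_assoc_serTensor, serApply_idTensor] at h
  exact h.symm

end DrinfeldTwist

end TwistCalculus
-- Lie-algebra-valued forms: sign rules, Leibniz rules and equivariance.
section GFormIdentities

attribute [local instance 100] LieRing.ofAssociativeRing

variable {C : Type*} [CommRing C] [Algebra ℝ C] {𝔤 : Type*} [LieRing 𝔤] [LieAlgebra ℝ 𝔤]

/-- The elementary real `𝔤`-valued form `α ⊗ x`. -/
def rmk {k : ℕ} (α : DForm C k) (x : 𝔤) : RForm C 𝔤 k := (α ⊗ₜ[ℝ] x : DForm C k ⊗[ℝ] 𝔤)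

theorem rmk_add_form {k : ℕ} (α β : DForm C k) (x : 𝔤) :
    rmk (α + β) x = rmk α x + rmk β x := TensorProduct.add_tmul α β x

theorem rmk_add_lie {k : ℕ} (α : DForm C k) (x y : 𝔤) :
    rmk α (x + y) = rmk α x + rmk α y := TensorProduct.tmul_add α x y

/-- The elementary `𝔤`-valued form `c ⊗ (α ⊗ x)`. -/
def gmk {k : ℕ} (c : ℂ) (α : DForm C k) (x : 𝔤) : GForm C 𝔤 k := c ⊗ₜ[ℝ] rmk α x

theorem gform_induction {k : ℕ} {p : GForm C 𝔤 k → Prop} (h : ∀ c α x, p (gmk c α x))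
    (hadd : ∀ a b, p a → p b → p (a + b)) (a : GForm C 𝔤 k) : p a := by
  have h0 : p 0 := by
    -- Zero is itself an elementary form, so the induction principle needs no separate case for it.
    have : gmk (0 : ℂ) (0 : DForm C k) (0 : 𝔤) = 0 := TensorProduct.zero_tmul _ _
    exact this ▸ h 0 0 0
  induction a using TensorProduct.induction_on with
  | zero => exact h0
  | add a b ha hb => exact hadd a b ha hb
  | tmul c m =>
    have hm : ∀ t : DForm C k ⊗[ℝ] 𝔤, p (c ⊗ₜ[ℝ] (show RForm C 𝔤 k from t)) := by
      intro t
      induction t using TensorProduct.induction_on with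
      | zero => exact (TensorProduct.tmul_zero (R := ℝ) (RForm C 𝔤 k) c).symm ▸ h0
      | tmul α x => exact h c α x
      | add t t' ht ht' =>
        exact (TensorProduct.tmul_add (R := ℝ) c (show RForm C 𝔤 k from t) t').symm ▸ hadd _ _ ht ht'
    exact hm m

theorem gmk_add_form {k : ℕ} (c : ℂ) (α β : DForm C k) (x : 𝔤) :
    gmk c (α + β) x = gmk c α x + gmk c β x := by
  rw [gmk, rmk_add_form, TensorProduct.tmul_add]
  rfl

theorem gmk_add_lie {k : ℕ} (c : ℂ) (α : DForm C k) (x y : 𝔤) :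
    gmk c α (x + y) = gmk c α x + gmk c α y := by
  rw [gmk, rmk_add_lie, TensorProduct.tmul_add]
  rfl

theorem gmk_zero_form {k : ℕ} (c : ℂ) (x : 𝔤) : gmk c (0 : DForm C k) x = 0 := by
  have h := gmk_add_form c (0 : DForm C k) 0 x
  rw [add_zero] at h
  exact left_eq_add.1 h

theorem gmk_neg_form {k : ℕ} (c : ℂ) (α : DForm C k) (x : 𝔤) : gmk c (-α) x = -gmk c α x := by
  rw [eq_neg_iff_add_eq_zero, ← gmk_add_form, neg_add_cancel, gmk_zero_form]

theorem gmk_neg_lie {k : ℕ} (c : ℂ) (α : DForm C k) (x : 𝔤) : gmk c α (-x) = -gmk c α x := by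
  have h0 : gmk c α (0 : 𝔤) = 0 := by
    have h := gmk_add_lie c α (0 : 𝔤) 0
    rw [add_zero] at h
    exact left_eq_add.1 h
  rw [eq_neg_iff_add_eq_zero, ← gmk_add_lie, neg_add_cancel, h0]

theorem bracket_gmk {p q n : ℕ} (c c' : ℂ) (α : DForm C p) (β : DForm C q) (x y : 𝔤) :
    bracket C 𝔤 p q n (gmk c α x ⊗ₜ gmk c' β y) = gmk (c * c') (wedge C p q n α β) ⁅x, y⁆ := by
  rw [bracket, LinearMap.comp_apply, gmk, gmk, LinearEquiv.coe_coe,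
    TensorProduct.AlgebraTensorModule.distribBaseChange_symm_tmul, LinearMap.baseChange_tmul]
  rfl

theorem gD_gmk {k n : ℕ} (c : ℂ) (α : DForm C k) (x : 𝔤) :
    gD C 𝔤 k n (gmk c α x) = gmk c (extDLinear C k n α) x := rfl

/-- The sign (-1)^k comes from the wedge product, the additional minus from skew symmetry in 𝔤. For
k = 1 they cancel, so the bracket of two gauge fields is symmetric. -/
theorem bracket_one_comm {k n : ℕ} (a : GForm C 𝔤 1) (b : GForm C 𝔤 k) :
    bracket C 𝔤 k 1 n (b ⊗ₜ a) = -((-1 : ℂ) ^ k • bracket C 𝔤 1 k n (a ⊗ₜ b)) := by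
  induction a using gform_induction with
  | hadd a a' h h' => simp only [TensorProduct.add_tmul, TensorProduct.tmul_add, map_add, h, h',
      smul_add, neg_add]
  | h c α x =>
    induction b using gform_induction with
    | hadd a a' h h' => simp only [TensorProduct.add_tmul, TensorProduct.tmul_add, map_add, h, h',
        smul_add, neg_add]
    | h c' β y =>
      rw [bracket_gmk, bracket_gmk, wedge_one_comm, ← lie_skew, mul_comm c', gmk_neg_lie]
      rcases neg_one_pow_eq_or ℤ k with h | h
      · have h' : (-1 : ℂ) ^ k = 1 := by exact_mod_cast congrArg (Int.cast : ℤ → ℂ) h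
        rw [h, h', one_smul, one_smul]
      · have h' : (-1 : ℂ) ^ k = -1 := by exact_mod_cast congrArg (Int.cast : ℤ → ℂ) h
        rw [h, h', neg_one_smul, neg_one_smul, gmk_neg_form]

/-- A 0-form factor acts by multiplication and can be pulled out of the wedge product without sign;
what remains is the Jacobi identity in 𝔤. -/
theorem bracket_zero_bracket {p q n : ℕ} (l : GForm C 𝔤 0) (a : GForm C 𝔤 p) (b : GForm C 𝔤 q) :
    bracket C 𝔤 0 n n (l ⊗ₜ bracket C 𝔤 p q n (a ⊗ₜ b))
      = bracket C 𝔤 p q n (bracket C 𝔤 0 p p (l ⊗ₜ a) ⊗ₜ b)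
        + bracket C 𝔤 p q n (a ⊗ₜ bracket C 𝔤 0 q q (l ⊗ₜ b)) := by
  induction l using gform_induction with
  | hadd l l' h h' =>
    simp only [TensorProduct.add_tmul, TensorProduct.tmul_add, map_add, h, h']
    abel
  | h c f z =>
    induction a using gform_induction with
    | hadd l l' h h' =>
      simp only [TensorProduct.add_tmul, TensorProduct.tmul_add, map_add, h, h']
      abel
    | h c' α x =>
      induction b using gform_induction with
      | hadd l l' h h' =>
        simp only [TensorProduct.tmul_add, map_add, h, h']
        abel
      | h c'' β y =>
        simp only [bracket_gmk, wedge_zero, map_smul, LinearMap.smul_apply]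
        rw [← mul_assoc, mul_left_comm c' c, ← mul_assoc, ← gmk_add_lie, leibniz_lie z x y]

theorem gD_bracket_zero {k n : ℕ} (l : GForm C 𝔤 0) (a : GForm C 𝔤 k) :
    gD C 𝔤 k n (bracket C 𝔤 0 k k (l ⊗ₜ a))
      = bracket C 𝔤 1 k n (gD C 𝔤 0 1 l ⊗ₜ a) + bracket C 𝔤 0 n n (l ⊗ₜ gD C 𝔤 k n a) := by
  induction l using gform_induction with
  | hadd l l' h h' =>
    simp only [TensorProduct.add_tmul, map_add, h, h']
    abel
  | h c f z =>
    induction a using gform_induction with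
    | hadd l l' h h' =>
      simp only [TensorProduct.tmul_add, map_add, h, h']
      abel
    | h c' α x =>
      simp only [bracket_gmk, gD_gmk, extDLinear_wedge_zero, gmk_add_form]

theorem gD_gD_zero (l : GForm C 𝔤 0) : gD C 𝔤 1 2 (gD C 𝔤 0 1 l) = 0 := by
  induction l using gform_induction with
  | hadd l l' h h' => rw [map_add, map_add, h, h', add_zero]
  | h c f z =>
    rw [gD_gmk, gD_gmk, extDLinear_apply, extDLinear_apply, extD_extD_zero, gmk_zero_form]

variable (𝔨 : LieSubalgebra ℝ (VField C))

theorem lie_gmk {k : ℕ} (s c : ℂ) (ξ : 𝔨) (α : DForm C k) (x : 𝔤) :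
    ⁅(s ⊗ₜ[ℝ] ξ : ℂ ⊗[ℝ] 𝔨), gmk c α x⁆ = gmk (s * c) (lieDeriv (ξ : VField C) α) x := rfl

theorem equivariant_of_gmk {k n : ℕ} {f : GForm C 𝔤 k →ₗ[ℂ] GForm C 𝔤 n}
    (h : ∀ (s c : ℂ) (ξ : 𝔨) (α : DForm C k) (x : 𝔤),
      f ⁅(s ⊗ₜ[ℝ] ξ : ℂ ⊗[ℝ] 𝔨), gmk c α x⁆ = ⁅(s ⊗ₜ[ℝ] ξ : ℂ ⊗[ℝ] 𝔨), f (gmk c α x)⁆) :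
    Equivariant (ℂ ⊗[ℝ] 𝔨) f := by
  intro ζ a
  induction ζ using TensorProduct.induction_on with
  | zero => simp
  | add ζ ζ' h h' => simp only [add_lie, map_add, h, h']
  | tmul s ξ =>
    induction a using gform_induction with
    | hadd a b h h' => simp only [lie_add, map_add, h, h']
    | h c α x => exact h s c ξ α x

theorem equivariant_gD (k n : ℕ) : Equivariant (ℂ ⊗[ℝ] 𝔨) (gD C 𝔤 k n) :=
  equivariant_of_gmk 𝔨 fun s c ξ α x => by
    rw [lie_gmk, gD_gmk, gD_gmk, lie_gmk, lieDeriv_extDLinear]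

theorem equivariant_bracket (p q n : ℕ) : Equivariant (ℂ ⊗[ℝ] 𝔨) (bracket C 𝔤 p q n) := by
  intro ζ t
  induction ζ using TensorProduct.induction_on with
  | zero => simp
  | add ζ ζ' h h' => simp only [add_lie, map_add, h, h']
  | tmul s ξ =>
    induction t using TensorProduct.induction_on with
    | zero => simp
    | add a b h h' => simp only [lie_add, map_add, h, h']
    | tmul a b =>
      rw [TensorProduct.LieModule.lie_tmul_right, map_add]
      induction a using gform_induction with
      | hadd l l' h h' =>
        simp only [TensorProduct.add_tmul, map_add, lie_add, ← h, ← h']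
        abel
      | h c α x =>
        induction b using gform_induction with
        | hadd l l' h h' =>
          simp only [TensorProduct.tmul_add, map_add, lie_add, ← h, ← h']
          abel
        | h c' β y =>
          simp only [bracket_gmk, lie_gmk, lieDeriv_wedge, gmk_add_form]
          rw [mul_assoc, mul_left_comm c s]

end GFormIdentities

/-! ### The Hodge operator on Lie-algebra-valued forms. -/

section HodgeIdentities

variable {d : ℕ} {M : Type*} [TopologicalSpace M] [ChartedSpace (EuclideanSpace ℝ (Fin d)) M]
  [IsManifold 𝓘(ℝ, EuclideanSpace ℝ (Fin d)) ∞ M] [T2Space M]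
  {S : OrientedLorentzian d M} {𝔤 : Type*} [LieRing 𝔤] [LieAlgebra ℝ 𝔤]

theorem gHodge_gmk {k m : ℕ} (c : ℂ) (α : DForm (Fn d M) k) (x : 𝔤) :
    gHodge S 𝔤 k m (gmk c α x) = gmk c (S.hodge k m α) x := rfl

theorem gHodge_bracket_zero {k m : ℕ} (l : Om d M 𝔤 0) (a : Om d M 𝔤 k) :
    gHodge S 𝔤 k m (bracket (Fn d M) 𝔤 0 k k (l ⊗ₜ a))
      = bracket (Fn d M) 𝔤 0 m m (l ⊗ₜ gHodge S 𝔤 k m a) := by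
  induction l using gform_induction with
  | hadd l l' h h' => simp only [TensorProduct.add_tmul, map_add, h, h']
  | h c f z =>
    induction a using gform_induction with
    | hadd l l' h h' => simp only [TensorProduct.tmul_add, map_add, h, h']
    | h c' α x => rw [bracket_gmk, gHodge_gmk, gHodge_gmk, bracket_gmk, S.hodge_wedge_zero]

theorem gHodge_eq_zero {k m : ℕ} (h : k + m ≠ d) : gHodge S 𝔤 k m = 0 := by
  refine LinearMap.ext fun a => ?_
  induction a using gform_induction with
  | hadd l l' h h' => simp only [map_add, h, h']
  | h c f z =>
    rw [gHodge_gmk, S.hodge_eq_zero h, LinearMap.zero_apply, gmk_zero_form, LinearMap.zero_apply]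

theorem equivariant_gHodge {𝔨 : LieSubalgebra ℝ (VField (Fn d M))}
    (h𝔨 : ∀ ξ ∈ 𝔨, S.IsKilling ξ) (k m : ℕ) : Equivariant (ℂ ⊗[ℝ] 𝔨) (gHodge S 𝔤 k m) :=
  equivariant_of_gmk 𝔨 fun s c ξ α x => by
    rw [lie_gmk, gHodge_gmk, gHodge_gmk, lie_gmk, OrientedLorentzian.lieDeriv_hodge (h𝔨 ξ ξ.2)]

end HodgeIdentities
-- Braided Leibniz rule with the gauge parameter moved to the front.
section TwistedJets

attribute [local instance 100] LieRing.ofAssociativeRing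

variable {L : Type*} [LieRing L] [LieAlgebra ℂ L] (T : DrinfeldTwist L)
variable {V W X Λ : Type*}
  [AddCommGroup V] [Module ℂ V] [LieRingModule L V] [LieModule ℂ L V]
  [AddCommGroup W] [Module ℂ W] [LieRingModule L W] [LieModule ℂ L W]
  [AddCommGroup X] [Module ℂ X] [LieRingModule L X] [LieModule ℂ L X]
  [AddCommGroup Λ] [Module ℂ Λ] [LieRingModule L Λ] [LieModule ℂ L Λ]

namespace DrinfeldTwist

theorem serApply_twisted {Y : Type*} [AddCommGroup Y] [Module ℂ Y] (b : V ⊗[ℂ] W →ₗ[ℂ] Y)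
    (t : Ser (V ⊗[ℂ] W)) :
    serApply (T.twisted b) t = serMap b (serApply (T.invAct V W) t) := by
  rw [twisted, serApply_serComp, serApply_single]

theorem serApply_twisted_braidTensor {Y : Type*} [AddCommGroup Y] [Module ℂ Y]
    (b : V ⊗[ℂ] W →ₗ[ℂ] Y) (v : Ser V) (w : Ser W) :
    serApply (T.twisted b) (T.braidTensor v w)
      = serMap (b ∘ₗ (TensorProduct.comm ℂ W V).toLinearMap) (T.starTensor w v) := by
  rw [serApply_twisted, invAct_braidTensor, serMap_serMap]

/-- For trivial R the braided flip is the ordinary one, so ⊗⋆ is symmetric. -/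
theorem serMap_comm_starTensor (hR : T.rMatrix = 1) (v : Ser V) (w : Ser W) :
    serMap (TensorProduct.comm ℂ V W).toLinearMap (T.starTensor v w) = T.starTensor w v := by
  rw [← invAct_braidTensor, starTensor, braidTensor, braidAct, hR, map_one, serAct₂_eq, opSer_one]

theorem starTensor_zero (v : Ser V) (w : Ser W) : T.starTensor v w 0 = v 0 ⊗ₜ w 0 := by
  have h1 : PowerSeries.coeff 0 (T.F⁻¹).val = 1 := by
    have h := congrArg PowerSeries.constantCoeff T.F.mul_inv
    rw [map_mul, T.normalized, one_mul, map_one] at h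
    rw [PowerSeries.coeff_zero_eq_constantCoeff_apply]
    exact h
  have h2 : T.invAct V W 0 = LinearMap.id := by
    rw [invAct, serAct₂_eq, opSer, h1, map_one]
    rfl
  rw [starTensor, serApply, serMap₂_apply, Finset.HasAntidiagonal.antidiagonal_zero,
    Finset.sum_singleton, h2, serTensor, serMap₂_apply, Finset.HasAntidiagonal.antidiagonal_zero,
    Finset.sum_singleton]
  rfl

/-- This evaluates R_k v ⊗⋆ f⋆(R^k λ, x). Equivariance pulls f outside, the cocycle condition
regroups the three factors, and the braiding becomes a flip that leaves λ ⊗⋆ v ⊗⋆ x. It serves both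
the gauge variation and the term [R_kA, ∗[R^kA, A]⋆]⋆. -/
theorem invAct_idTensor_twisted {f : Λ ⊗[ℂ] X →ₗ[ℂ] W} (hf : Equivariant L f) (v : Ser V)
    (l : Ser Λ) (x : Ser X) :
    serApply (T.invAct V W) (serApply (idTensor V (serComp (T.twisted f) (tensorRight Λ x)))
        (T.braidTensor v l))
      = serMap (f.lTensor V ∘ₗ (TensorProduct.assoc ℂ V Λ X).toLinearMap ∘ₗ
          (TensorProduct.comm ℂ Λ V).toLinearMap.rTensor X)
          (T.starTensor (T.starTensor l v) x) := by
  have h : ∀ t : Ser (V ⊗[ℂ] Λ), serApply (idTensor V (tensorRight Λ x)) t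
      = serMap (TensorProduct.assoc ℂ V Λ X).toLinearMap (serTensor t x) := by
    intro t
    rw [serTensor, serMap_serMap₂, serMap₂_flip]
    change serMap₂ LinearMap.id (serMap (LinearMap.lTensorHom V)
      (serMap (TensorProduct.mk ℂ Λ X).flip x)) t = serMap₂ _ x t
    rw [serMap_serMap]
    change serMap₂ (LinearMap.compl₁₂ LinearMap.id
      (LinearMap.lTensorHom V ∘ₗ (TensorProduct.mk ℂ Λ X).flip) LinearMap.id) x t = _
    congr 1
    ext1 x
    exact TensorProduct.ext' fun v l => rfl
  rw [idTensor_serComp, serApply_serComp, h, twisted, idTensor_serComp, serApply_serComp,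
    idTensor_single, serApply_single]
  have h2 := T.serMap_invAct (.id) hf (serApply (idTensor V (T.invAct Λ X))
    (serMap (TensorProduct.assoc ℂ V Λ X).toLinearMap (serTensor (T.braidTensor v l) x)))
  -- The regrouping must come first: only then is F⁻¹ applied directly to the braided pair v, λ.
  rw [invAct_assoc, invAct_braidTensor] at h2
  refine h2.symm.trans ?_
  rw [← T.serMap_rTensor_starTensor Equivariant.tensorComm]
  rfl

end DrinfeldTwist

namespace Jet

variable {Γ U U' : Type*} [AddCommGroup Γ] [Module ℂ Γ] [AddCommGroup U] [Module ℂ U]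
  [AddCommGroup U'] [Module ℂ U']

theorem delta_add (v w : Jet Γ U) (l : Ser Γ) : (v + w).delta l = v.delta l + w.delta l :=
  serApply_add_left _ _ _

theorem delta_smul (c : ℂ) (v : Jet Γ U) (l : Ser Γ) : (c • v).delta l = c • v.delta l :=
  serApply_smul_left _ _ _

theorem delta_map (f : U →ₗ[ℂ] U') (v : Jet Γ U) (l : Ser Γ) :
    (v.map f).delta l = serMap f (v.delta l) :=
  serApply_llcomp _ _ _

/-- The last factor has the affine variation Dλ + f⋆(λ, w), so the Leibniz rule yields three terms.
In the last two λ now stands leftmost, and the classical map outside remembers its original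
position. -/
theorem delta_starTensor_field {D : Λ →ₗ[ℂ] W} {f : Λ ⊗[ℂ] W →ₗ[ℂ] W} (hD : Equivariant L D)
    (hf : Equivariant L f) (v : Jet Λ V) (w : Ser W) (l : Ser Λ) :
    (v.starTensor T ⟨w, Pi.single 0 D + serComp (T.twisted f) (tensorRight Λ w)⟩).delta l
      = T.starTensor (v.delta l) w
        + serMap (D.lTensor V ∘ₗ (TensorProduct.comm ℂ Λ V).toLinearMap) (T.starTensor l v.val)
        + serMap (f.lTensor V ∘ₗ (TensorProduct.assoc ℂ V Λ W).toLinearMap ∘ₗ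
          (TensorProduct.comm ℂ Λ V).toLinearMap.rTensor W)
          (T.starTensor (T.starTensor l v.val) w) := by
  change serApply (serComp _ (_ + _)) l = _
  rw [serApply_serComp, serApply_add_left, serApply_serComp, serApply_serComp, serApply_serComp,
    serApply_tensorRight, serApply_tensorLeft, idTensor_add, serApply_add_left, idTensor_single,
    serApply_single, serApply_add_right, serApply_add_right]
  change T.starTensor (v.delta l) w + (serApply _ (serMap _ (T.braidTensor v.val l))
    + serApply _ (serApply _ (T.braidTensor v.val l))) = _
  rw [T.invAct_idTensor_twisted hf, add_assoc]
  congr 2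
  have h := T.serMap_invAct (.id) hD (T.braidTensor v.val l)
  rw [T.invAct_braidTensor] at h
  exact h.symm

end Jet

end TwistedJets

/-! ### Classical multilinear identities behind gauge covariance. -/

section GaugeSystem

/-- The algebraic structure behind the Yang-Mills brackets: gauge parameters `Λ`, gauge fields `V`,
field strengths `F` and field equations `E`, with the maps `D = d`, `δ = d`, `K = d ∗`,
`Q (A ⊗ φ) = [A, ∗φ]` and the brackets of gauge fields and with gauge parameters. -/
structure GaugeSystem (Λ V F E : Type*) [AddCommGroup Λ] [Module ℂ Λ] [AddCommGroup V] [Module ℂ V]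
    [AddCommGroup F] [Module ℂ F] [AddCommGroup E] [Module ℂ E] where
  D : Λ →ₗ[ℂ] V
  δ : V →ₗ[ℂ] F
  K : F →ₗ[ℂ] E
  Q : V ⊗[ℂ] F →ₗ[ℂ] E
  br : V ⊗[ℂ] V →ₗ[ℂ] F
  actV : Λ ⊗[ℂ] V →ₗ[ℂ] V
  actF : Λ ⊗[ℂ] F →ₗ[ℂ] F
  actE : Λ ⊗[ℂ] E →ₗ[ℂ] E
  δ_D : ∀ l, δ (D l) = 0
  br_comm : ∀ a b, br (a ⊗ₜ b) = br (b ⊗ₜ a)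
  δ_act : ∀ l a, δ (actV (l ⊗ₜ a)) = br (D l ⊗ₜ a) + actF (l ⊗ₜ δ a)
  K_act : ∀ l φ, K (actF (l ⊗ₜ φ)) = Q (D l ⊗ₜ φ) + actE (l ⊗ₜ K φ)
  act_br : ∀ l a b, actF (l ⊗ₜ br (a ⊗ₜ b)) = br (actV (l ⊗ₜ a) ⊗ₜ b) + br (a ⊗ₜ actV (l ⊗ₜ b))
  act_Q : ∀ l a φ, actE (l ⊗ₜ Q (a ⊗ₜ φ)) = Q (actV (l ⊗ₜ a) ⊗ₜ φ) + Q (a ⊗ₜ actF (l ⊗ₜ φ))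

namespace GaugeSystem

variable {Λ V F E : Type*} [AddCommGroup Λ] [Module ℂ Λ] [AddCommGroup V] [Module ℂ V]
  [AddCommGroup F] [Module ℂ F] [AddCommGroup E] [Module ℂ E] (G : GaugeSystem Λ V F E)

/-- `A ↦ d ∗ dA`. -/
def ell1 : V →ₗ[ℂ] E := G.K ∘ₗ G.δ

/-- `(A₁, A₂) ↦ -d ∗ [A₁, A₂] - [A₁, ∗ dA₂] - [A₂, ∗ dA₁]`. -/
def ell2 : V ⊗[ℂ] V →ₗ[ℂ] E :=
  -(G.K ∘ₗ G.br) - G.Q ∘ₗ G.δ.lTensor V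
    - G.Q ∘ₗ (TensorProduct.comm ℂ F V).toLinearMap ∘ₗ G.δ.rTensor V

/-- `(A₁, A₂, A₃) ↦ [A₁, ∗ [A₂, A₃]]`. -/
def cubL : (V ⊗[ℂ] V) ⊗[ℂ] V →ₗ[ℂ] E :=
  G.Q ∘ₗ G.br.lTensor V ∘ₗ (TensorProduct.assoc ℂ V V V).toLinearMap

/-- `(A₁, A₂, A₃) ↦ [A₂, ∗ [A₁, A₃]]`. -/
def cubM : (V ⊗[ℂ] V) ⊗[ℂ] V →ₗ[ℂ] E :=
  G.cubL ∘ₗ (TensorProduct.comm ℂ V V).toLinearMap.rTensor V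

/-- `(A₁, A₂, A₃) ↦ [A₃, ∗ [A₁, A₂]]`. -/
def cubN : (V ⊗[ℂ] V) ⊗[ℂ] V →ₗ[ℂ] E :=
  G.Q ∘ₗ (TensorProduct.comm ℂ F V).toLinearMap ∘ₗ G.br.rTensor V

/-- `(A₁, A₂, A₃) ↦ -[A₁, ∗ [A₂, A₃]] - [A₂, ∗ [A₁, A₃]] - [A₃, ∗ [A₁, A₂]]`. -/
def ell3 : (V ⊗[ℂ] V) ⊗[ℂ] V →ₗ[ℂ] E := -G.cubL - G.cubM - G.cubN

/-- The classical cubic map underlying the extra terms of the braided Yang-Mills equations. -/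
def extra : (V ⊗[ℂ] V) ⊗[ℂ] V →ₗ[ℂ] E :=
  (1 / 6 : ℂ) • G.cubM - (1 / 12 : ℂ) • G.cubL - (1 / 12 : ℂ) • G.cubN

/-- The linear part of the variation of `A ⊗⋆ A`. -/
def varTwoLin : Λ ⊗[ℂ] V →ₗ[ℂ] V ⊗[ℂ] V :=
  G.D.rTensor V + G.D.lTensor V ∘ₗ (TensorProduct.comm ℂ Λ V).toLinearMap

/-- The quadratic part of the variation of `A ⊗⋆ A`. -/
def varTwoQuad : (Λ ⊗[ℂ] V) ⊗[ℂ] V →ₗ[ℂ] V ⊗[ℂ] V :=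
  (-G.actV).rTensor V + (-G.actV).lTensor V ∘ₗ (TensorProduct.assoc ℂ V Λ V).toLinearMap ∘ₗ
    (TensorProduct.comm ℂ Λ V).toLinearMap.rTensor V

/-- The quadratic part of the variation of `A ⊗⋆ A ⊗⋆ A`. -/
def varThreeQuad : (Λ ⊗[ℂ] V) ⊗[ℂ] V →ₗ[ℂ] (V ⊗[ℂ] V) ⊗[ℂ] V :=
  G.varTwoLin.rTensor V + G.D.lTensor (V ⊗[ℂ] V) ∘ₗ
    (TensorProduct.comm ℂ Λ (V ⊗[ℂ] V)).toLinearMap ∘ₗ (TensorProduct.assoc ℂ Λ V V).toLinearMap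

/-- The cubic part of the variation of `A ⊗⋆ A ⊗⋆ A`. -/
def varThreeCubic : ((Λ ⊗[ℂ] V) ⊗[ℂ] V) ⊗[ℂ] V →ₗ[ℂ] (V ⊗[ℂ] V) ⊗[ℂ] V :=
  G.varTwoQuad.rTensor V + (-G.actV).lTensor (V ⊗[ℂ] V) ∘ₗ
    (TensorProduct.assoc ℂ (V ⊗[ℂ] V) Λ V).toLinearMap ∘ₗ
    ((TensorProduct.comm ℂ Λ (V ⊗[ℂ] V)).toLinearMap ∘ₗ
      (TensorProduct.assoc ℂ Λ V V).toLinearMap).rTensor V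

theorem ell2_tmul (a b : V) :
    G.ell2 (a ⊗ₜ b) = -G.K (G.br (a ⊗ₜ b)) - G.Q (a ⊗ₜ G.δ b) - G.Q (b ⊗ₜ G.δ a) := rfl

theorem ell3_tmul (a b c : V) :
    G.ell3 ((a ⊗ₜ b) ⊗ₜ c) = -G.Q (a ⊗ₜ G.br (b ⊗ₜ c)) - G.Q (b ⊗ₜ G.br (a ⊗ₜ c))
      - G.Q (c ⊗ₜ G.br (a ⊗ₜ b)) := rfl

theorem extra_tmul (a b c : V) :
    G.extra ((a ⊗ₜ b) ⊗ₜ c) = (1 / 6 : ℂ) • G.Q (b ⊗ₜ G.br (a ⊗ₜ c))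
      - (1 / 12 : ℂ) • G.Q (a ⊗ₜ G.br (b ⊗ₜ c)) - (1 / 12 : ℂ) • G.Q (c ⊗ₜ G.br (a ⊗ₜ b)) := rfl

theorem varTwoLin_tmul (l : Λ) (a : V) : G.varTwoLin (l ⊗ₜ a) = G.D l ⊗ₜ a + a ⊗ₜ G.D l := rfl

theorem varTwoQuad_tmul (l : Λ) (a b : V) :
    G.varTwoQuad ((l ⊗ₜ a) ⊗ₜ b) = -(G.actV (l ⊗ₜ a) ⊗ₜ b) - a ⊗ₜ G.actV (l ⊗ₜ b) := by
  have h : G.varTwoQuad ((l ⊗ₜ a) ⊗ₜ b)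
    = (-G.actV (l ⊗ₜ a)) ⊗ₜ b + a ⊗ₜ (-G.actV (l ⊗ₜ b)) := rfl
  rw [h, TensorProduct.neg_tmul, TensorProduct.tmul_neg, ← sub_eq_add_neg]

theorem varThreeQuad_tmul (l : Λ) (a b : V) :
    G.varThreeQuad ((l ⊗ₜ a) ⊗ₜ b)
      = (G.D l ⊗ₜ a) ⊗ₜ b + (a ⊗ₜ G.D l) ⊗ₜ b + (a ⊗ₜ b) ⊗ₜ G.D l := by
  rw [← TensorProduct.add_tmul]
  rfl

theorem varThreeCubic_tmul (l : Λ) (a b c : V) :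
    G.varThreeCubic (((l ⊗ₜ a) ⊗ₜ b) ⊗ₜ c)
      = -((G.actV (l ⊗ₜ a) ⊗ₜ b) ⊗ₜ c) - (a ⊗ₜ G.actV (l ⊗ₜ b)) ⊗ₜ c
        - (a ⊗ₜ b) ⊗ₜ G.actV (l ⊗ₜ c) := by
  have h : G.varThreeCubic (((l ⊗ₜ a) ⊗ₜ b) ⊗ₜ c)
    = G.varTwoQuad ((l ⊗ₜ a) ⊗ₜ b) ⊗ₜ c + (a ⊗ₜ b) ⊗ₜ (-G.actV (l ⊗ₜ c)) := rfl
  rw [h, varTwoQuad_tmul, TensorProduct.sub_tmul, TensorProduct.neg_tmul, TensorProduct.tmul_neg,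
    ← sub_eq_add_neg]

theorem ell1_comp_D : G.ell1 ∘ₗ G.D = 0 := by
  ext l
  simp [ell1, G.δ_D]

/-- The inhomogeneous terms K[Dλ, a] and Q(Dλ, δa) from differentiating [λ, a] are cancelled by ℓ₂
on the symmetrised pair (Dλ, a); its remaining term vanishes by δD = 0. -/
theorem ell1_comp_act :
    G.ell1 ∘ₗ (-G.actV) + (-(1 / 2) : ℂ) • G.ell2 ∘ₗ G.varTwoLin
      = -(G.actE ∘ₗ G.ell1.lTensor Λ) := by
  refine TensorProduct.ext' fun l a => ?_
  change G.K (G.δ (-G.actV (l ⊗ₜ a))) + (-(1 / 2) : ℂ) • G.ell2 (G.varTwoLin (l ⊗ₜ a))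
    = -G.actE (l ⊗ₜ G.K (G.δ a))
  rw [varTwoLin_tmul, map_add, ell2_tmul, ell2_tmul, G.br_comm a, G.δ_D,
    map_neg, G.δ_act, map_neg, map_add, G.K_act]
  simp only [TensorProduct.tmul_zero, map_zero]
  module

theorem ell2_comp_varTwoQuad :
    (-(1 / 2) : ℂ) • G.ell2 ∘ₗ G.varTwoQuad + (-(1 / 6) : ℂ) • G.ell3 ∘ₗ G.varThreeQuad
      = -((-(1 / 2) : ℂ) • G.actE ∘ₗ G.ell2.lTensor Λ ∘ₗ
          (TensorProduct.assoc ℂ Λ V V).toLinearMap) := by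
  refine TensorProduct.ext_threefold fun l a b => ?_
  change (-(1 / 2) : ℂ) • G.ell2 (G.varTwoQuad ((l ⊗ₜ a) ⊗ₜ b))
      + (-(1 / 6) : ℂ) • G.ell3 (G.varThreeQuad ((l ⊗ₜ a) ⊗ₜ b))
    = -((-(1 / 2) : ℂ) • G.actE (l ⊗ₜ G.ell2 (a ⊗ₜ b)))
  -- Expanding K[λ,[a,b]] by the Leibniz rule and by Jacobi expresses the action of λ on K[a,b]
  -- through K of the varied brackets. The leftover Q(Dλ ⊗ [a,b]) is absorbed by ℓ₃.
  have h := G.K_act l (G.br (a ⊗ₜ b))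
  rw [G.act_br, map_add, ← sub_eq_iff_eq_add'] at h
  rw [varTwoQuad_tmul, varThreeQuad_tmul]
  simp only [map_add, map_sub, map_neg, ell2_tmul, ell3_tmul, TensorProduct.tmul_sub,
    TensorProduct.tmul_neg, G.act_Q, G.δ_act, TensorProduct.tmul_add, ← h]
  rw [G.br_comm a (G.D l), G.br_comm b (G.D l)]
  module

/-- Only the derivation property is involved: λ acts on Q and on the bracket by the Leibniz rule,
hence on every composite of them. -/
theorem ell3_comp_varThreeCubic :
    (-(1 / 6) : ℂ) • G.ell3 ∘ₗ G.varThreeCubic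
      = -((-(1 / 6) : ℂ) • G.actE ∘ₗ G.ell3.lTensor Λ ∘ₗ
          (TensorProduct.assoc ℂ Λ (V ⊗[ℂ] V) V).toLinearMap ∘ₗ
          (TensorProduct.assoc ℂ Λ V V).toLinearMap.rTensor V) := by
  refine TensorProduct.ext_fourfold fun l a b c => ?_
  change (-(1 / 6) : ℂ) • G.ell3 (G.varThreeCubic (((l ⊗ₜ a) ⊗ₜ b) ⊗ₜ c))
    = -((-(1 / 6) : ℂ) • G.actE (l ⊗ₜ G.ell3 ((a ⊗ₜ b) ⊗ₜ c)))
  rw [varThreeCubic_tmul]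
  simp only [map_add, map_sub, map_neg, ell3_tmul, TensorProduct.tmul_sub,
    TensorProduct.tmul_neg, G.act_Q, G.act_br, TensorProduct.tmul_add]
  module

/-- Each of Q(Dλ,[a,b]), Q(a,[Dλ,b]) and Q(b,[Dλ,a]) is produced once by each insertion of Dλ, with
total coefficient 1/6 − 1/12 − 1/12 = 0. -/
theorem extra_comp_varThreeQuad : G.extra ∘ₗ G.varThreeQuad = 0 := by
  refine TensorProduct.ext_threefold fun l a b => ?_
  change G.extra (G.varThreeQuad ((l ⊗ₜ a) ⊗ₜ b)) = 0
  rw [varThreeQuad_tmul]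
  simp only [map_add, extra_tmul]
  rw [G.br_comm a (G.D l), G.br_comm b (G.D l)]
  module

theorem extra_comp_varThreeCubic :
    G.extra ∘ₗ G.varThreeCubic
      = -(G.actE ∘ₗ G.extra.lTensor Λ ∘ₗ
          (TensorProduct.assoc ℂ Λ (V ⊗[ℂ] V) V).toLinearMap ∘ₗ
          (TensorProduct.assoc ℂ Λ V V).toLinearMap.rTensor V) := by
  refine TensorProduct.ext_fourfold fun l a b c => ?_
  change G.extra (G.varThreeCubic (((l ⊗ₜ a) ⊗ₜ b) ⊗ₜ c))
    = -G.actE (l ⊗ₜ G.extra ((a ⊗ₜ b) ⊗ₜ c))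
  rw [varThreeCubic_tmul]
  simp only [map_add, map_sub, map_neg, extra_tmul, TensorProduct.tmul_sub,
    TensorProduct.tmul_smul, map_smul, G.act_Q, G.act_br, TensorProduct.tmul_add]
  module

end GaugeSystem

end GaugeSystem
-- Linearity of `serMap` in the map.
section SeriesLinearity

variable {V W : Type*} [AddCommGroup V] [Module ℂ V] [AddCommGroup W] [Module ℂ W]

theorem serMap_zero_left (v : Ser V) : serMap (0 : V →ₗ[ℂ] W) v = 0 := rfl

theorem serMap_add_left (f g : V →ₗ[ℂ] W) (v : Ser V) :
    serMap (f + g) v = serMap f v + serMap g v := rfl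

theorem serMap_neg_left (f : V →ₗ[ℂ] W) (v : Ser V) : serMap (-f) v = -serMap f v := rfl

theorem serMap_smul_left (c : ℂ) (f : V →ₗ[ℂ] W) (v : Ser V) :
    serMap (c • f) v = c • serMap f v := rfl

end SeriesLinearity

/-! ### Transfer of the classical identities to the braided setting. -/

section BraidedGaugeSystem

attribute [local instance 100] LieRing.ofAssociativeRing

namespace GaugeSystem

section

variable {Λ V F E : Type*} [AddCommGroup Λ] [Module ℂ Λ] [AddCommGroup V] [Module ℂ V]
  [AddCommGroup F] [Module ℂ F] [AddCommGroup E] [Module ℂ E] (G : GaugeSystem Λ V F E)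

/-- Here c stands for (-1)^d: the sign written in the bracket cancels the sign from moving the
1-form to the front, so the dimension disappears from the algebra. -/
theorem ell3_eq {c : ℂ} (hc : c * c = 1) {R : (V ⊗[ℂ] V) ⊗[ℂ] V →ₗ[ℂ] E}
    (hR : R = -(c • G.cubN)) : -G.cubL - G.cubM + c • R = G.ell3 := by
  rw [hR, smul_neg, smul_smul, hc, one_smul, ell3, sub_eq_add_neg _ G.cubN]

theorem extra_eq {c : ℂ} (hc : c * c = 1) {R : (V ⊗[ℂ] V) ⊗[ℂ] V →ₗ[ℂ] E}
    (hR : R = -(c • G.cubN)) :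
    (1 / 6 : ℂ) • G.cubM + (-(1 / 12) : ℂ) • G.cubL + (c / 12) • R = G.extra := by
  have h : (c / 12) • R = -((1 / 12 : ℂ) • G.cubN) := by
    rw [hR, smul_neg, smul_smul, div_mul_eq_mul_div, hc]
  rw [h, extra]
  module

theorem ell2_eq {c : ℂ} (hc : c * c = 1) {K' : V ⊗[ℂ] V →ₗ[ℂ] E} (hK : K' = G.K ∘ₗ G.br)
    {Q' : V ⊗[ℂ] V →ₗ[ℂ] E} (hQ : Q' = G.Q ∘ₗ G.δ.lTensor V) {R : V ⊗[ℂ] V →ₗ[ℂ] E}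
    (hR : R = -(c • (G.Q ∘ₗ (TensorProduct.comm ℂ F V).toLinearMap ∘ₗ G.δ.rTensor V))) :
    -K' - Q' + c • R = G.ell2 := by
  rw [hR, smul_neg, smul_smul, hc, one_smul, ell2, hK, hQ, ← sub_eq_add_neg]

end

variable {L : Type*} [LieRing L] [LieAlgebra ℂ L] (T : DrinfeldTwist L)
variable {Λ V F E : Type*}
  [AddCommGroup Λ] [Module ℂ Λ] [LieRingModule L Λ] [LieModule ℂ L Λ]
  [AddCommGroup V] [Module ℂ V] [LieRingModule L V] [LieModule ℂ L V]
  [AddCommGroup F] [Module ℂ F] [LieRingModule L F] [LieModule ℂ L F]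
  [AddCommGroup E] [Module ℂ E] [LieRingModule L E] [LieModule ℂ L E]
  (G : GaugeSystem Λ V F E)

/-- Equivariance of the maps of a gauge system. -/
structure IsEquivariant (L : Type*) [LieRing L] [LieAlgebra ℂ L] {Λ V F E : Type*}
    [AddCommGroup Λ] [Module ℂ Λ] [LieRingModule L Λ] [LieModule ℂ L Λ]
    [AddCommGroup V] [Module ℂ V] [LieRingModule L V] [LieModule ℂ L V]
    [AddCommGroup F] [Module ℂ F] [LieRingModule L F] [LieModule ℂ L F]
    [AddCommGroup E] [Module ℂ E] [LieRingModule L E] [LieModule ℂ L E]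
    (G : GaugeSystem Λ V F E) : Prop where
  D : Equivariant L G.D
  δ : Equivariant L G.δ
  K : Equivariant L G.K
  Q : Equivariant L G.Q
  br : Equivariant L G.br
  actV : Equivariant L G.actV

variable {G}

namespace IsEquivariant

variable (hG : G.IsEquivariant L)
include hG

theorem ell1 : Equivariant L G.ell1 := hG.K.comp hG.δ

theorem ell2 : Equivariant L G.ell2 :=
  ((hG.K.comp hG.br).neg.sub (hG.Q.comp hG.δ.lTensor)).sub
    (hG.Q.comp (Equivariant.tensorComm.comp hG.δ.rTensor))

theorem cubL : Equivariant L G.cubL := hG.Q.comp (hG.br.lTensor.comp .tensorAssoc)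

theorem cubM : Equivariant L G.cubM := hG.cubL.comp Equivariant.tensorComm.rTensor

theorem cubN : Equivariant L G.cubN :=
  hG.Q.comp (Equivariant.tensorComm.comp hG.br.rTensor)

theorem ell3 : Equivariant L G.ell3 := (hG.cubL.neg.sub hG.cubM).sub hG.cubN

theorem extra : Equivariant L G.extra :=
  ((hG.cubM.smul _).sub (hG.cubL.smul _)).sub (hG.cubN.smul _)

theorem varTwoLin : Equivariant L G.varTwoLin :=
  hG.D.rTensor.add (hG.D.lTensor.comp .tensorComm)

theorem varTwoQuad : Equivariant L G.varTwoQuad :=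
  hG.actV.neg.rTensor.add (hG.actV.neg.lTensor.comp
    (Equivariant.tensorAssoc.comp Equivariant.tensorComm.rTensor))

end IsEquivariant

variable (G) in
/-- The gauge field `A` with its braided gauge variation `δ_λ A = Dλ - [λ, A]⋆`. -/
def jet (A : Ser V) : Jet Λ V :=
  ⟨A, Pi.single 0 G.D + serComp (T.twisted (-G.actV)) (tensorRight Λ A)⟩

variable (A : Ser V) (l : Ser Λ)

omit [LieRingModule L F] [LieModule ℂ L F] [LieRingModule L E] [LieModule ℂ L E] in
theorem delta_jet :
    (G.jet T A).delta l = serMap G.D l + serMap (-G.actV) (T.starTensor l A) := by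
  change serApply (_ + _) l = _
  rw [serApply_add_left, serApply_single, serApply_serComp, serApply_tensorRight,
    T.serApply_twisted]
  rfl

theorem delta_jet_two (hG : G.IsEquivariant L) :
    ((G.jet T A).starTensor T (G.jet T A)).delta l
      = serMap G.varTwoLin (T.starTensor l A)
        + serMap G.varTwoQuad (T.starTensor (T.starTensor l A) A) := by
  have h := Jet.delta_starTensor_field T hG.D hG.actV.neg (G.jet T A) A l
  refine h.trans ?_
  rw [delta_jet, T.starTensor_add_left, ← T.serMap_rTensor_starTensor hG.D,
    ← T.serMap_rTensor_starTensor hG.actV.neg]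
  rw [varTwoLin, varTwoQuad, serMap_add_left, serMap_add_left, add_add_add_comm, ← add_assoc]
  rfl

theorem delta_jet_three (hG : G.IsEquivariant L) :
    (((G.jet T A).starTensor T (G.jet T A)).starTensor T (G.jet T A)).delta l
      = serMap G.varThreeQuad (T.starTensor (T.starTensor l A) A)
        + serMap G.varThreeCubic (T.starTensor (T.starTensor (T.starTensor l A) A) A) := by
  have h := Jet.delta_starTensor_field T hG.D hG.actV.neg
    ((G.jet T A).starTensor T (G.jet T A)) A l
  refine h.trans ?_
  change _ + serMap _ (T.starTensor l (T.starTensor A A))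
    + serMap _ (T.starTensor (T.starTensor l (T.starTensor A A)) A) = _
  -- Associativity rewrites λ ⊗⋆ (A ⊗⋆ A) as (λ ⊗⋆ A) ⊗⋆ A, so that all terms of equal degree in A
  -- are evaluated on the same left-bracketed tensor.
  rw [delta_jet_two T A l hG, T.starTensor_add_left, ← T.serMap_rTensor_starTensor hG.varTwoLin,
    ← T.serMap_rTensor_starTensor hG.varTwoQuad, ← T.starTensor_assoc,
    ← T.serMap_rTensor_starTensor Equivariant.tensorAssoc, serMap_serMap, serMap_serMap]
  have h1 : G.varThreeQuad = G.varTwoLin.rTensor V + (G.D.lTensor (V ⊗[ℂ] V) ∘ₗ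
    (TensorProduct.comm ℂ Λ (V ⊗[ℂ] V)).toLinearMap) ∘ₗ
      (TensorProduct.assoc ℂ Λ V V).toLinearMap := rfl
  have h2 : G.varThreeCubic = G.varTwoQuad.rTensor V + ((-G.actV).lTensor (V ⊗[ℂ] V) ∘ₗ
      (TensorProduct.assoc ℂ (V ⊗[ℂ] V) Λ V).toLinearMap ∘ₗ
      (TensorProduct.comm ℂ Λ (V ⊗[ℂ] V)).toLinearMap.rTensor V) ∘ₗ
      (TensorProduct.assoc ℂ Λ V V).toLinearMap.rTensor V := by
    rw [varThreeCubic, LinearMap.rTensor_comp]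
    rfl
  rw [h1, h2]
  rw [serMap_add_left, serMap_add_left, add_add_add_comm, ← add_assoc]

omit [LieRingModule L F] [LieModule ℂ L F] in
theorem starTensor_serMap_cube {f : (V ⊗[ℂ] V) ⊗[ℂ] V →ₗ[ℂ] E}
    (hf : Equivariant L f) :
    serMap G.actE (T.starTensor l (serMap f (T.starTensor (T.starTensor A A) A)))
      = serMap (G.actE ∘ₗ f.lTensor Λ ∘ₗ (TensorProduct.assoc ℂ Λ (V ⊗[ℂ] V) V).toLinearMap ∘ₗ
          (TensorProduct.assoc ℂ Λ V V).toLinearMap.rTensor V)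
        (T.starTensor (T.starTensor (T.starTensor l A) A) A) := by
  rw [← T.serMap_lTensor_starTensor hf, ← T.starTensor_assoc, ← T.starTensor_assoc,
    ← T.serMap_rTensor_starTensor Equivariant.tensorAssoc]
  rfl

theorem delta_extra (hG : G.IsEquivariant L) :
    serMap G.extra
        ((((G.jet T A).starTensor T (G.jet T A)).starTensor T (G.jet T A)).delta l)
      = -serMap G.actE (T.starTensor l (serMap G.extra
          (T.starTensor (T.starTensor A A) A))) := by
  rw [delta_jet_three T A l hG, map_add, serMap_serMap, serMap_serMap, extra_comp_varThreeQuad,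
    extra_comp_varThreeCubic, starTensor_serMap_cube T A l hG.extra, serMap_zero_left,
    serMap_neg_left, zero_add]

/-- Both sides are classical maps on λ, λ⊗⋆A, λ⊗⋆A⊗⋆A and λ⊗⋆A⊗⋆A⊗⋆A. Comparison by degree in A
leaves exactly the four classical identities. -/
theorem delta_maurerCartan (hG : G.IsEquivariant L) :
    serMap G.ell1 ((G.jet T A).delta l)
        + (-(1 / 2) : ℂ) • serMap G.ell2 (((G.jet T A).starTensor T (G.jet T A)).delta l)
        + (-(1 / 6) : ℂ) • serMap G.ell3
          ((((G.jet T A).starTensor T (G.jet T A)).starTensor T (G.jet T A)).delta l)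
      = -serMap G.actE (T.starTensor l (serMap G.ell1 A
          + (-(1 / 2) : ℂ) • serMap G.ell2 (T.starTensor A A)
          + (-(1 / 6) : ℂ) • serMap G.ell3 (T.starTensor (T.starTensor A A) A))) := by
  have h0 := congrArg (fun f => serMap f l) G.ell1_comp_D
  have h1 := congrArg (fun f => serMap f (T.starTensor l A)) G.ell1_comp_act
  have h2 := congrArg (fun f => serMap f (T.starTensor (T.starTensor l A) A))
    G.ell2_comp_varTwoQuad
  have h3 := congrArg (fun f => serMap f (T.starTensor (T.starTensor (T.starTensor l A) A) A))
    G.ell3_comp_varThreeCubic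
  simp only [serMap_add_left, serMap_neg_left, serMap_smul_left, serMap_zero_left] at h0 h1 h2 h3
  have e1 : serMap G.actE (T.starTensor l (serMap G.ell1 A))
      = serMap (G.actE ∘ₗ G.ell1.lTensor Λ) (T.starTensor l A) := by
    rw [← T.serMap_lTensor_starTensor hG.ell1]
    rfl
  have e2 : serMap G.actE (T.starTensor l (serMap G.ell2 (T.starTensor A A)))
      = serMap (G.actE ∘ₗ G.ell2.lTensor Λ ∘ₗ (TensorProduct.assoc ℂ Λ V V).toLinearMap)
        (T.starTensor (T.starTensor l A) A) := by
    rw [← T.serMap_lTensor_starTensor hG.ell2, ← T.starTensor_assoc]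
    rfl
  rw [delta_jet, delta_jet_two T A l hG, delta_jet_three T A l hG]
  simp only [map_add, T.starTensor_add_right, T.starTensor_smul_right, map_smul, serMap_serMap]
  rw [starTensor_serMap_cube T A l hG.ell3, e1, e2, neg_add, neg_add, ← h1, ← h2, ← h3, h0]
  module

/-- The linear and quadratic terms agree outright. Among the cubic ones, ℓ₃ supplies L/6 + M/6 + N/6
and the covariant derivatives L/4 + N/4, which leaves the extra term. -/
theorem braided_yangMills (hG : G.IsEquivariant L) {φ : Ser F}
    (hφ : φ = serMap G.δ A + (1 / 2 : ℂ) • serMap G.br (T.starTensor A A)) :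
    serMap G.ell1 A + (-(1 / 2) : ℂ) • serMap G.ell2 (T.starTensor A A)
        + (-(1 / 6) : ℂ) • serMap G.ell3 (T.starTensor (T.starTensor A A) A)
      = (1 / 2 : ℂ) • ((serMap G.K φ + serMap G.Q (T.starTensor A φ))
          + (serMap G.K φ
            + serMap (G.Q ∘ₗ (TensorProduct.comm ℂ F V).toLinearMap) (T.starTensor φ A)))
        + serMap G.extra (T.starTensor (T.starTensor A A) A) := by
  have h2 : serMap G.ell2 (T.starTensor A A) = -serMap G.K (serMap G.br (T.starTensor A A))
      - serMap G.Q (T.starTensor A (serMap G.δ A))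
      - serMap (G.Q ∘ₗ (TensorProduct.comm ℂ F V).toLinearMap)
        (T.starTensor (serMap G.δ A) A) := by
    rw [← T.serMap_lTensor_starTensor hG.δ, ← T.serMap_rTensor_starTensor hG.δ]
    rfl
  have hL : serMap G.cubL (T.starTensor (T.starTensor A A) A)
      = serMap G.Q (T.starTensor A (serMap G.br (T.starTensor A A))) := by
    rw [← T.serMap_lTensor_starTensor hG.br, ← T.starTensor_assoc]
    rfl
  have hN : serMap G.cubN (T.starTensor (T.starTensor A A) A)
      = serMap (G.Q ∘ₗ (TensorProduct.comm ℂ F V).toLinearMap)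
        (T.starTensor (serMap G.br (T.starTensor A A)) A) := by
    rw [← T.serMap_rTensor_starTensor hG.br]
    rfl
  have h3 : ∀ t, serMap G.ell3 t = -serMap G.cubL t - serMap G.cubM t - serMap G.cubN t :=
    fun _ => rfl
  have h4 : ∀ t, serMap G.extra t = (1 / 6 : ℂ) • serMap G.cubM t
    - (1 / 12 : ℂ) • serMap G.cubL t - (1 / 12 : ℂ) • serMap G.cubN t := fun _ => rfl
  have h1 : serMap G.ell1 A = serMap G.K (serMap G.δ A) := rfl
  rw [hφ, h3, h4, h2, hL, hN, h1]
  simp only [map_add, T.starTensor_add_right, T.starTensor_smul_right, T.starTensor_add_left,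
    T.starTensor_smul_left, map_smul]
  module

omit [LieRingModule L Λ] [LieModule ℂ L Λ] [LieRingModule L F] [LieModule ℂ L F]
  [LieRingModule L E] [LieModule ℂ L E] in
theorem extra_starTensor_zero :
    serMap G.extra (T.starTensor (T.starTensor A A) A) 0 = 0 := by
  rw [serMap_apply, T.starTensor_zero, T.starTensor_zero, extra_tmul]
  module

omit [LieRingModule L Λ] [LieModule ℂ L Λ] [LieRingModule L F] [LieModule ℂ L F]
  [LieRingModule L E] [LieModule ℂ L E] in
-- A symmetric ⊗⋆ makes A ⊗⋆ A ⊗⋆ A invariant under exchanging the first two factors and under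
-- moving the last one to the front, so the three cubic terms coincide and their coefficients
-- cancel.
theorem extra_starTensor_of_rMatrix_eq_one (hR : T.rMatrix = 1) :
    serMap G.extra (T.starTensor (T.starTensor A A) A) = 0 := by
  have hM : serMap G.cubM (T.starTensor (T.starTensor A A) A)
      = serMap G.cubL (T.starTensor (T.starTensor A A) A) := by
    rw [cubM, ← serMap_serMap, T.serMap_rTensor_starTensor Equivariant.tensorComm,
      T.serMap_comm_starTensor hR]
  have hN : serMap G.cubN (T.starTensor (T.starTensor A A) A)
      = serMap G.cubL (T.starTensor (T.starTensor A A) A) := by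
    have h : G.cubN = (G.Q ∘ₗ G.br.lTensor V) ∘ₗ
        (TensorProduct.comm ℂ (V ⊗[ℂ] V) V).toLinearMap :=
      TensorProduct.ext_threefold fun a b c => rfl
    have h' : G.cubL = (G.Q ∘ₗ G.br.lTensor V) ∘ₗ
        (TensorProduct.assoc ℂ V V V).toLinearMap := rfl
    rw [h, h', ← serMap_serMap (TensorProduct.comm ℂ (V ⊗[ℂ] V) V).toLinearMap,
      ← serMap_serMap (TensorProduct.assoc ℂ V V V).toLinearMap, T.serMap_comm_starTensor hR, T.starTensor_assoc]
  have h4 : ∀ t, serMap G.extra t = (1 / 6 : ℂ) • serMap G.cubM t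
    - (1 / 12 : ℂ) • serMap G.cubL t - (1 / 12 : ℂ) • serMap G.cubN t := fun _ => rfl
  rw [h4, hM, hN]
  module

end GaugeSystem

end BraidedGaugeSystem
-- Passage from brackets written with ∗ to the maps of a gauge system.
section FactoredGaugeSystem

attribute [local instance 100] LieRing.ofAssociativeRing

namespace GaugeSystem

/-! Gauge systems whose maps `K = D ∘ H` and `Q = B ∘ (1 ⊗ H)` factor through a Hodge operator. -/

section

variable {Λ V F E : Type*} [AddCommGroup Λ] [Module ℂ Λ] [AddCommGroup V] [Module ℂ V]
  [AddCommGroup F] [Module ℂ F] [AddCommGroup E] [Module ℂ E] (G : GaugeSystem Λ V F E)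
  {H : Type*} [AddCommGroup H] [Module ℂ H] {h : F →ₗ[ℂ] H} {D : H →ₗ[ℂ] E}
  {B : V ⊗[ℂ] H →ₗ[ℂ] E} {B' : H ⊗[ℂ] V →ₗ[ℂ] E} {δ : V →ₗ[ℂ] F} {br : V ⊗[ℂ] V →ₗ[ℂ] F}
  {c : ℂ}

theorem ell2_eq_of_factor (hδ : G.δ = δ) (hbr : G.br = br) (hK : G.K = D ∘ₗ h)
    (hQ : G.Q = B ∘ₗ h.lTensor V) (hc : c * c = 1)
    (hB : ∀ φ a, B' (h φ ⊗ₜ a) = -(c • B (a ⊗ₜ h φ))) :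
    -(D ∘ₗ h ∘ₗ br) - B ∘ₗ (h ∘ₗ δ).lTensor V + c • B' ∘ₗ (h ∘ₗ δ).rTensor V = G.ell2 := by
  subst hδ hbr
  refine G.ell2_eq hc ?_ ?_ ?_
  · rw [hK]
    rfl
  · rw [hQ, LinearMap.lTensor_comp]
    rfl
  · rw [hQ]
    exact TensorProduct.ext' fun _ _ => hB _ _

theorem cubL_eq_of_factor (hbr : G.br = br) (hQ : G.Q = B ∘ₗ h.lTensor V) :
    B ∘ₗ (h ∘ₗ br).lTensor V ∘ₗ (TensorProduct.assoc ℂ V V V).toLinearMap = G.cubL := by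
  subst hbr
  rw [cubL, hQ, LinearMap.lTensor_comp]
  rfl

theorem cubN_eq_of_factor (hbr : G.br = br) (hQ : G.Q = B ∘ₗ h.lTensor V)
    (hB : ∀ φ a, B' (h φ ⊗ₜ a) = -(c • B (a ⊗ₜ h φ))) :
    B' ∘ₗ (h ∘ₗ br).rTensor V = -(c • G.cubN) := by
  subst hbr
  rw [cubN, hQ]
  exact TensorProduct.ext_threefold fun _ _ _ => hB _ _

end

variable {L : Type*} [LieRing L] [LieAlgebra ℂ L] (T : DrinfeldTwist L)
variable {Λ V F E H : Type*}
  [AddCommGroup Λ] [Module ℂ Λ]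
  [AddCommGroup V] [Module ℂ V] [LieRingModule L V] [LieModule ℂ L V]
  [AddCommGroup F] [Module ℂ F] [LieRingModule L F]
  [AddCommGroup H] [Module ℂ H] [LieRingModule L H] [LieModule ℂ L H]
  [AddCommGroup E] [Module ℂ E]
  {h : F →ₗ[ℂ] H} {B : V ⊗[ℂ] H →ₗ[ℂ] E} {B' : H ⊗[ℂ] V →ₗ[ℂ] E} {br : V ⊗[ℂ] V →ₗ[ℂ] F}
  (A : Ser V)

theorem serMap_starTensor_factor [LieModule ℂ L F] (hh : Equivariant L h) (φ : Ser F) :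
    serMap B (T.starTensor A (serMap h φ)) = serMap (B ∘ₗ h.lTensor V) (T.starTensor A φ) := by
  rw [← T.serMap_lTensor_starTensor hh, serMap_serMap]

theorem serMap_starTensor_factor_cubL (hh : Equivariant L h) (hbr : Equivariant L br) :
    serMap B (T.starTensor A (serMap h (serMap br (T.starTensor A A))))
      = serMap (B ∘ₗ (h ∘ₗ br).lTensor V ∘ₗ (TensorProduct.assoc ℂ V V V).toLinearMap)
        (T.starTensor (T.starTensor A A) A) := by
  rw [serMap_serMap, ← T.serMap_lTensor_starTensor (hh.comp hbr), ← T.starTensor_assoc]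
  rfl

theorem serMap_starTensor_factor_cubR (hh : Equivariant L h) (hbr : Equivariant L br) :
    serMap B' (T.starTensor (serMap h (serMap br (T.starTensor A A))) A)
      = serMap (B' ∘ₗ (h ∘ₗ br).rTensor V) (T.starTensor (T.starTensor A A) A) := by
  rw [serMap_serMap, ← T.serMap_rTensor_starTensor (hh.comp hbr), serMap_serMap]

theorem serApply_twisted_braidTensor_factor [LieModule ℂ L F] (hh : Equivariant L h) (φ : Ser F) :
    serApply (T.twisted B) (T.braidTensor A (serMap h φ))
      = serMap ((B ∘ₗ h.lTensor V) ∘ₗ (TensorProduct.comm ℂ F V).toLinearMap)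
        (T.starTensor φ A) := by
  rw [T.serApply_twisted_braidTensor, ← T.serMap_rTensor_starTensor hh, serMap_serMap]
  refine congrArg (fun f => serMap f (T.starTensor φ A)) ?_
  exact TensorProduct.ext' fun _ _ => rfl

/-- This is `invAct_idTensor_twisted` with a second copy of A in the role of λ: the braiding amounts
to exchanging the first two factors of A ⊗⋆ A ⊗⋆ A. -/
theorem serApply_twisted_idTensor_factor (hh : Equivariant L h) (hbr : Equivariant L br) :
    serApply (T.twisted B)
        (serApply (idTensor V (serComp (T.twisted (h ∘ₗ br)) (tensorRight V A)))
          (T.braidTensor A A))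
      = serMap ((B ∘ₗ (h ∘ₗ br).lTensor V ∘ₗ (TensorProduct.assoc ℂ V V V).toLinearMap) ∘ₗ
          (TensorProduct.comm ℂ V V).toLinearMap.rTensor V)
        (T.starTensor (T.starTensor A A) A) := by
  rw [T.serApply_twisted, T.invAct_idTensor_twisted (hh.comp hbr)]
  rfl

theorem serMap_add_sub_add {W : Type*} [AddCommGroup W] [Module ℂ W] (f g k : W →ₗ[ℂ] E)
    (a b c : ℂ) (t : Ser W) :
    a • serMap f t - b • serMap g t + c • serMap k t
      = serMap (a • f + (-b) • g + c • k) t := by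
  rw [serMap_add_left, serMap_add_left, serMap_smul_left, serMap_smul_left, serMap_smul_left,
    neg_smul, sub_eq_add_neg]

end GaugeSystem

end FactoredGaugeSystem

/-! ### Yang–Mills theory as a gauge system. -/

section YangMillsSystem

variable {d : ℕ} {M : Type*} [TopologicalSpace M] [ChartedSpace (EuclideanSpace ℝ (Fin d)) M]
  [IsManifold 𝓘(ℝ, EuclideanSpace ℝ (Fin d)) ∞ M] [T2Space M]
  (S : OrientedLorentzian d M) (𝔤 : Type*) [LieRing 𝔤] [LieAlgebra ℝ 𝔤]

/-- The gauge system of Yang-Mills theory. -/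
def ymSystem : GaugeSystem (Om d M 𝔤 0) (Om d M 𝔤 1) (Om d M 𝔤 2) (Om d M 𝔤 (d - 1)) where
  D := gD (Fn d M) 𝔤 0 1
  δ := gD (Fn d M) 𝔤 1 2
  K := gD (Fn d M) 𝔤 (d - 2) (d - 1) ∘ₗ gHodge S 𝔤 2 (d - 2)
  Q := bracket (Fn d M) 𝔤 1 (d - 2) (d - 1) ∘ₗ (gHodge S 𝔤 2 (d - 2)).lTensor (Om d M 𝔤 1)
  br := bracket (Fn d M) 𝔤 1 1 2
  actV := bracket (Fn d M) 𝔤 0 1 1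
  actF := bracket (Fn d M) 𝔤 0 2 2
  actE := bracket (Fn d M) 𝔤 0 (d - 1) (d - 1)
  δ_D := gD_gD_zero
  br_comm a b := by
    rw [bracket_one_comm, pow_one, neg_one_smul, neg_neg]
  δ_act := gD_bracket_zero
  K_act l φ := by
    rw [LinearMap.comp_apply, gHodge_bracket_zero, gD_bracket_zero]
    rfl
  act_br := bracket_zero_bracket
  -- A gauge parameter multiplies forms by functions, over which ∗ is linear; hence its action
  -- commutes with ∗.
  act_Q l a φ := by
    simp only [LinearMap.comp_apply, LinearMap.lTensor_tmul]
    rw [bracket_zero_bracket, gHodge_bracket_zero]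

theorem neg_one_pow_mul_self (d : ℕ) : (-1 : ℂ) ^ d * (-1) ^ d = 1 := by
  rw [← mul_pow, neg_mul_neg, one_mul, one_pow]

variable {𝔤}

/-- For d ≥ 2 the graded sign (-1)^(d-2) equals (-1)^d. -/
theorem bracket_gHodge_comm (φ : Om d M 𝔤 2) (a : Om d M 𝔤 1) :
    bracket (Fn d M) 𝔤 (d - 2) 1 (d - 1) (gHodge S 𝔤 2 (d - 2) φ ⊗ₜ a)
      = -((-1 : ℂ) ^ d • bracket (Fn d M) 𝔤 1 (d - 2) (d - 1)
        (a ⊗ₜ gHodge S 𝔤 2 (d - 2) φ)) := by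
  by_cases h : 2 ≤ d
  · have hs : (-1 : ℂ) ^ d = (-1) ^ (d - 2) := by
      conv_lhs => rw [← Nat.sub_add_cancel h, pow_add]
      norm_num
    rw [bracket_one_comm, hs]
  -- For d < 2 the subtraction d - 2 truncates to 0, so 2 + (d - 2) ≠ d. The Hodge operator on
  -- 2-forms is then zero by convention and both sides vanish.
  · rw [gHodge_eq_zero (by omega), LinearMap.zero_apply, TensorProduct.zero_tmul,
      TensorProduct.tmul_zero, map_zero, map_zero, smul_zero, neg_zero]

variable (𝔤)

theorem cubicL_eq : cubicL S 𝔤 = (ymSystem S 𝔤).cubL :=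
  (ymSystem S 𝔤).cubL_eq_of_factor rfl rfl

theorem cubicM_eq : cubicM S 𝔤 = (ymSystem S 𝔤).cubM := by
  rw [cubicM, cubicL_eq]
  rfl

theorem cubicR_eq :
    cubicR S 𝔤 = -((-1 : ℂ) ^ d • (ymSystem S 𝔤).cubN) :=
  (ymSystem S 𝔤).cubN_eq_of_factor rfl rfl (bracket_gHodge_comm S)

theorem ell2Field_eq : ell2Field S 𝔤 = (ymSystem S 𝔤).ell2 :=
  (ymSystem S 𝔤).ell2_eq_of_factor rfl rfl rfl rfl (neg_one_pow_mul_self d)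
    (bracket_gHodge_comm S)

theorem ell3Field_eq : ell3Field S 𝔤 = (ymSystem S 𝔤).ell3 := by
  rw [ell3Field, cubicL_eq, cubicM_eq]
  exact (ymSystem S 𝔤).ell3_eq (neg_one_pow_mul_self d) (cubicR_eq S 𝔤)

theorem extra_eq_cubic :
    (1 / 6 : ℂ) • cubicM S 𝔤 + (-(1 / 12) : ℂ) • cubicL S 𝔤 + ((-1) ^ d / 12 : ℂ) • cubicR S 𝔤
      = (ymSystem S 𝔤).extra := by
  rw [cubicL_eq, cubicM_eq]
  exact (ymSystem S 𝔤).extra_eq (neg_one_pow_mul_self d) (cubicR_eq S 𝔤)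

variable {S 𝔤} {𝔨 : LieSubalgebra ℝ (VField (Fn d M))}

theorem ymSystem_isEquivariant (h𝔨 : ∀ ξ ∈ 𝔨, S.IsKilling ξ) :
    (ymSystem S 𝔤).IsEquivariant (ℂ ⊗[ℝ] 𝔨) where
  D := equivariant_gD 𝔨 0 1
  δ := equivariant_gD 𝔨 1 2
  K := (equivariant_gD 𝔨 _ _).comp (equivariant_gHodge h𝔨 _ _)
  Q := (equivariant_bracket 𝔨 _ _ _).comp (equivariant_gHodge h𝔨 _ _).lTensor
  br := equivariant_bracket 𝔨 1 1 2
  actV := equivariant_bracket 𝔨 0 1 1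

variable (S) (T : DrinfeldTwist (ℂ ⊗[ℝ] 𝔨)) (A : Ser (Om d M 𝔤 1))

theorem maurerCartan_val :
    (maurerCartan S T A).val = serMap (ymSystem S 𝔤).ell1 A
      + (-(1 / 2) : ℂ) • serMap (ymSystem S 𝔤).ell2 (T.starTensor A A)
      + (-(1 / 6) : ℂ) • serMap (ymSystem S 𝔤).ell3 (T.starTensor (T.starTensor A A) A) := by
  rw [← ell2Field_eq, ← ell3Field_eq]
  rfl

theorem extraTermsJet_val :
    (extraTermsJet S T A).val
      = serMap (ymSystem S 𝔤).extra (T.starTensor (T.starTensor A A) A) := by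
  rw [← extra_eq_cubic]
  rfl

theorem extraTermsJet_delta (l : Ser (Om d M 𝔤 0)) :
    (extraTermsJet S T A).delta l = serMap (ymSystem S 𝔤).extra ((fieldJet₃ T A).delta l) := by
  rw [← extra_eq_cubic, extraTermsJet, Jet.delta_add, Jet.delta_add, Jet.delta_smul,
    Jet.delta_smul, Jet.delta_smul, Jet.delta_map, Jet.delta_map, Jet.delta_map]
  rfl

theorem maurerCartan_delta (l : Ser (Om d M 𝔤 0)) :
    (maurerCartan S T A).delta l = serMap (ymSystem S 𝔤).ell1 ((fieldJet T A).delta l)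
      + (-(1 / 2) : ℂ) • serMap (ymSystem S 𝔤).ell2 ((fieldJet₂ T A).delta l)
      + (-(1 / 6) : ℂ) • serMap (ymSystem S 𝔤).ell3 ((fieldJet₃ T A).delta l) := by
  rw [← ell2Field_eq, ← ell3Field_eq, maurerCartan, Jet.delta_add, Jet.delta_add, Jet.delta_smul,
    Jet.delta_smul, Jet.delta_map, Jet.delta_map, Jet.delta_map]
  rfl

theorem brStar_gHodge_right (h𝔨 : ∀ ξ ∈ 𝔨, S.IsKilling ξ) (φ : Ser (Om d M 𝔤 2)) :
    brStar T (d - 1) A (serMap (gHodge S 𝔤 2 (d - 2)) φ)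
      = serMap (ymSystem S 𝔤).Q (T.starTensor A φ) :=
  GaugeSystem.serMap_starTensor_factor T A (equivariant_gHodge h𝔨 _ _) φ

theorem cubicL_starTensor (h𝔨 : ∀ ξ ∈ 𝔨, S.IsKilling ξ) :
    brStar T (d - 1) A (serMap (gHodge S 𝔤 2 (d - 2)) (brStar T 2 A A))
      = serMap (cubicL S 𝔤) (T.starTensor (T.starTensor A A) A) :=
  GaugeSystem.serMap_starTensor_factor_cubL T A (equivariant_gHodge h𝔨 _ _)
    (equivariant_bracket 𝔨 1 1 2)

theorem cubicR_starTensor (h𝔨 : ∀ ξ ∈ 𝔨, S.IsKilling ξ) :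
    brStar T (d - 1) (serMap (gHodge S 𝔤 2 (d - 2)) (brStar T 2 A A)) A
      = serMap (cubicR S 𝔤) (T.starTensor (T.starTensor A A) A) :=
  GaugeSystem.serMap_starTensor_factor_cubR T A (equivariant_gHodge h𝔨 _ _)
    (equivariant_bracket 𝔨 1 1 2)

theorem cubicBraided_eq (h𝔨 : ∀ ξ ∈ 𝔨, S.IsKilling ξ) :
    cubicBraided S T A = serMap (cubicM S 𝔤) (T.starTensor (T.starTensor A A) A) :=
  GaugeSystem.serApply_twisted_idTensor_factor T A (equivariant_gHodge h𝔨 _ _)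
    (equivariant_bracket 𝔨 1 1 2)

theorem extraTerms_eq (h𝔨 : ∀ ξ ∈ 𝔨, S.IsKilling ξ) :
    extraTerms S T A
      = serMap (ymSystem S 𝔤).extra (T.starTensor (T.starTensor A A) A) := by
  rw [extraTerms, cubicBraided_eq S T A h𝔨, cubicL_starTensor S T A h𝔨,
    cubicR_starTensor S T A h𝔨, ← extra_eq_cubic]
  exact GaugeSystem.serMap_add_sub_add _ _ _ _ _ _ _

theorem covDL_gHodge (h𝔨 : ∀ ξ ∈ 𝔨, S.IsKilling ξ) (φ : Ser (Om d M 𝔤 2)) :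
    covDL T A (d - 1) (serMap (gHodge S 𝔤 2 (d - 2)) φ)
      = serMap (ymSystem S 𝔤).K φ + serMap (ymSystem S 𝔤).Q (T.starTensor A φ) := by
  rw [covDL, brStar_gHodge_right S T A h𝔨]
  rfl

theorem covDR_gHodge (h𝔨 : ∀ ξ ∈ 𝔨, S.IsKilling ξ) (φ : Ser (Om d M 𝔤 2)) :
    covDR T A (d - 1) (serMap (gHodge S 𝔤 2 (d - 2)) φ)
      = serMap (ymSystem S 𝔤).K φ
        + serMap ((ymSystem S 𝔤).Q ∘ₗ (TensorProduct.comm ℂ _ _).toLinearMap)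
          (T.starTensor φ A) := by
  rw [covDR, GaugeSystem.serApply_twisted_braidTensor_factor T A (equivariant_gHodge h𝔨 _ _)]
  rfl

end YangMillsSystem

end BraidedYM

end

/-! ### The braided Yang–Mills theorem. -/

open BraidedYM in
theorem mainTheorem4 {d : ℕ} {M : Type*} [TopologicalSpace M]
    [ChartedSpace (EuclideanSpace ℝ (Fin d)) M]
    [IsManifold 𝓘(ℝ, EuclideanSpace ℝ (Fin d)) ∞ M] [T2Space M] [SigmaCompactSpace M]
    (S : OrientedLorentzian d M)
    {𝔤 : Type*} [LieRing 𝔤] [LieAlgebra ℝ 𝔤]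
    (𝔨 : LieSubalgebra ℝ (VField (Fn d M))) (h𝔨 : ∀ ξ ∈ 𝔨, S.IsKilling ξ)
    (T : DrinfeldTwist (ℂ ⊗[ℝ] 𝔨)) (A : Ser (Om d M 𝔤 1)) :
    ((maurerCartan S T A).val
        = (1 / 2 : ℂ) • (covDL T A (d - 1) (serMap (gHodge S 𝔤 2 (d - 2)) (curvature T A))
            + covDR T A (d - 1) (serMap (gHodge S 𝔤 2 (d - 2)) (curvature T A)))
          + extraTerms S T A) ∧
    (extraTerms S T A 0 = 0 ∧ (T.rMatrix = 1 → extraTerms S T A = 0)) ∧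
    (∀ lam : Ser (Om d M 𝔤 0),
      (maurerCartan S T A).delta lam = -brStar T (d - 1) lam (maurerCartan S T A).val) ∧
    ((extraTermsJet S T A).val = extraTerms S T A ∧
      ∀ lam : Ser (Om d M 𝔤 0),
        (extraTermsJet S T A).delta lam = -brStar T (d - 1) lam (extraTerms S T A)) := by
  have hG := ymSystem_isEquivariant (𝔤 := 𝔤) h𝔨
  refine ⟨?_, ⟨?_, fun hR => ?_⟩, fun lam => ?_, ?_, fun lam => ?_⟩
  · rw [maurerCartan_val, extraTerms_eq S T A h𝔨, covDL_gHodge S T A h𝔨, covDR_gHodge S T A h𝔨]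
    exact GaugeSystem.braided_yangMills T A hG rfl
  · rw [extraTerms_eq S T A h𝔨]
    exact GaugeSystem.extra_starTensor_zero T A
  · rw [extraTerms_eq S T A h𝔨]
    exact GaugeSystem.extra_starTensor_of_rMatrix_eq_one T A hR
  · rw [maurerCartan_delta, maurerCartan_val]
    exact GaugeSystem.delta_maurerCartan T A lam hG
  · rw [extraTermsJet_val, extraTerms_eq S T A h𝔨]
  · rw [extraTermsJet_delta, extraTerms_eq S T A h𝔨]
    exact GaugeSystem.delta_extra T A lam hG
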